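/- **Flips.** Let $P$ be a finite set of points in the plane. An *edge* is a line segment between two distinct points of $P$. An *odd matching* on $P$ is a set of edges with pairwise distinct endpoints, no two of which cross (as closed segments they have no common point), such that exactly one point of $P$, the isolated point, is not an endpoint of any edge. A *flip* turns an odd matching on $P$ into another odd matching on $P$ by removing one edge and inserting another one, which is incident to the isolated point. A *flip sequence of length $k$* consists of $k$ consecutive flips. **Planar Monotone 3SAT.** An instance $\Phi$ has variables $x_1,\dots,x_V$ and clauses $c_1,\dots,c_C$, each clause consisting of at most three literals which are all positive or all negative, and it is given with a rectilinear representation on an integer grid with columns $0,\dots,n-1$: variable $x_i$ occupies the columns $[l_{x_i},r_{x_i}]$ of a horizontal line, with $r_{x_i}<l_{x_{i+1}}$; clause $c$ is a horizontal bar over the columns $[l_c,r_c]$ at distance $h_c\in\{1,\dots,H\}$ from this line, above it if $c$ is positive and below it if $c$ is negative; bars of clauses are pairwise disjoint; for each variable $x$ of $c$ the bars of $x$ and $c$ are joined by a vertical segment in a column $k_{c,x}\in[l_x,r_x]\cap[l_c,r_c]$ that meets no other clause bar. **Construction.** Put $m=(H+1)C$, $S=2n+8$, $G=4S(m+1)$.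 Each variable and each clause is a *gadget* $g$ over the columns $[l_g,r_g]$. Variable gadgets have row $\rho_g=0$; the gadget of $c_j$ ($j=1,\dots,C$) has row $\pm(h_{c_j}C+j-1)$, with sign $+$ for positive and $-$ for negative clauses. With $L_g=4(r_g-l_g)+3$, the gadget $g$ has the $2L_g$ vertices $\bigl(G(4l_g-1+t),\,S\rho_g\pm1\bigr)$, $0\le t<L_g$. Numbered $p_0,\dots,p_{2L_g-1}$ cyclically clockwise along this rectangle, starting at the upper left corner, they give the blue edges $p_{2j}p_{2j+1}$ and the red edges $p_{2j+1}p_{2j+2}$ (indices modulo $2L_g$), $0\le j<L_g$. The *happy edges* are the following: - for each gadget $g$, the segment from $(G(4l_g-1)+1,\,S\rho_g)$ to $(G(4r_g+1)-1,\,S\rho_g)$; - for each integer $w$ with $-m\le w<m$, with $b_w=Sw+n+3$, the segments from $(4Gk+1,\,b_w+i)$ to $(4G(k+1)-1,\,b_w+i)$ for $i\in\{0,1\}$ and $-1\le k<n$; - for each such $w$ and each $0\le k<n$, the segment from $(4Gk-3,\,b_w+2)$ to $(4Gk+3,\,b_w+2)$, unless column $k$ is open at $w$, i.e. $k=k_{c,x}$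 for some clause $c$ with a variable $x$ such that the row $\rho$ of $c$ satisfies $0\le w<\rho$ or $\rho\le w<0$. The point set $P$ consists of the point $(-3G,0)$, all gadget vertices, and all endpoints of happy edges. $M$ consists of all happy and all blue edges, $M'$ of all happy and all red edges. **Proposition.** For every instance $\Phi$ of Planar Monotone 3SAT with $V$ variables and $C$ clauses, given with a rectilinear representation, the sets $M$ and $M'$ constructed above are odd matchings on $P$, and there is a flip sequence from $M$ to $M'$ of length exactly $\tfrac12|M\triangle M'|+V+C$ if and only if $\Phi$ is satisfiable. -/

import Mathlib

namespace OddFlip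

/-! ### Odd matchings on point sets in the plane and geometric flips -/

/-- The Euclidean plane, as coordinate pairs (only its affine structure is used). -/
abbrev Plane : Type := ℝ × ℝ

/-- The closed line segment spanned by an edge (an unordered pair of points). -/
def edgeSegment (e : Sym2 Plane) : Set Plane :=
  {x | ∃ p q : Plane, e = s(p, q) ∧ x ∈ segment ℝ p q}

/-- Two distinct edges cross if their segments share a point that is not a common endpoint. -/
def Cross (e f : Sym2 Plane) : Prop :=
  e ≠ f ∧ ∃ x ∈ edgeSegment e ∩ edgeSegment f, ¬ (x ∈ e ∧ x ∈ f)

/-- `p` is a point of `P` that is not an endpoint of any edge of `M`. -/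
def IsIsolated (P : Finset Plane) (M : Finset (Sym2 Plane)) (p : Plane) : Prop :=
  p ∈ P ∧ ∀ e ∈ M, p ∉ e

/-- `M` is an odd matching on `P`: a plane matching that leaves exactly one point isolated. -/
structure IsOddMatching (P : Finset Plane) (M : Finset (Sym2 Plane)) : Prop where
  edge_not_diag : ∀ e ∈ M, ¬ e.IsDiag
  edge_mem : ∀ e ∈ M, ∀ p ∈ e, p ∈ P
  matching : ∀ e ∈ M, ∀ f ∈ M, ∀ p, p ∈ e → p ∈ f → e = f
  plane : ∀ e ∈ M, ∀ f ∈ M, ¬ Cross e f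
  isolated : ∃! p, IsIsolated P M p

/-- A geometric flip between odd matchings: one edge is removed and another one, incident to the
isolated point, is inserted. -/
def Flip (P : Finset Plane) (M N : Finset (Sym2 Plane)) : Prop :=
  IsOddMatching P M ∧ IsOddMatching P N ∧
    ∃ e ∈ M, ∃ f, f ∉ M ∧ (∃ u ∈ f, IsIsolated P M u) ∧ N = insert f (M.erase e)

/-- There is a flip sequence from `M` to `N` that consists of exactly `k` flips. -/
def HasFlipSequence (P : Finset Plane) (M N : Finset (Sym2 Plane)) (k : ℕ) : Prop :=
  ∃ seq : ℕ → Finset (Sym2 Plane),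
    seq 0 = M ∧ seq k = N ∧ ∀ i < k, Flip P (seq i) (seq (i + 1))

/-! ### Planar Monotone 3SAT -/

/-- A monotone CNF formula with `V` variables and `C` clauses of at most three literals each.
Clause `c` consists of the literals `x` with `x ∈ vars c` if `positive c = true`, and of the
literals `¬ x` with `x ∈ vars c` if `positive c = false`. -/
structure Monotone3CNF (V C : ℕ) where
  positive : Fin C → Bool
  vars : Fin C → Finset (Fin V)
  card_le : ∀ c, (vars c).card ≤ 3

/-- Some truth assignment makes at least one literal of every clause true. -/
def Monotone3CNF.Satisfiable {V C : ℕ} (Φ : Monotone3CNF V C) : Prop :=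
  ∃ a : Fin V → Bool, ∀ c, ∃ x ∈ Φ.vars c, a x = Φ.positive c

/-- A rectilinear representation of a monotone formula on an integer grid with columns
`0, …, width - 1`. The variables are drawn on a horizontal line, from left to right, variable `x`
over the columns `varLeft x, …, varRight x`. Clause `c` is a horizontal bar over the columns
`clauseLeft c, …, clauseRight c` at distance `height c ≥ 1` from the line of the variables, above
this line if `c` is positive and below it if `c` is negative. For `x ∈ vars c`, the bars of `x`
and `c` are joined by a vertical segment in column `leg c x`. Bars are pairwise disjoint, and a
vertical segment meets no clause bar but its own; so the vertical segments on one side of the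
line of the variables are pairwise disjoint, too. -/
structure RectilinearRep {V C : ℕ} (Φ : Monotone3CNF V C) where
  width : ℕ
  maxHeight : ℕ
  varLeft : Fin V → ℕ
  varRight : Fin V → ℕ
  clauseLeft : Fin C → ℕ
  clauseRight : Fin C → ℕ
  height : Fin C → ℕ
  leg : Fin C → Fin V → ℕ
  var_le : ∀ x, varLeft x ≤ varRight x
  var_lt_width : ∀ x, varRight x < width
  var_disjoint : ∀ x y, x < y → varRight x < varLeft y
  clause_le : ∀ c, clauseLeft c ≤ clauseRight c
  clause_lt_width : ∀ c, clauseRight c < width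
  height_pos : ∀ c, 1 ≤ height c
  height_le : ∀ c, height c ≤ maxHeight
  clause_disjoint : ∀ c d, c ≠ d → Φ.positive c = Φ.positive d → height c = height d →
    clauseRight c < clauseLeft d ∨ clauseRight d < clauseLeft c
  leg_var : ∀ c, ∀ x ∈ Φ.vars c, varLeft x ≤ leg c x ∧ leg c x ≤ varRight x
  leg_clause : ∀ c, ∀ x ∈ Φ.vars c, clauseLeft c ≤ leg c x ∧ leg c x ≤ clauseRight c
  leg_avoids : ∀ c, ∀ x ∈ Φ.vars c, ∀ d, Φ.positive c = Φ.positive d → height d < height c →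
    leg c x < clauseLeft d ∨ clauseRight d < leg c x

/-! ### The odd matchings of a rectilinear representation -/

/-- The point with integer coordinates `(x, y)`. -/
def pt (x y : ℤ) : Plane := ((x : ℝ), (y : ℝ))

namespace RectilinearRep

variable {V C : ℕ} {Φ : Monotone3CNF V C} (R : RectilinearRep Φ)

/-- All rows used by the gadgets have absolute value below `maxRow`. -/
def maxRow : ℕ := (R.maxHeight + 1) * C

/-- Vertical distance of consecutive rows. -/
def rowDist : ℕ := 2 * R.width + 8

/-- Horizontal distance of consecutive vertices of a gadget. Column `k` of the representation is
placed at the `x`-coordinate `4 * unit * k`. -/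
def unit : ℕ := 4 * R.rowDist * (R.maxRow + 1)

/-- There is one gadget for each variable and one for each clause. -/
abbrev Gadget (_R : RectilinearRep Φ) : Type := Fin V ⊕ Fin C

/-- First column of a gadget. -/
def left : R.Gadget → ℕ := Sum.elim R.varLeft R.clauseLeft

/-- Last column of a gadget. -/
def right : R.Gadget → ℕ := Sum.elim R.varRight R.clauseRight

/-- The row of a clause gadget: above the variables for positive clauses, below for negative ones;
ordered by the height in the representation, clauses of the same height by their index. -/
def clauseRow (c : Fin C) : ℤ :=
  if Φ.positive c then ((R.height c * C + c.val : ℕ) : ℤ) else -((R.height c * C + c.val : ℕ) : ℤ)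

/-- The row of a gadget; all variable gadgets are in row `0`. -/
def row : R.Gadget → ℤ := Sum.elim (fun _ => 0) R.clauseRow

/-- Number of vertices on the upper side of a gadget, and also on its lower side. -/
def len (g : R.Gadget) : ℕ := 4 * (R.right g - R.left g) + 3

/-- The `2 * len g` vertices of a gadget in cyclic (clockwise) order along a rectangle: the upper
side from left to right, then the lower side from right to left. -/
def vertex (g : R.Gadget) (j : ℕ) : Plane :=
  if j < R.len g then
    pt (R.unit * (4 * R.left g - 1 + j)) (R.rowDist * R.row g + 1)
  else
    pt (R.unit * (4 * R.left g - 1 + (2 * R.len g - 1 - j))) (R.rowDist * R.row g - 1)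

/-- The edges of the gadget's cycle that belong to the initial matching only. -/
noncomputable def blue (g : R.Gadget) : Finset (Sym2 Plane) :=
  (Finset.range (R.len g)).image fun j => s(R.vertex g (2 * j), R.vertex g (2 * j + 1))

/-- The edges of the gadget's cycle that belong to the target matching only. -/
noncomputable def red (g : R.Gadget) : Finset (Sym2 Plane) :=
  (Finset.range (R.len g)).image fun j =>
    s(R.vertex g (2 * j + 1), R.vertex g ((2 * j + 2) % (2 * R.len g)))

/-- The happy edge inside the cycle of a gadget. -/
def bar (g : R.Gadget) : Sym2 Plane :=
  s(pt (R.unit * (4 * R.left g - 1) + 1) (R.rowDist * R.row g),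
    pt (R.unit * (4 * R.right g + 1) - 1) (R.rowDist * R.row g))

/-- The `y`-coordinate of the lowest layer of the wall between the rows `w` and `w + 1`. -/
def wallBase (w : ℤ) : ℤ := R.rowDist * w + R.width + 3

/-- The happy edge between the columns `k` and `k + 1` in layer `i` (`i = 0, 1`) of wall `w`. It
leaves gaps of width `2` around the columns. -/
def wallPiece (w : ℤ) (i : ℕ) (k : ℤ) : Sym2 Plane :=
  s(pt (4 * R.unit * k + 1) (R.wallBase w + i), pt (4 * R.unit * (k + 1) - 1) (R.wallBase w + i))

/-- The happy edge that closes column `k` in the uppermost layer of wall `w`. -/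
def plug (w k : ℤ) : Sym2 Plane :=
  s(pt (4 * R.unit * k - 3) (R.wallBase w + 2), pt (4 * R.unit * k + 3) (R.wallBase w + 2))

/-- Column `k` is left open in wall `w`, since the wall is traversed by a vertical segment of the
representation in that column. -/
def ColumnOpen (w k : ℤ) : Prop :=
  ∃ c, ∃ x ∈ Φ.vars c, (R.leg c x : ℤ) = k ∧
    (0 ≤ w ∧ w < R.clauseRow c ∨ R.clauseRow c ≤ w ∧ w < 0)

instance (w k : ℤ) : Decidable (R.ColumnOpen w k) := by
  unfold ColumnOpen
  infer_instance

/-- All happy edges: they belong to both matchings. -/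
noncomputable def happy : Finset (Sym2 Plane) :=
  Finset.univ.image R.bar ∪
  ((Finset.Ico (-(R.maxRow : ℤ)) R.maxRow ×ˢ Finset.range 2) ×ˢ
      Finset.Ico (-1 : ℤ) R.width).image (fun t => R.wallPiece t.1.1 t.1.2 t.2) ∪
  ((Finset.Ico (-(R.maxRow : ℤ)) R.maxRow ×ˢ Finset.Ico (0 : ℤ) R.width).filter
      (fun t => ¬ R.ColumnOpen t.1 t.2)).image (fun t => R.plug t.1 t.2)

/-- The additional isolated point to the left of the leftmost variable gadget. -/
def start : Plane := pt (-3 * R.unit) 0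

/-- The initial odd matching. -/
noncomputable def initialMatching : Finset (Sym2 Plane) :=
  R.happy ∪ Finset.univ.biUnion R.blue

/-- The target odd matching. -/
noncomputable def targetMatching : Finset (Sym2 Plane) :=
  R.happy ∪ Finset.univ.biUnion R.red

/-- The point set: the isolated point, the gadget vertices and the endpoints of happy edges. -/
noncomputable def points : Finset Plane :=
  insert R.start
    ((Finset.univ.biUnion fun g => (Finset.range (2 * R.len g)).image (R.vertex g)) ∪
      R.happy.biUnion Sym2.toFinset)

end RectilinearRep

end OddFlip

namespace OddFlip

/-! ### Segments and boxes with integer corners -/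

/-! The symmetric difference of the two matchings consists of one cycle of `2 * len g` edges per
gadget, alternately blue and red. To recolour such a cycle, the isolated point has to come in from
outside: one flip inserts an entry edge from the isolated point `u` to a vertex of the cycle, then
`len g` flips insert the red edges one after the other, and the last of them removes the entry edge
and makes `u` isolated again. This costs `len g + 1` flips per gadget, in total half of the
symmetric difference plus `V + C`.

Short sequences give assignments. All red edges must be inserted, and the flip that removes the
first blue edge of a gadget inserts no red edge. With the given length nothing else can happen
(`Moves.red_or_entry`), so the happy edges stay in place throughout (`Moves.happy_subset`), and all
vertices of one gadget that ever become isolated have the same parity (`Moves.parity`), because on a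
cycle the isolated point moves by two steps. In the columns of the representation, odd vertices are
on the upper side of a gadget and even ones on the lower side, so this parity is a truth value. The
happy edges force a clause gadget to be entered from one of its variables, on the side of the clause
(`entry_of_clause`): the first two layers of a wall let a segment pass only vertically in a column
(`exists_open_column`), plugs close the columns without a leg, and bars prevent passing through a
variable gadget. So the entry into a clause gadget exhibits a true literal.

Assignments give short sequences. Choose a true literal for each clause. The legs of these literals,
edges joining consecutive variable gadgets, the cycles and the happy edges form a plane graph
(`usedEdges_not_cross`), in which every move of the isolated point is a legal flip (`IsState.flip`).
The gadgets are recoloured depth first (`Tour.enter`): going round a variable gadget, the isolated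
point visits the clauses at their feet and the next variable at the exit corner, and returns each
time. The truth value decides whether the even or the odd vertices are visited. -/

theorem mem_edgeSegment {z p q : Plane} : z ∈ edgeSegment s(p, q) ↔ z ∈ segment ℝ p q := by
  constructor
  · rintro ⟨p', q', h, hz⟩
    rcases Sym2.eq_iff.1 h with ⟨rfl, rfl⟩ | ⟨rfl, rfl⟩
    · exact hz
    · rwa [segment_symm]
  · exact fun h => ⟨p, q, rfl, h⟩

theorem mem_edgeSegment_of_mem {z : Plane} {e : Sym2 Plane} (h : z ∈ e) : z ∈ edgeSegment e := by
  obtain ⟨q, rfl⟩ := h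
  exact mem_edgeSegment.2 (left_mem_segment ℝ z q)

theorem pt_eq_iff {a b c d : ℤ} : pt a b = pt c d ↔ a = c ∧ b = d := by
  simp [pt, Prod.ext_iff]

/-- The point `z` lies in the box `[x₁, x₂] × [y₁, y₂]`. -/
def InBox (x₁ x₂ y₁ y₂ : ℤ) (z : Plane) : Prop :=
  (x₁ : ℝ) ≤ z.1 ∧ z.1 ≤ x₂ ∧ (y₁ : ℝ) ≤ z.2 ∧ z.2 ≤ y₂

/-- Transfers a common real point of two boxes to inequalities between their integer corners.
Disjointness and crossing questions below are reduced to integer arithmetic in this way. -/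
theorem InBox.overlap {x₁ x₂ y₁ y₂ x₁' x₂' y₁' y₂' : ℤ} {z : Plane}
    (h : InBox x₁ x₂ y₁ y₂ z) (h' : InBox x₁' x₂' y₁' y₂' z) :
    x₁ ≤ x₂' ∧ x₁' ≤ x₂ ∧ y₁ ≤ y₂' ∧ y₁' ≤ y₂ := by
  obtain ⟨a, b, c, d⟩ := h
  obtain ⟨a', b', c', d'⟩ := h'
  refine ⟨?_, ?_, ?_, ?_⟩
  · exact_mod_cast a.trans b'
  · exact_mod_cast a'.trans b
  · exact_mod_cast c.trans d'
  · exact_mod_cast c'.trans d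

theorem InBox.eq_pt {x y : ℤ} {z : Plane} (h : InBox x x y y z) : z = pt x y := by
  obtain ⟨a, b, c, d⟩ := h
  exact Prod.ext (le_antisymm b a) (le_antisymm d c)

theorem inBox_pt {x y x₁ x₂ y₁ y₂ : ℤ} (h₁ : x₁ ≤ x) (h₂ : x ≤ x₂) (h₃ : y₁ ≤ y) (h₄ : y ≤ y₂) :
    InBox x₁ x₂ y₁ y₂ (pt x y) := by
  simp only [InBox, pt]
  norm_cast

theorem InBox.eq_pt_of {x y x₁ x₂ y₁ y₂ : ℤ} {z : Plane} (h : InBox x x y₁ y₂ z)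
    (h' : InBox x₁ x₂ y y z) : z = pt x y :=
  InBox.eq_pt ⟨h.1, h.2.1, h'.2.2.1, h'.2.2.2⟩

theorem convex_inBox (x₁ x₂ y₁ y₂ : ℤ) : Convex ℝ {z | InBox x₁ x₂ y₁ y₂ z} := by
  have : {z | InBox x₁ x₂ y₁ y₂ z} = Set.Icc (x₁ : ℝ) x₂ ×ˢ Set.Icc (y₁ : ℝ) y₂ := by
    ext z
    simp only [InBox, Set.mem_ofPred_eq, Set.mem_prod, Set.mem_Icc, and_assoc]
  rw [this]
  exact (convex_Icc _ _).prod (convex_Icc _ _)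

theorem inBox_of_mem {a b c d x₁ x₂ y₁ y₂ : ℤ} {z : Plane}
    (hz : z ∈ edgeSegment s(pt a c, pt b d))
    (h₁ : x₁ ≤ a) (h₂ : a ≤ x₂) (h₃ : x₁ ≤ b) (h₄ : b ≤ x₂)
    (h₅ : y₁ ≤ c) (h₆ : c ≤ y₂) (h₇ : y₁ ≤ d) (h₈ : d ≤ y₂) : InBox x₁ x₂ y₁ y₂ z := by
  exact (convex_inBox x₁ x₂ y₁ y₂).segment_subset (inBox_pt h₁ h₂ h₅ h₆) (inBox_pt h₃ h₄ h₇ h₈)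
    (mem_edgeSegment.1 hz)

/-- Multiples of `s` of distinct integers differ by at least `s`. -/
theorem mul_add_le_mul {s a b : ℤ} (hs : 0 ≤ s) (h : a < b) : s * a + s ≤ s * b := by
  nlinarith

namespace RectilinearRep

variable {V C : ℕ} {Φ : Monotone3CNF V C} (R : RectilinearRep Φ)

theorem rowDist_eq : (R.rowDist : ℤ) = 2 * R.width + 8 := by
  simp [rowDist]

theorem unit_eq : (R.unit : ℤ) = 4 * R.rowDist * (R.maxRow + 1) := by
  simp [unit]

theorem rowDist_ge : (8 : ℤ) ≤ R.rowDist := by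
  have := R.rowDist_eq; omega

theorem unit_ge : (32 : ℤ) ≤ R.unit := by
  have h := R.rowDist_ge
  rw [R.unit_eq]
  have : (0 : ℤ) ≤ R.maxRow := by positivity
  nlinarith

theorem left_le_right (g : R.Gadget) : R.left g ≤ R.right g := by
  rcases g with x | c
  · exact R.var_le x
  · exact R.clause_le c

theorem right_lt_width (g : R.Gadget) : R.right g < R.width := by
  rcases g with x | c
  · exact R.var_lt_width x
  · exact R.clause_lt_width c

theorem len_eq (g : R.Gadget) : (R.len g : ℤ) = 4 * R.right g - 4 * R.left g + 3 := by
  have := R.left_le_right g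
  simp only [len]; omega

theorem three_le_len (g : R.Gadget) : 3 ≤ R.len g := by
  simp [len]

/-! ### Rows of gadgets -/

theorem absRow_pos (c : Fin C) : 0 < R.height c * C + c.val := by
  have h := R.height_pos c
  have hC : 0 < C := c.pos
  positivity

theorem absRow_lt (c : Fin C) : R.height c * C + c.val < R.maxRow := by
  have h := R.height_le c
  have hc := c.isLt
  simp only [maxRow]
  nlinarith

/-- Since `c.val < C`, the number `height c * C + c.val` orders the clauses lexicographically, first
by height and then by index. -/
theorem height_le_of_absRow_le {c d : Fin C}
    (h : R.height d * C + d.val ≤ R.height c * C + c.val) : R.height d ≤ R.height c := by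
  by_contra hlt
  have hc := c.isLt
  have : (R.height c + 1) * C ≤ R.height d * C := Nat.mul_le_mul_right _ (by omega)
  rw [add_mul] at this
  omega

theorem absRow_inj {c d : Fin C}
    (h : R.height d * C + d.val = R.height c * C + c.val) : c = d := by
  have h₁ := R.height_le_of_absRow_le h.le
  have h₂ := R.height_le_of_absRow_le h.ge
  have h₃ : R.height c = R.height d := le_antisymm h₂ h₁
  rw [h₃] at h
  exact Fin.ext (by omega)

theorem clauseRow_of_pos {c : Fin C} (h : Φ.positive c = true) :
    R.clauseRow c = ((R.height c * C + c.val : ℕ) : ℤ) := by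
  simp [clauseRow, h]

theorem clauseRow_of_neg {c : Fin C} (h : Φ.positive c = false) :
    R.clauseRow c = -((R.height c * C + c.val : ℕ) : ℤ) := by
  simp [clauseRow, h]

theorem clauseRow_pos_iff (c : Fin C) : 0 < R.clauseRow c ↔ Φ.positive c = true := by
  have := R.absRow_pos c
  cases h : Φ.positive c
  · rw [R.clauseRow_of_neg h]; simp only [Bool.false_eq_true, iff_false]; omega
  · rw [R.clauseRow_of_pos h]; simp only [iff_true]; omega

theorem clauseRow_neg_iff (c : Fin C) : R.clauseRow c < 0 ↔ Φ.positive c = false := by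
  have := R.absRow_pos c
  cases h : Φ.positive c
  · rw [R.clauseRow_of_neg h]; simp only [iff_true]; omega
  · rw [R.clauseRow_of_pos h]; simp only [Bool.true_eq_false, iff_false]; omega

theorem clauseRow_ne_zero (c : Fin C) : R.clauseRow c ≠ 0 := by
  cases h : Φ.positive c
  · exact ((R.clauseRow_neg_iff c).2 h).ne
  · exact ((R.clauseRow_pos_iff c).2 h).ne'

theorem clauseRow_inj {c d : Fin C} (h : R.clauseRow c = R.clauseRow d) : c = d := by
  cases hc : Φ.positive c
  · have hd := (R.clauseRow_neg_iff d).1 (h ▸ (R.clauseRow_neg_iff c).2 hc)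
    rw [R.clauseRow_of_neg hc, R.clauseRow_of_neg hd] at h
    exact R.absRow_inj (by omega)
  · have hd := (R.clauseRow_pos_iff d).1 (h ▸ (R.clauseRow_pos_iff c).2 hc)
    rw [R.clauseRow_of_pos hc, R.clauseRow_of_pos hd] at h
    exact R.absRow_inj (by omega)

/-- The bounds fail to be strict only if `maxRow = 0`, that is, if there are no clauses. -/
theorem row_bounds (g : R.Gadget) : -(R.maxRow : ℤ) ≤ R.row g ∧ R.row g ≤ R.maxRow ∧
    (0 < R.maxRow → -(R.maxRow : ℤ) < R.row g ∧ R.row g < R.maxRow) := by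
  rcases g with x | c
  · simp [row]
  · have := R.absRow_lt c
    cases h : Φ.positive c
    · simp only [row, Sum.elim_inr, R.clauseRow_of_neg h]; omega
    · simp only [row, Sum.elim_inr, R.clauseRow_of_pos h]; omega

/-- A leg of a clause meets no clause bar between the clause and the variables but its own. -/
theorem eq_of_leg_mem {c d : Fin C} {x : Fin V} (hx : x ∈ Φ.vars c)
    (hrow : 0 < R.clauseRow d ∧ R.clauseRow d ≤ R.clauseRow c ∨
      R.clauseRow c ≤ R.clauseRow d ∧ R.clauseRow d < 0)
    (h₁ : R.clauseLeft d ≤ R.leg c x) (h₂ : R.leg c x ≤ R.clauseRight d) : c = d := by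
  have key : Φ.positive c = Φ.positive d ∧
      R.height d * C + d.val ≤ R.height c * C + c.val := by
    rcases hrow with ⟨ha, hb⟩ | ⟨ha, hb⟩
    · have hd := (R.clauseRow_pos_iff d).1 ha
      have hc := (R.clauseRow_pos_iff c).1 (ha.trans_le hb)
      rw [R.clauseRow_of_pos hc, R.clauseRow_of_pos hd] at hb
      exact ⟨hc.trans hd.symm, by omega⟩
    · have hd := (R.clauseRow_neg_iff d).1 hb
      have hc := (R.clauseRow_neg_iff c).1 (ha.trans_lt hb)
      rw [R.clauseRow_of_neg hc, R.clauseRow_of_neg hd] at ha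
      exact ⟨hc.trans hd.symm, by omega⟩
  obtain ⟨hp, hle⟩ := key
  by_contra hne
  have hl := R.leg_clause c x hx
  rcases (R.height_le_of_absRow_le hle).lt_or_eq with hlt | heq
  · have := R.leg_avoids c x hx d hp hlt
    omega
  · have := R.clause_disjoint c d hne hp heq.symm
    omega

theorem eq_of_mem_columns {x y : Fin V} {k : ℤ} (h₁ : (R.varLeft x : ℤ) ≤ k)
    (h₂ : k ≤ R.varRight x) (h₃ : (R.varLeft y : ℤ) ≤ k) (h₄ : k ≤ R.varRight y) : x = y := by
  rcases lt_trichotomy x y with h | h | h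
  · have := R.var_disjoint x y h; omega
  · exact h
  · have := R.var_disjoint y x h; omega

/-! ### Coordinates of gadgets -/

/-- The `x`-coordinate of the vertices in position `t` on the two sides of a gadget. -/
def abscissa (g : R.Gadget) (t : ℤ) : ℤ := R.unit * (4 * R.left g - 1 + t)

theorem abscissa_mono (g : R.Gadget) {s t : ℤ} (h : s ≤ t) : R.abscissa g s ≤ R.abscissa g t := by
  have := R.unit_ge
  unfold abscissa
  nlinarith

theorem abscissa_lt (g : R.Gadget) {s t : ℤ} (h : s < t) :
    R.abscissa g s + R.unit ≤ R.abscissa g t := by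
  have := R.unit_ge
  unfold abscissa
  nlinarith

theorem abscissa_last (g : R.Gadget) :
    R.abscissa g (R.len g - 1) = R.unit * (4 * R.right g + 1) := by
  unfold abscissa
  rw [R.len_eq]
  ring

theorem vertex_upper (g : R.Gadget) {j : ℕ} (h : j < R.len g) :
    R.vertex g j = pt (R.abscissa g j) (R.rowDist * R.row g + 1) := by
  simp [vertex, h, abscissa]

theorem vertex_lower (g : R.Gadget) {j : ℕ} (h : R.len g ≤ j) :
    R.vertex g j = pt (R.abscissa g (2 * R.len g - 1 - j)) (R.rowDist * R.row g - 1) := by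
  simp [vertex, h.not_gt, abscissa]

/-- The closed box spanned by the vertices of a gadget. -/
def InGadgetBox (g : R.Gadget) (z : Plane) : Prop :=
  InBox (R.unit * (4 * R.left g - 1)) (R.unit * (4 * R.right g + 1))
    (R.rowDist * R.row g - 1) (R.rowDist * R.row g + 1) z

/-- Distinct rows are at least 8 apart, more than the combined half-widths `1 + 3` of the two
strips. -/
theorem row_eq_of_overlap {v w a b : ℤ} (h₁ : R.rowDist * v - 1 ≤ R.rowDist * w + a)
    (h₂ : R.rowDist * w - b ≤ R.rowDist * v + 1) (ha : a ≤ 3) (hb : b ≤ 3) : v = w := by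
  have hS := R.rowDist_ge
  rcases lt_trichotomy v w with h | h | h
  · have := mul_add_le_mul (by omega : (0 : ℤ) ≤ R.rowDist) h; omega
  · exact h
  · have := mul_add_le_mul (by omega : (0 : ℤ) ≤ R.rowDist) h; omega

theorem eq_of_row_eq_of_columns {g h : R.Gadget} (hrow : R.row g = R.row h)
    (h₁ : R.left g ≤ R.right h) (h₂ : R.left h ≤ R.right g) : g = h := by
  rcases g with x | c <;> rcases h with y | d
  · simp only [left, right, Sum.elim_inl] at h₁ h₂
    rcases lt_trichotomy x y with h | h | h
    · have := R.var_disjoint x y h; omega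
    · rw [h]
    · have := R.var_disjoint y x h; omega
  · exact absurd hrow.symm (R.clauseRow_ne_zero d)
  · exact absurd hrow (R.clauseRow_ne_zero c)
  · rw [R.clauseRow_inj hrow]

/-- A gadget exceeds its columns by one unit on each side, while columns are four units apart. Boxes
in the same row therefore meet only if the column ranges do. -/
theorem eq_of_inGadgetBox {g h : R.Gadget} {z : Plane} (hg : R.InGadgetBox g z)
    (hh : R.InGadgetBox h z) : g = h := by
  obtain ⟨h₁, h₂, h₃, h₄⟩ := InBox.overlap hg hh
  have hG := R.unit_ge
  have hrow : R.row g = R.row h := R.row_eq_of_overlap h₃ h₄ (by norm_num) (by norm_num)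
  have h₅ : (4 * R.left g - 1 : ℤ) ≤ 4 * R.right h + 1 := le_of_mul_le_mul_left h₁ (by omega)
  have h₆ : (4 * R.left h - 1 : ℤ) ≤ 4 * R.right g + 1 := le_of_mul_le_mul_left h₂ (by omega)
  exact R.eq_of_row_eq_of_columns hrow (by omega) (by omega)

theorem vertex_inGadgetBox (g : R.Gadget) {j : ℕ} (h : j < 2 * R.len g) :
    R.InGadgetBox g (R.vertex g j) := by
  have h₀ : R.abscissa g 0 = R.unit * (4 * R.left g - 1) := by simp [abscissa]
  rw [InGadgetBox, ← h₀, ← R.abscissa_last]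
  rcases lt_or_ge j (R.len g) with hj | hj
  · rw [R.vertex_upper g hj]
    refine inBox_pt (R.abscissa_mono g (by omega)) (R.abscissa_mono g (by omega))
      (by omega) (by omega)
  · rw [R.vertex_lower g hj]
    refine inBox_pt (R.abscissa_mono g (by omega)) (R.abscissa_mono g (by omega))
      (by omega) (by omega)

theorem abscissa_inj (g : R.Gadget) {s t : ℤ} (h : R.abscissa g s = R.abscissa g t) : s = t := by
  have hG := R.unit_ge
  rcases lt_trichotomy s t with h' | h' | h'
  · have := R.abscissa_lt g h'; omega
  · exact h'
  · have := R.abscissa_lt g h'; omega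

theorem vertex_inj {g h : R.Gadget} {i j : ℕ} (hi : i < 2 * R.len g) (hj : j < 2 * R.len h)
    (heq : R.vertex g i = R.vertex h j) : g = h ∧ i = j := by
  obtain rfl : g = h :=
    R.eq_of_inGadgetBox (R.vertex_inGadgetBox g hi) (heq ▸ R.vertex_inGadgetBox h hj)
  refine ⟨rfl, ?_⟩
  rcases lt_or_ge i (R.len g) with h₁ | h₁ <;> rcases lt_or_ge j (R.len g) with h₂ | h₂
  · rw [R.vertex_upper g h₁, R.vertex_upper g h₂, pt_eq_iff] at heq
    have := R.abscissa_inj g heq.1; omega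
  · rw [R.vertex_upper g h₁, R.vertex_lower g h₂, pt_eq_iff] at heq
    omega
  · rw [R.vertex_lower g h₁, R.vertex_upper g h₂, pt_eq_iff] at heq
    omega
  · rw [R.vertex_lower g h₁, R.vertex_lower g h₂, pt_eq_iff] at heq
    have := R.abscissa_inj g heq.1; omega

/-- The `j`-th edge of the cycle of a gadget. -/
def cycleEdge (g : R.Gadget) (j : ℕ) : Sym2 Plane :=
  s(R.vertex g j, R.vertex g ((j + 1) % (2 * R.len g)))

theorem cycleEdge_inGadgetBox (g : R.Gadget) {j : ℕ} (hj : j < 2 * R.len g) {z : Plane}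
    (hz : z ∈ edgeSegment (R.cycleEdge g j)) : R.InGadgetBox g z := by
  have hj' : (j + 1) % (2 * R.len g) < 2 * R.len g := Nat.mod_lt _ (by omega)
  exact (convex_inBox _ _ _ _).segment_subset (R.vertex_inGadgetBox g hj) (R.vertex_inGadgetBox g hj')
    (mem_edgeSegment.1 hz)

/-- Together with the next three lemmas this splits the cycle by the index `j` into the four sides
of the rectangle, so that each edge is a degenerate box. -/
theorem cycleEdge_upper (g : R.Gadget) {j : ℕ} (hj : j + 1 < R.len g) {z : Plane}
    (hz : z ∈ edgeSegment (R.cycleEdge g j)) :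
    InBox (R.abscissa g j) (R.abscissa g (j + 1))
      (R.rowDist * R.row g + 1) (R.rowDist * R.row g + 1) z := by
  rw [cycleEdge, Nat.mod_eq_of_lt (by omega), R.vertex_upper g hj,
    R.vertex_upper g (by omega)] at hz
  push_cast at hz
  have := R.abscissa_mono g (show (j : ℤ) ≤ j + 1 by omega)
  exact inBox_of_mem hz le_rfl this this le_rfl le_rfl le_rfl le_rfl le_rfl

theorem cycleEdge_right (g : R.Gadget) {j : ℕ} (hj : j + 1 = R.len g) {z : Plane}
    (hz : z ∈ edgeSegment (R.cycleEdge g j)) :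
    InBox (R.abscissa g (R.len g - 1)) (R.abscissa g (R.len g - 1))
      (R.rowDist * R.row g - 1) (R.rowDist * R.row g + 1) z := by
  rw [cycleEdge, Nat.mod_eq_of_lt (by omega), R.vertex_upper g (by omega),
    R.vertex_lower g (by omega)] at hz
  have h₁ : (j : ℤ) = R.len g - 1 := by omega
  have h₂ : (2 * R.len g - 1 - (j + 1 : ℕ) : ℤ) = R.len g - 1 := by omega
  rw [h₁, h₂] at hz
  exact inBox_of_mem hz le_rfl le_rfl le_rfl le_rfl (by omega) (by omega) (by omega) (by omega)

theorem cycleEdge_lower (g : R.Gadget) {j : ℕ} (hj : R.len g ≤ j) (hj' : j + 1 < 2 * R.len g)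
    {z : Plane} (hz : z ∈ edgeSegment (R.cycleEdge g j)) :
    InBox (R.abscissa g (2 * R.len g - 2 - j)) (R.abscissa g (2 * R.len g - 1 - j))
      (R.rowDist * R.row g - 1) (R.rowDist * R.row g - 1) z := by
  rw [cycleEdge, Nat.mod_eq_of_lt (by omega), R.vertex_lower g hj,
    R.vertex_lower g (by omega)] at hz
  have h₂ : (2 * R.len g - 1 - (j + 1 : ℕ) : ℤ) = 2 * R.len g - 2 - j := by push_cast; ring
  rw [h₂] at hz
  have := R.abscissa_mono g (show (2 * R.len g - 2 - j : ℤ) ≤ 2 * R.len g - 1 - j by omega)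
  exact inBox_of_mem hz this le_rfl le_rfl this le_rfl le_rfl le_rfl le_rfl

theorem cycleEdge_left (g : R.Gadget) {j : ℕ} (hj : j + 1 = 2 * R.len g) {z : Plane}
    (hz : z ∈ edgeSegment (R.cycleEdge g j)) :
    InBox (R.abscissa g 0) (R.abscissa g 0)
      (R.rowDist * R.row g - 1) (R.rowDist * R.row g + 1) z := by
  have := R.three_le_len g
  rw [cycleEdge, hj, Nat.mod_self, R.vertex_lower g (j := j) (by omega),
    R.vertex_upper g (by omega)] at hz
  have h₁ : (2 * R.len g - 1 - j : ℤ) = 0 := by omega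
  rw [h₁] at hz
  exact inBox_of_mem hz le_rfl le_rfl le_rfl le_rfl (by omega) (by omega) (by omega) (by omega)

/-- A lattice point on the cycle of a gadget that is not on the level of its bar is a vertex. -/
theorem mem_cycleEdge_of_lattice (g : R.Gadget) {j : ℕ} (hj : j < 2 * R.len g) {a y : ℤ}
    (hz : pt (R.unit * a) y ∈ edgeSegment (R.cycleEdge g j))
    (hy : y ≠ R.rowDist * R.row g) : pt (R.unit * a) y ∈ R.cycleEdge g j := by
  have hG := R.unit_ge
  have hself : InBox (R.unit * a) (R.unit * a) y y (pt (R.unit * a) y) :=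
    ⟨le_rfl, le_rfl, le_rfl, le_rfl⟩
  have key : ∀ t, R.abscissa g t ≤ R.unit * a → R.unit * a ≤ R.abscissa g (t + 1) →
      R.unit * a = R.abscissa g t ∨ R.unit * a = R.abscissa g (t + 1) := by
    intro t h₁ h₂
    have h₃ := le_of_mul_le_mul_left (show R.unit * _ ≤ R.unit * a from h₁) (by omega)
    have h₄ := le_of_mul_le_mul_left (show R.unit * a ≤ R.unit * _ from h₂) (by omega)
    rcases h₃.eq_or_lt with h | h
    · left; rw [abscissa, h]
    · right; rw [abscissa]; congr 1; omega
  rcases lt_or_ge (j + 1) (R.len g) with h | h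
  · obtain ⟨h₁, h₂, h₃, h₄⟩ := InBox.overlap hself (R.cycleEdge_upper g h hz)
    rw [cycleEdge, Nat.mod_eq_of_lt (by omega), R.vertex_upper g h,
      R.vertex_upper g (by omega), Sym2.mem_iff, pt_eq_iff, pt_eq_iff]
    push_cast
    rcases key _ h₂ h₁ with h | h
    · exact Or.inl ⟨h, by omega⟩
    · exact Or.inr ⟨h, by omega⟩
  rcases h.eq_or_lt with h | h
  · obtain ⟨h₁, h₂, h₃, h₄⟩ := InBox.overlap hself (R.cycleEdge_right g h.symm hz)
    rw [cycleEdge, Nat.mod_eq_of_lt (by omega), R.vertex_upper g (by omega),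
      R.vertex_lower g (by omega), Sym2.mem_iff, pt_eq_iff, pt_eq_iff]
    have e₁ : (j : ℤ) = R.len g - 1 := by omega
    have e₂ : (2 * R.len g - 1 - (j + 1 : ℕ) : ℤ) = R.len g - 1 := by omega
    rw [e₁, e₂]
    omega
  rcases lt_or_ge (j + 1) (2 * R.len g) with h' | h'
  · obtain ⟨h₁, h₂, h₃, h₄⟩ := InBox.overlap hself (R.cycleEdge_lower g (by omega) h' hz)
    rw [cycleEdge, Nat.mod_eq_of_lt (by omega), R.vertex_lower g (by omega),
      R.vertex_lower g (by omega), Sym2.mem_iff, pt_eq_iff, pt_eq_iff]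
    have e₁ : (2 * R.len g - 1 - j : ℤ) = 2 * R.len g - 2 - j + 1 := by ring
    have e₂ : (2 * R.len g - 1 - (j + 1 : ℕ) : ℤ) = 2 * R.len g - 2 - j := by push_cast; ring
    rw [e₁] at h₁ ⊢
    rw [e₂]
    rcases key _ h₂ h₁ with h | h
    · exact Or.inr ⟨h, by omega⟩
    · exact Or.inl ⟨h, by omega⟩
  · have h'' : j + 1 = 2 * R.len g := by omega
    obtain ⟨h₁, h₂, h₃, h₄⟩ := InBox.overlap hself (R.cycleEdge_left g h'' hz)
    rw [cycleEdge, h'', Nat.mod_self, R.vertex_lower g (j := j) (by omega),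
      R.vertex_upper g (j := 0) (by omega), Sym2.mem_iff, pt_eq_iff, pt_eq_iff]
    have e₁ : (2 * R.len g - 1 - j : ℤ) = 0 := by omega
    rw [e₁]
    push_cast
    omega

/-- Distinct edges of the cycle of a gadget meet in lattice points only. -/
theorem cycleEdge_meet_lattice (g : R.Gadget) {i j : ℕ} (hij : i < j) (hj : j < 2 * R.len g)
    {z : Plane} (hi : z ∈ edgeSegment (R.cycleEdge g i))
    (hj' : z ∈ edgeSegment (R.cycleEdge g j)) :
    ∃ a y : ℤ, z = pt (R.unit * a) y ∧ y ≠ R.rowDist * R.row g := by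
  have hG := R.unit_ge
  have hlen := R.three_le_len g
  have conclude : ∀ t y : ℤ, z = pt (R.abscissa g t) y → y ≠ R.rowDist * R.row g →
      ∃ a y : ℤ, z = pt (R.unit * a) y ∧ y ≠ R.rowDist * R.row g :=
    fun t y hz hy => ⟨_, y, hz, hy⟩
  rcases lt_or_ge (j + 1) (R.len g) with h₁ | h₁
  · have bi := R.cycleEdge_upper g (show i + 1 < R.len g by omega) hi
    have bj := R.cycleEdge_upper g h₁ hj'
    -- The edge `i` ends where the edge `j` begins, or before, so a common point has exactly the
    -- abscissa of position `j`.
    have := R.abscissa_mono g (show (i + 1 : ℤ) ≤ j by omega)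
    refine conclude j (R.rowDist * R.row g + 1) (InBox.eq_pt ?_) (by omega)
    exact ⟨bj.1, bi.2.1.trans (by exact_mod_cast this), bj.2.2⟩
  rcases h₁.eq_or_lt with h₁ | h₁
  · have bi := R.cycleEdge_upper g (show i + 1 < R.len g by omega) hi
    exact conclude _ _ ((R.cycleEdge_right g h₁.symm hj').eq_pt_of bi) (by omega)
  rcases lt_or_ge (j + 1) (2 * R.len g) with h₂ | h₂
  · have bj := R.cycleEdge_lower g (by omega) h₂ hj'
    rcases lt_or_ge (i + 1) (R.len g) with h₃ | h₃
    · have := (R.cycleEdge_upper g h₃ hi).overlap bj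
      omega
    rcases h₃.eq_or_lt with h₃ | h₃
    · exact conclude _ _ ((R.cycleEdge_right g h₃.symm hi).eq_pt_of bj) (by omega)
    · have bi := R.cycleEdge_lower g (show R.len g ≤ i by omega) (by omega) hi
      have := R.abscissa_mono g (show (2 * R.len g - 1 - j : ℤ) ≤ 2 * R.len g - 2 - i by omega)
      refine conclude (2 * R.len g - 1 - j) (R.rowDist * R.row g - 1) (InBox.eq_pt ?_) (by omega)
      exact ⟨le_trans (by exact_mod_cast this) bi.1, bj.2.1, bj.2.2⟩
  · have bj := R.cycleEdge_left g (by omega) hj'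
    rcases lt_or_ge (i + 1) (R.len g) with h₃ | h₃
    · exact conclude _ _ (bj.eq_pt_of (R.cycleEdge_upper g h₃ hi)) (by omega)
    rcases h₃.eq_or_lt with h₃ | h₃
    · have h₄ := (R.cycleEdge_right g h₃.symm hi).overlap bj
      have := R.abscissa_lt g (show (0 : ℤ) < R.len g - 1 by omega)
      omega
    · exact conclude _ _ (bj.eq_pt_of (R.cycleEdge_lower g (by omega) (by omega) hi)) (by omega)

/-- Different gadgets are separated by their boxes. On one cycle, common points are lattice points,
and these are endpoints of both edges. The level of the bar has to be excluded there, since the two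
vertical edges contain a lattice point on it that is no vertex. -/
theorem not_cross_cycleEdge {g h : R.Gadget} {i j : ℕ} (hi : i < 2 * R.len g)
    (hj : j < 2 * R.len h) : ¬ Cross (R.cycleEdge g i) (R.cycleEdge h j) := by
  rintro ⟨hne, z, ⟨h₁, h₂⟩, hz⟩
  obtain rfl := R.eq_of_inGadgetBox (R.cycleEdge_inGadgetBox g hi h₁)
    (R.cycleEdge_inGadgetBox h hj h₂)
  have : ∃ a y : ℤ, z = pt (R.unit * a) y ∧ y ≠ R.rowDist * R.row g := by
    rcases lt_trichotomy i j with h | h | h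
    · exact R.cycleEdge_meet_lattice g h hj h₁ h₂
    · exact absurd (h ▸ rfl) hne
    · exact R.cycleEdge_meet_lattice g h hi h₂ h₁
  obtain ⟨a, y, rfl, hy⟩ := this
  exact hz ⟨R.mem_cycleEdge_of_lattice g hi h₁ hy, R.mem_cycleEdge_of_lattice g hj h₂ hy⟩

end RectilinearRep

theorem symmDiff_union_union {α : Type*} [DecidableEq α] {H A B : Finset α} (hA : Disjoint A H)
    (hB : Disjoint B H) (hAB : Disjoint A B) : symmDiff (H ∪ A) (H ∪ B) = A ∪ B := by
  rw [Finset.disjoint_left] at hA hB hAB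
  ext e
  have a := @hA e
  have b := @hB e
  have c := @hAB e
  simp only [Finset.mem_symmDiff, Finset.mem_union]
  tauto

namespace RectilinearRep

variable {V C : ℕ} {Φ : Monotone3CNF V C} (R : RectilinearRep Φ)

/-! ### Happy edges -/

theorem mem_happy {e : Sym2 Plane} : e ∈ R.happy ↔ (∃ g, e = R.bar g) ∨
    (∃ w : ℤ, ∃ i : ℕ, ∃ k : ℤ, (-(R.maxRow : ℤ) ≤ w ∧ w < R.maxRow) ∧ i < 2 ∧
      (-1 ≤ k ∧ k < R.width) ∧ e = R.wallPiece w i k) ∨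
    (∃ w k : ℤ, (-(R.maxRow : ℤ) ≤ w ∧ w < R.maxRow) ∧ (0 ≤ k ∧ k < R.width) ∧
      ¬ R.ColumnOpen w k ∧ e = R.plug w k) := by
  simp only [happy, Finset.mem_union, Finset.mem_image, Finset.mem_filter, Finset.mem_product,
    Finset.mem_Ico, Finset.mem_range, Finset.mem_univ, true_and, Prod.exists, or_assoc]
  refine or_congr ?_ (or_congr ?_ ?_)
  · exact exists_congr fun g => eq_comm
  · refine exists_congr fun w => exists_congr fun i => exists_congr fun k => ?_
    rw [eq_comm (a := e)]
    tauto
  · refine exists_congr fun w => exists_congr fun k => ?_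
    rw [eq_comm (a := e)]
    tauto

theorem bar_inBox (g : R.Gadget) {z : Plane} (hz : z ∈ edgeSegment (R.bar g)) :
    InBox (R.unit * (4 * R.left g - 1) + 1) (R.unit * (4 * R.right g + 1) - 1)
      (R.rowDist * R.row g) (R.rowDist * R.row g) z := by
  have hG := R.unit_ge
  have := mul_add_le_mul (by omega : (0 : ℤ) ≤ R.unit)
    (show (4 * R.left g - 1 : ℤ) < 4 * R.right g + 1 by have := R.left_le_right g; omega)
  exact inBox_of_mem hz le_rfl (by omega) (by omega) le_rfl le_rfl le_rfl le_rfl le_rfl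

theorem bar_inGadgetBox (g : R.Gadget) {z : Plane} (hz : z ∈ edgeSegment (R.bar g)) :
    R.InGadgetBox g z := by
  have h := R.bar_inBox g hz
  obtain ⟨h₁, h₂, h₃, h₄⟩ := h
  push_cast at h₁ h₂ h₃ h₄
  refine ⟨?_, ?_, ?_, ?_⟩ <;> push_cast <;> linarith

theorem wallPiece_inBox (w : ℤ) (i : ℕ) (k : ℤ) {z : Plane}
    (hz : z ∈ edgeSegment (R.wallPiece w i k)) :
    InBox (4 * R.unit * k + 1) (4 * R.unit * (k + 1) - 1)
      (R.rowDist * w + R.width + 3 + i) (R.rowDist * w + R.width + 3 + i) z := by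
  have hG := R.unit_ge
  have := mul_add_le_mul (by omega : (0 : ℤ) ≤ 4 * R.unit) (show k < k + 1 by omega)
  exact inBox_of_mem hz le_rfl (by omega) (by omega) le_rfl le_rfl le_rfl le_rfl le_rfl

theorem plug_inBox (w k : ℤ) {z : Plane} (hz : z ∈ edgeSegment (R.plug w k)) :
    InBox (4 * R.unit * k - 3) (4 * R.unit * k + 3)
      (R.rowDist * w + R.width + 5) (R.rowDist * w + R.width + 5) z := by
  refine inBox_of_mem hz le_rfl (by omega) (by omega) le_rfl ?_ ?_ ?_ ?_ <;>
    simp only [wallBase] <;> omega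

/-- Walls are disjoint from the horizontal strips of the gadgets. -/
theorem wall_level_ne {v w i : ℤ} (h₀ : 0 ≤ i) (h₂ : i ≤ 2)
    (h : R.rowDist * v - 1 ≤ R.rowDist * w + R.width + 3 + i)
    (h' : R.rowDist * w + R.width + 3 + i ≤ R.rowDist * v + 1) : False := by
  -- The layers lie `width + 3` to `width + 5` above row `w`, hence at least `width + 3` below row
  -- `w + 1`.
  have hS := R.rowDist_eq
  rcases lt_or_ge w v with hlt | hge
  · have := mul_add_le_mul (by omega : (0 : ℤ) ≤ R.rowDist) hlt; omega
  · have := mul_le_mul_of_nonneg_left hge (by omega : (0 : ℤ) ≤ R.rowDist); omega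

theorem wall_level_inj {w w' i i' : ℤ} (h₀ : 0 ≤ i) (h₂ : i ≤ 2) (h₀' : 0 ≤ i') (h₂' : i' ≤ 2)
    (h : R.rowDist * w + R.width + 3 + i = R.rowDist * w' + R.width + 3 + i') :
    w = w' ∧ i = i' := by
  have hS := R.rowDist_eq
  rcases lt_trichotomy w w' with hlt | rfl | hlt
  · have := mul_add_le_mul (by omega : (0 : ℤ) ≤ R.rowDist) hlt; omega
  · exact ⟨rfl, by omega⟩
  · have := mul_add_le_mul (by omega : (0 : ℤ) ≤ R.rowDist) hlt; omega

/-- The part of the happy edges outside the gadgets: pieces and plugs of walls. -/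
def IsWallEdge (e : Sym2 Plane) : Prop :=
  ∃ w i x₁ x₂ : ℤ, (0 ≤ i ∧ i ≤ 2) ∧ ∀ z ∈ edgeSegment e,
    InBox x₁ x₂ (R.rowDist * w + R.width + 3 + i) (R.rowDist * w + R.width + 3 + i) z

theorem happy_bar_or_wall {e : Sym2 Plane} (he : e ∈ R.happy) :
    (∃ g, e = R.bar g) ∨ R.IsWallEdge e := by
  rcases R.mem_happy.1 he with h | ⟨w, i, k, -, hi, -, rfl⟩ | ⟨w, k, -, -, -, rfl⟩
  · exact Or.inl h
  · exact Or.inr ⟨w, i, _, _, by omega, fun z hz => R.wallPiece_inBox w i k hz⟩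
  · refine Or.inr ⟨w, 2, 4 * R.unit * k - 3, 4 * R.unit * k + 3, by omega, fun z hz => ?_⟩
    have := R.plug_inBox w k hz
    rwa [show R.rowDist * w + R.width + 3 + 2 = R.rowDist * w + R.width + 5 by ring]

theorem IsWallEdge.not_inBox {e : Sym2 Plane} (he : R.IsWallEdge e) {z : Plane}
    (hz : z ∈ edgeSegment e) {x₁ x₂ v : ℤ}
    (h : InBox x₁ x₂ (R.rowDist * v - 1) (R.rowDist * v + 1) z) : False := by
  obtain ⟨w, i, _, _, hi, hbox⟩ := he
  obtain ⟨-, -, h₁, h₂⟩ := h.overlap (hbox z hz)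
  exact R.wall_level_ne hi.1 hi.2 h₁ h₂

/-- Bars are separated by the gadget boxes, bars from wall edges by height, wall edges by their
layers, and edges of the same layer by their columns. -/
theorem happy_disjoint {e f : Sym2 Plane} (he : e ∈ R.happy) (hf : f ∈ R.happy) {z : Plane}
    (hze : z ∈ edgeSegment e) (hzf : z ∈ edgeSegment f) : e = f := by
  have hG := R.unit_ge
  have column : ∀ {k k' a b : ℤ}, 4 * R.unit * k - a ≤ 4 * R.unit * k' + b →
      a + b < 4 * R.unit → k ≤ k' := by
    intro k k' a b h hab
    by_contra hlt
    have := mul_add_le_mul (by omega : (0 : ℤ) ≤ 4 * R.unit) (not_le.1 hlt)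
    omega
  rcases R.happy_bar_or_wall he with ⟨g, rfl⟩ | he'
  · rcases R.happy_bar_or_wall hf with ⟨h, rfl⟩ | hf'
    · rw [R.eq_of_inGadgetBox (R.bar_inGadgetBox g hze) (R.bar_inGadgetBox h hzf)]
    · exact (IsWallEdge.not_inBox R hf' hzf (R.bar_inGadgetBox g hze)).elim
  rcases R.happy_bar_or_wall hf with ⟨h, rfl⟩ | hf'
  · exact (IsWallEdge.not_inBox R he' hze (R.bar_inGadgetBox h hzf)).elim
  rcases R.mem_happy.1 he with ⟨g, rfl⟩ | ⟨w, i, k, -, hi, -, rfl⟩ | ⟨w, k, -, -, -, rfl⟩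
  · exact (IsWallEdge.not_inBox R he' hze (R.bar_inGadgetBox g hze)).elim
  · rcases R.mem_happy.1 hf with ⟨g, rfl⟩ | ⟨w', i', k', -, hi', -, rfl⟩ | ⟨w', k', -, -, -, rfl⟩
    · exact (IsWallEdge.not_inBox R hf' hzf (R.bar_inGadgetBox g hzf)).elim
    · obtain ⟨h₁, h₂, h₃, h₄⟩ := (R.wallPiece_inBox _ _ _ hze).overlap (R.wallPiece_inBox _ _ _ hzf)
      obtain ⟨rfl, hii⟩ := R.wall_level_inj (by omega) (by omega) (by omega) (by omega)
        (le_antisymm h₃ h₄)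
      obtain rfl : i = i' := by exact_mod_cast hii
      rw [mul_add] at h₁ h₂
      obtain rfl : k = k' := le_antisymm
        (by_contra fun hlt => by
          have := mul_add_le_mul (by omega : (0 : ℤ) ≤ 4 * R.unit) (not_le.1 hlt); omega)
        (by_contra fun hlt => by
          have := mul_add_le_mul (by omega : (0 : ℤ) ≤ 4 * R.unit) (not_le.1 hlt); omega)
      rfl
    · obtain ⟨-, -, h₃, h₄⟩ := (R.wallPiece_inBox _ _ _ hze).overlap (R.plug_inBox _ _ hzf)
      have := R.wall_level_inj (w := w) (w' := w') (i := i) (i' := 2) (by omega) (by omega)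
        (by omega) (by omega) (by omega)
      omega
  · rcases R.mem_happy.1 hf with ⟨g, rfl⟩ | ⟨w', i', k', -, hi', -, rfl⟩ | ⟨w', k', -, -, -, rfl⟩
    · exact (IsWallEdge.not_inBox R hf' hzf (R.bar_inGadgetBox g hzf)).elim
    · obtain ⟨-, -, h₃, h₄⟩ := (R.plug_inBox _ _ hze).overlap (R.wallPiece_inBox _ _ _ hzf)
      have := R.wall_level_inj (w := w) (w' := w') (i := 2) (i' := i') (by omega) (by omega)
        (by omega) (by omega) (by omega)
      omega
    · obtain ⟨h₁, h₂, h₃, h₄⟩ := (R.plug_inBox _ _ hze).overlap (R.plug_inBox _ _ hzf)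
      obtain ⟨rfl, -⟩ := R.wall_level_inj (w := w) (w' := w') (i := 2) (i' := 2) (by omega)
        (by omega) (by omega) (by omega) (by omega)
      rw [le_antisymm (column h₁ (by omega)) (column h₂ (by omega))]

/-- The bar of a gadget keeps distance 1 from all four sides of its rectangle, and wall edges do not
reach the strip of the gadget. -/
theorem happy_cycleEdge_disjoint {e : Sym2 Plane} (he : e ∈ R.happy) {g : R.Gadget} {j : ℕ}
    (hj : j < 2 * R.len g) {z : Plane} (hze : z ∈ edgeSegment e)
    (hzf : z ∈ edgeSegment (R.cycleEdge g j)) : False := by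
  have hG := R.unit_ge
  have hbox := R.cycleEdge_inGadgetBox g hj hzf
  rcases R.happy_bar_or_wall he with ⟨h, rfl⟩ | he'
  · obtain rfl := R.eq_of_inGadgetBox (R.bar_inGadgetBox h hze) hbox
    have b := R.bar_inBox h hze
    have hlast := R.abscissa_last h
    have hfirst : R.abscissa h 0 = R.unit * (4 * R.left h - 1) := by simp [abscissa]
    rcases lt_or_ge (j + 1) (R.len h) with h₁ | h₁
    · have := b.overlap (R.cycleEdge_upper h h₁ hzf); omega
    rcases h₁.eq_or_lt with h₁ | h₁
    · have := b.overlap (R.cycleEdge_right h h₁.symm hzf); omega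
    rcases lt_or_ge (j + 1) (2 * R.len h) with h₂ | h₂
    · have := b.overlap (R.cycleEdge_lower h (by omega) h₂ hzf); omega
    · have := b.overlap (R.cycleEdge_left h (by omega) hzf); omega
  · exact IsWallEdge.not_inBox R he' hze hbox

theorem happy_not_isDiag {e : Sym2 Plane} (he : e ∈ R.happy) : ¬ e.IsDiag := by
  have hG := R.unit_ge
  rcases R.mem_happy.1 he with ⟨g, rfl⟩ | ⟨w, i, k, -, hi, -, rfl⟩ | ⟨w, k, -, -, -, rfl⟩
  · have := mul_add_le_mul (by omega : (0 : ℤ) ≤ R.unit)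
      (show (4 * R.left g - 1 : ℤ) < 4 * R.right g + 1 by have := R.left_le_right g; omega)
    rw [bar, Sym2.mk_isDiag_iff, pt_eq_iff]
    omega
  · have := mul_add_le_mul (by omega : (0 : ℤ) ≤ 4 * R.unit) (show k < k + 1 by omega)
    rw [wallPiece, Sym2.mk_isDiag_iff, pt_eq_iff]
    omega
  · rw [plug, Sym2.mk_isDiag_iff, pt_eq_iff]
    omega

/-- The bounds are written with `R.rowDist * 0` in order to match `IsWallEdge.not_inBox` for row
`0`. -/
theorem start_inBox : InBox (-3 * R.unit) (-3 * R.unit) (R.rowDist * 0 - 1) (R.rowDist * 0 + 1)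
    R.start :=
  inBox_pt le_rfl le_rfl (by omega) (by omega)

theorem start_not_inGadgetBox (g : R.Gadget) : ¬ R.InGadgetBox g R.start := by
  intro h
  have hG := R.unit_ge
  obtain ⟨h₁, -⟩ := InBox.overlap h R.start_inBox
  have := mul_le_mul_of_nonneg_left (show (-1 : ℤ) ≤ 4 * R.left g - 1 by omega)
    (by omega : (0 : ℤ) ≤ R.unit)
  omega

theorem start_not_mem_happy {e : Sym2 Plane} (he : e ∈ R.happy) : R.start ∉ e := by
  intro h
  have hz := mem_edgeSegment_of_mem h
  rcases R.happy_bar_or_wall he with ⟨g, rfl⟩ | he'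
  · exact R.start_not_inGadgetBox g (R.bar_inGadgetBox g hz)
  · exact IsWallEdge.not_inBox R he' hz R.start_inBox

/-! ### Blue and red edges -/

theorem succ_mod {L j : ℕ} (h : j < 2 * L) :
    (j + 1) % (2 * L) = if j + 1 = 2 * L then 0 else j + 1 := by
  split_ifs with h'
  · rw [h', Nat.mod_self]
  · exact Nat.mod_eq_of_lt (by omega)

/-- With the index in the form `2 * j + 0`, blue and red become the cases `ε = 0` and `ε = 1` of `2
* j + ε`. -/
theorem mem_blue {g : R.Gadget} {e : Sym2 Plane} :
    e ∈ R.blue g ↔ ∃ j < R.len g, e = R.cycleEdge g (2 * j + 0) := by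
  simp only [blue, Finset.mem_image, Finset.mem_range, cycleEdge]
  refine exists_congr fun j => and_congr_right fun hj => ?_
  rw [Nat.mod_eq_of_lt (by omega : 2 * j + 0 + 1 < 2 * R.len g), eq_comm]
  rfl

theorem mem_red {g : R.Gadget} {e : Sym2 Plane} :
    e ∈ R.red g ↔ ∃ j < R.len g, e = R.cycleEdge g (2 * j + 1) := by
  simp only [red, Finset.mem_image, Finset.mem_range, cycleEdge]
  exact exists_congr fun j => and_congr_right fun hj => eq_comm

theorem mem_cycleEdge {g : R.Gadget} {j : ℕ} {p : Plane} :
    p ∈ R.cycleEdge g j ↔ p = R.vertex g j ∨ p = R.vertex g ((j + 1) % (2 * R.len g)) :=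
  Sym2.mem_iff

/-- Every vertex of an edge of a cycle is a vertex of the gadget. -/
theorem exists_vertex_of_mem_cycleEdge {g : R.Gadget} {j : ℕ} (hj : j < 2 * R.len g) {p : Plane}
    (h : p ∈ R.cycleEdge g j) : ∃ i < 2 * R.len g, p = R.vertex g i := by
  rcases R.mem_cycleEdge.1 h with rfl | rfl
  · exact ⟨j, hj, rfl⟩
  · exact ⟨_, Nat.mod_lt _ (by omega), rfl⟩

/-- The two classes of edges of a cycle are perfect matchings of its vertices. -/
theorem exists_cycleEdge_of_vertex (g : R.Gadget) {n ε : ℕ} (hε : ε < 2) (hn : n < 2 * R.len g) :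
    ∃ j < R.len g, R.vertex g n ∈ R.cycleEdge g (2 * j + ε) := by
  have hlen := R.three_le_len g
  by_cases h : n % 2 = ε
  · exact ⟨n / 2, by omega, R.mem_cycleEdge.2 (Or.inl (by congr 1; omega))⟩
  -- Vertex `0` in the red class belongs to the last edge, which wraps around.
  · by_cases h₀ : n = 0
    · refine ⟨R.len g - 1, by omega, R.mem_cycleEdge.2 (Or.inr ?_)⟩
      rw [succ_mod (by omega), if_pos (by omega), h₀]
    · refine ⟨(n - 1) / 2, by omega, R.mem_cycleEdge.2 (Or.inr ?_)⟩
      rw [succ_mod (by omega), if_neg (by omega)]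
      congr 1; omega

/-- Different edges of a cycle with a common endpoint have consecutive indices modulo the even
number `2 * len`, hence indices of different parity. -/
theorem cycleEdge_eq_of_mem {g h : R.Gadget} {i j ε : ℕ} (hε : ε < 2) (hi : i < R.len g)
    (hj : j < R.len h) {p : Plane} (h₁ : p ∈ R.cycleEdge g (2 * i + ε))
    (h₂ : p ∈ R.cycleEdge h (2 * j + ε)) : g = h ∧ i = j := by
  have hi' : 2 * i + ε < 2 * R.len g := by omega
  have hj' : 2 * j + ε < 2 * R.len h := by omega
  have li := Nat.mod_lt (2 * i + ε + 1) (show 2 * R.len g > 0 by omega)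
  have lj := Nat.mod_lt (2 * j + ε + 1) (show 2 * R.len h > 0 by omega)
  rcases R.mem_cycleEdge.1 h₁ with rfl | rfl <;> rcases R.mem_cycleEdge.1 h₂ with h | h
  · obtain ⟨rfl, h⟩ := R.vertex_inj hi' hj' h
    exact ⟨rfl, by omega⟩
  · obtain ⟨rfl, h⟩ := R.vertex_inj hi' lj h
    rw [succ_mod hj'] at h
    split_ifs at h <;> omega
  · obtain ⟨rfl, hidx⟩ := R.vertex_inj li hj' h
    rw [succ_mod hi'] at hidx
    split_ifs at hidx <;> omega
  · obtain ⟨rfl, h⟩ := R.vertex_inj li lj h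
    rw [succ_mod hi', succ_mod hj'] at h
    refine ⟨rfl, ?_⟩
    split_ifs at h <;> omega

theorem cycleEdge_not_isDiag (g : R.Gadget) {j : ℕ} (hj : j < 2 * R.len g) :
    ¬ (R.cycleEdge g j).IsDiag := by
  rw [cycleEdge, Sym2.mk_isDiag_iff]
  intro h
  have := (R.vertex_inj hj (Nat.mod_lt _ (by omega)) h).2
  have hlen := R.three_le_len g
  rw [succ_mod hj] at this
  split_ifs at this <;> omega

/-! ### The initial and the target matching are odd matchings -/

theorem vertex_mem_points (g : R.Gadget) {j : ℕ} (hj : j < 2 * R.len g) :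
    R.vertex g j ∈ R.points := by
  simp only [points, Finset.mem_insert, Finset.mem_union, Finset.mem_biUnion, Finset.mem_univ,
    true_and, Finset.mem_image, Finset.mem_range]
  exact Or.inr (Or.inl ⟨g, j, hj, rfl⟩)

theorem start_mem_points : R.start ∈ R.points := Finset.mem_insert_self _ _

theorem mem_points_of_happy {e : Sym2 Plane} (he : e ∈ R.happy) {p : Plane} (hp : p ∈ e) :
    p ∈ R.points := by
  simp only [points, Finset.mem_insert, Finset.mem_union, Finset.mem_biUnion]
  exact Or.inr (Or.inr ⟨e, he, by simpa using hp⟩)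

theorem mem_points_cases {p : Plane} (hp : p ∈ R.points) : p = R.start ∨
    (∃ g, ∃ j < 2 * R.len g, p = R.vertex g j) ∨ ∃ e ∈ R.happy, p ∈ e := by
  simp only [points, Finset.mem_insert, Finset.mem_union, Finset.mem_biUnion, Finset.mem_univ,
    true_and, Finset.mem_image, Finset.mem_range] at hp
  rcases hp with h | ⟨g, j, hj, rfl⟩ | ⟨e, he, hpe⟩
  · exact Or.inl h
  · exact Or.inr (Or.inl ⟨g, j, hj, rfl⟩)
  · exact Or.inr (Or.inr ⟨e, he, by simpa using hpe⟩)

theorem mem_cycleEdge_points {g : R.Gadget} {j : ℕ} (hj : j < 2 * R.len g) {p : Plane}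
    (h : p ∈ R.cycleEdge g j) : p ∈ R.points := by
  obtain ⟨i, hi, rfl⟩ := R.exists_vertex_of_mem_cycleEdge hj h
  exact R.vertex_mem_points g hi

theorem start_not_mem_cycleEdge {g : R.Gadget} {j : ℕ} (hj : j < 2 * R.len g) :
    R.start ∉ R.cycleEdge g j := fun h =>
  R.start_not_inGadgetBox g (R.cycleEdge_inGadgetBox g hj (mem_edgeSegment_of_mem h))

theorem not_cross_happy {e f : Sym2 Plane} (he : e ∈ R.happy) (hf : f ∈ R.happy) :
    ¬ Cross e f := fun ⟨hne, _, hz, _⟩ => hne (R.happy_disjoint he hf hz.1 hz.2)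

/-- Handles both matchings at once: together with the happy edges, either colour class covers every
point except `start` exactly once. -/
theorem isOddMatching_of_class {ε : ℕ} (hε : ε < 2) {M : Finset (Sym2 Plane)}
    (hM : ∀ e, e ∈ M ↔ e ∈ R.happy ∨ ∃ g, ∃ j < R.len g, e = R.cycleEdge g (2 * j + ε)) :
    IsOddMatching R.points M ∧ IsIsolated R.points M R.start := by
  have hiso : IsIsolated R.points M R.start := by
    refine ⟨R.start_mem_points, fun e he => ?_⟩
    rcases (hM e).1 he with he | ⟨g, j, hj, rfl⟩
    · exact R.start_not_mem_happy he
    · exact R.start_not_mem_cycleEdge (by omega)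
  refine ⟨⟨?_, ?_, ?_, ?_, R.start, hiso, ?_⟩, hiso⟩
  · intro e he
    rcases (hM e).1 he with he | ⟨g, j, hj, rfl⟩
    · exact R.happy_not_isDiag he
    · exact R.cycleEdge_not_isDiag g (by omega)
  · intro e he p hp
    rcases (hM e).1 he with he | ⟨g, j, hj, rfl⟩
    · exact R.mem_points_of_happy he hp
    · exact R.mem_cycleEdge_points (by omega) hp
  · intro e he f hf p hpe hpf
    have hze := mem_edgeSegment_of_mem hpe
    have hzf := mem_edgeSegment_of_mem hpf
    rcases (hM e).1 he with he | ⟨g, i, hi, rfl⟩ <;> rcases (hM f).1 hf with hf | ⟨h, j, hj, rfl⟩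
    · exact R.happy_disjoint he hf hze hzf
    · exact (R.happy_cycleEdge_disjoint he (by omega) hze hzf).elim
    · exact (R.happy_cycleEdge_disjoint hf (by omega) hzf hze).elim
    · obtain ⟨rfl, rfl⟩ := R.cycleEdge_eq_of_mem hε hi hj hpe hpf
      rfl
  · intro e he f hf hcross
    rcases (hM e).1 he with he | ⟨g, i, hi, rfl⟩ <;> rcases (hM f).1 hf with hf | ⟨h, j, hj, rfl⟩
    · exact R.not_cross_happy he hf hcross
    · obtain ⟨-, z, hz, -⟩ := hcross
      exact R.happy_cycleEdge_disjoint he (by omega) hz.1 hz.2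
    · obtain ⟨-, z, hz, -⟩ := hcross
      exact R.happy_cycleEdge_disjoint hf (by omega) hz.2 hz.1
    · exact R.not_cross_cycleEdge (by omega) (by omega) hcross
  · rintro p ⟨hp, hp'⟩
    rcases R.mem_points_cases hp with h | ⟨g, n, hn, rfl⟩ | ⟨e, he, hpe⟩
    · exact h
    · obtain ⟨j, hj, hmem⟩ := R.exists_cycleEdge_of_vertex g hε hn
      exact absurd hmem (hp' _ ((hM _).2 (Or.inr ⟨g, j, hj, rfl⟩)))
    · exact absurd hpe (hp' e ((hM e).2 (Or.inl he)))

theorem mem_initialMatching {e : Sym2 Plane} : e ∈ R.initialMatching ↔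
    e ∈ R.happy ∨ ∃ g, ∃ j < R.len g, e = R.cycleEdge g (2 * j + 0) := by
  simp only [initialMatching, Finset.mem_union, Finset.mem_biUnion, Finset.mem_univ, true_and,
    mem_blue]

theorem mem_targetMatching {e : Sym2 Plane} : e ∈ R.targetMatching ↔
    e ∈ R.happy ∨ ∃ g, ∃ j < R.len g, e = R.cycleEdge g (2 * j + 1) := by
  simp only [targetMatching, Finset.mem_union, Finset.mem_biUnion, Finset.mem_univ, true_and,
    mem_red]

theorem initialMatching_isOddMatching : IsOddMatching R.points R.initialMatching :=
  (R.isOddMatching_of_class (ε := 0) (by norm_num) fun _ => R.mem_initialMatching).1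

theorem initialMatching_isIsolated : IsIsolated R.points R.initialMatching R.start :=
  (R.isOddMatching_of_class (ε := 0) (by norm_num) fun _ => R.mem_initialMatching).2

theorem targetMatching_isOddMatching : IsOddMatching R.points R.targetMatching :=
  (R.isOddMatching_of_class (ε := 1) (by norm_num) fun _ => R.mem_targetMatching).1

/-! ### The size of the symmetric difference -/

/-- If the endpoints agreed in swapped order, each index would be the successor of the other, which
is impossible on a cycle of length at least 6. -/
theorem cycleEdge_inj {g h : R.Gadget} {i j : ℕ} (hi : i < 2 * R.len g) (hj : j < 2 * R.len h)
    (heq : R.cycleEdge g i = R.cycleEdge h j) : g = h ∧ i = j := by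
  have li := Nat.mod_lt (i + 1) (show 2 * R.len g > 0 by omega)
  have lj := Nat.mod_lt (j + 1) (show 2 * R.len h > 0 by omega)
  rcases Sym2.eq_iff.1 heq with ⟨h₁, -⟩ | ⟨h₁, h₂⟩
  · exact R.vertex_inj hi hj h₁
  · obtain ⟨rfl, h₁⟩ := R.vertex_inj hi lj h₁
    obtain ⟨-, h₂⟩ := R.vertex_inj li hj h₂
    have := R.three_le_len g
    rw [succ_mod hj] at h₁
    rw [succ_mod hi] at h₂
    split_ifs at h₁ h₂ <;> omega

theorem card_blue (g : R.Gadget) : (R.blue g).card = R.len g := by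
  have : R.blue g = (Finset.range (R.len g)).image fun j => R.cycleEdge g (2 * j + 0) := by
    ext e; simp [mem_blue, eq_comm]
  rw [this, Finset.card_image_of_injOn, Finset.card_range]
  intro i hi j hj h
  simp only [Finset.coe_range, Set.mem_Iio] at hi hj
  have := (R.cycleEdge_inj (by omega) (by omega) h).2
  omega

theorem card_red (g : R.Gadget) : (R.red g).card = R.len g := by
  have : R.red g = (Finset.range (R.len g)).image fun j => R.cycleEdge g (2 * j + 1) := by
    ext e; simp [mem_red, eq_comm]
  rw [this, Finset.card_image_of_injOn, Finset.card_range]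
  intro i hi j hj h
  simp only [Finset.coe_range, Set.mem_Iio] at hi hj
  have := (R.cycleEdge_inj (by omega) (by omega) h).2
  omega

theorem blue_disjoint {g h : R.Gadget} (hne : g ≠ h) : Disjoint (R.blue g) (R.blue h) := by
  rw [Finset.disjoint_left]
  rintro e he hf
  obtain ⟨i, hi, rfl⟩ := R.mem_blue.1 he
  obtain ⟨j, hj, h⟩ := R.mem_blue.1 hf
  exact hne (R.cycleEdge_inj (by omega) (by omega) h).1

theorem red_disjoint {g h : R.Gadget} (hne : g ≠ h) : Disjoint (R.red g) (R.red h) := by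
  rw [Finset.disjoint_left]
  rintro e he hf
  obtain ⟨i, hi, rfl⟩ := R.mem_red.1 he
  obtain ⟨j, hj, h⟩ := R.mem_red.1 hf
  exact hne (R.cycleEdge_inj (by omega) (by omega) h).1

theorem blue_red_disjoint (g h : R.Gadget) : Disjoint (R.blue g) (R.red h) := by
  rw [Finset.disjoint_left]
  rintro e he hf
  obtain ⟨i, hi, rfl⟩ := R.mem_blue.1 he
  obtain ⟨j, hj, h⟩ := R.mem_red.1 hf
  have := (R.cycleEdge_inj (by omega) (by omega) h).2
  omega

theorem cycleEdge_not_mem_happy {g : R.Gadget} {j : ℕ} (hj : j < 2 * R.len g) :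
    R.cycleEdge g j ∉ R.happy := fun he =>
  have hz := mem_edgeSegment_of_mem (R.mem_cycleEdge.2 (Or.inl rfl) : R.vertex g j ∈ _)
  R.happy_cycleEdge_disjoint he hj hz hz

theorem blue_happy_disjoint (g : R.Gadget) : Disjoint (R.blue g) R.happy := by
  rw [Finset.disjoint_left]
  rintro e he
  obtain ⟨i, hi, rfl⟩ := R.mem_blue.1 he
  exact R.cycleEdge_not_mem_happy (by omega)

theorem red_happy_disjoint (g : R.Gadget) : Disjoint (R.red g) R.happy := by
  rw [Finset.disjoint_left]
  rintro e he
  obtain ⟨i, hi, rfl⟩ := R.mem_red.1 he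
  exact R.cycleEdge_not_mem_happy (by omega)

theorem card_symmDiff : (symmDiff R.initialMatching R.targetMatching).card =
    2 * ∑ g, R.len g := by
  have h₁ : Disjoint (Finset.univ.biUnion R.blue) R.happy := by
    simp only [Finset.disjoint_biUnion_left]
    exact fun g _ => R.blue_happy_disjoint g
  have h₂ : Disjoint (Finset.univ.biUnion R.red) R.happy := by
    simp only [Finset.disjoint_biUnion_left]
    exact fun g _ => R.red_happy_disjoint g
  have h₃ : Disjoint (Finset.univ.biUnion R.blue) (Finset.univ.biUnion R.red) := by
    simp only [Finset.disjoint_biUnion_left, Finset.disjoint_biUnion_right]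
    exact fun g _ h _ => R.blue_red_disjoint _ _
  have : symmDiff R.initialMatching R.targetMatching =
      Finset.univ.biUnion R.blue ∪ Finset.univ.biUnion R.red :=
    symmDiff_union_union h₁ h₂ h₃
  rw [this, Finset.card_union_of_disjoint h₃,
    Finset.card_biUnion fun g _ h _ hne => R.blue_disjoint hne,
    Finset.card_biUnion fun g _ h _ hne => R.red_disjoint hne]
  simp only [card_blue, card_red]
  ring

end RectilinearRep

/-! ### Segments that avoid the happy edges -/

theorem mem_edgeSegment_horizontal {x₁ x₂ y : ℤ} {z : Plane} (h₁ : (x₁ : ℝ) ≤ z.1)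
    (h₂ : z.1 ≤ x₂) (hy : z.2 = y) : z ∈ edgeSegment s(pt x₁ y, pt x₂ y) := by
  rw [mem_edgeSegment]
  unfold pt
  rw [← Prod.image_mk_segment_left, segment_eq_Icc (h₁.trans h₂)]
  exact ⟨z.1, ⟨h₁, h₂⟩, by rw [← hy]⟩

/-- The segment is parametrised by height, so that its abscissas in consecutive layers of a wall
differ by the constant inverse slope. -/
theorem mem_segment_at_height {A B : Plane} {y : ℝ} (h : A.2 < B.2) (h₁ : A.2 ≤ y)
    (h₂ : y ≤ B.2) :
    (A.1 + (B.1 - A.1) / (B.2 - A.2) * (y - A.2), y) ∈ edgeSegment s(A, B) := by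
  rw [mem_edgeSegment, segment_eq_image']
  have h₀ : 0 < B.2 - A.2 := sub_pos.2 h
  refine ⟨(y - A.2) / (B.2 - A.2), ⟨by apply div_nonneg <;> linarith, ?_⟩, ?_⟩
  · rw [div_le_one h₀]; linarith
  · ext
    · simp only [Prod.fst_add, Prod.smul_fst, Prod.fst_sub, smul_eq_mul]
      field_simp
    · simp only [Prod.snd_add, Prod.smul_snd, Prod.snd_sub, smul_eq_mul]
      field_simp
      ring

/-- The pieces of a layer cover everything between the columns `-1` and `n` except the gaps of
half-width 1. The bounds on `x` are the abscissas of `start` and of the rightmost possible gadget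
vertex; they exclude the columns `-1` and `n` themselves. -/
theorem exists_gap {G : ℝ} {n : ℕ} (hG : 32 ≤ G) {x : ℝ} (h₁ : -3 * G ≤ x)
    (h₂ : x ≤ G * (4 * n - 3))
    (h : ∀ k : ℤ, -1 ≤ k → k < n → ¬ (4 * G * k + 1 ≤ x ∧ x ≤ 4 * G * (k + 1) - 1)) :
    ∃ k : ℤ, 0 ≤ k ∧ k < n ∧ |x - 4 * G * k| < 1 := by
  have hG' : 0 < 4 * G := by linarith
  set q := ⌊x / (4 * G)⌋ with hq
  have q₁ : 4 * G * q ≤ x := by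
    have := Int.floor_le (x / (4 * G)); rw [le_div_iff₀ hG'] at this; linarith
  have q₂ : x < 4 * G * (q + 1) := by
    have := Int.lt_floor_add_one (x / (4 * G)); rw [div_lt_iff₀ hG'] at this; linarith
  have q₃ : -1 ≤ q := by
    by_contra hlt
    have : (q : ℝ) + 1 ≤ -1 := by exact_mod_cast (by omega : q + 1 ≤ -1)
    nlinarith
  have q₄ : q < n := by
    by_contra hlt
    have : (n : ℝ) ≤ q := by exact_mod_cast (not_lt.1 hlt)
    nlinarith
  by_cases hc : 4 * G * q + 1 ≤ x
  · have hc' : 4 * G * (q + 1) - 1 < x := not_le.1 fun h' => h q q₃ q₄ ⟨hc, h'⟩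
    refine ⟨q + 1, by omega, ?_, ?_⟩
    · by_contra hlt
      have : (n : ℝ) ≤ q + 1 := by exact_mod_cast (not_lt.1 hlt)
      nlinarith
    · push_cast
      rw [abs_lt]; constructor <;> linarith
  · refine ⟨q, ?_, q₄, ?_⟩
    · by_contra hlt
      have : (q : ℝ) ≤ -1 := by exact_mod_cast (by omega : q ≤ -1)
      nlinarith
    · rw [abs_lt]; constructor <;> linarith

/-- A segment that is flat enough to change the gap within one unit of height cannot rise by
`D`. -/
theorem eq_of_gaps {G n D d x : ℝ} {k k' : ℤ} (hG : 32 ≤ G) (hn : 0 ≤ n) (hD : 2 * n + 6 ≤ D)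
    (hd : |d * D| ≤ 4 * n * G) (h : |x - 4 * G * k| < 1) (h' : |x + d - 4 * G * k'| < 1) :
    k' = k := by
  rw [abs_lt] at h h'
  by_contra hne
  -- Points in gaps of different columns are at least `4 * G - 2` apart.
  have hdG : 4 * G - 2 ≤ |d| := by
    rcases lt_or_gt_of_ne hne with hlt | hlt
    · have : (k' : ℝ) + 1 ≤ k := by exact_mod_cast hlt
      have : G * (k' + 1) ≤ G * k := mul_le_mul_of_nonneg_left this (by linarith)
      rw [le_abs]; right; linarith
    · have : (k : ℝ) + 1 ≤ k' := by exact_mod_cast hlt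
      have : G * (k + 1) ≤ G * k' := mul_le_mul_of_nonneg_left this (by linarith)
      rw [le_abs]; left; linarith
  -- At this slope, a rise by `D` would need more than the horizontal extent `4 * n * G` that is
  -- available.
  have hmul : (4 * G - 2) * (2 * n + 6) ≤ |d| * D :=
    mul_le_mul hdG hD (by linarith) (abs_nonneg _)
  rw [abs_mul, abs_of_pos (show 0 < D by linarith)] at hd
  nlinarith

/-- The lattice points of a steep segment through a gap are in the column of the gap. -/
theorem eq_of_near {G D d x s : ℝ} {k t : ℤ} (hG : 32 ≤ G) (hD : 2 * D + 1 < G)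
    (h : |x - 4 * G * k| < 1) (h' : |x + d - 4 * G * k| < 1) (hts : G * t = x + d * s)
    (hs : |s| ≤ D) : t = 4 * k := by
  rw [abs_lt] at h h'
  -- Staying in one gap of width 2 over a unit of height bounds the slope by 2. Over height `D` the
  -- abscissa stays within `2 * D + 1 < G` of the column, and the only multiple of `G` this close is
  -- the column itself.
  have hd : |d| ≤ 2 := by rw [abs_le]; constructor <;> linarith
  have h₂ : |d * s| ≤ 2 * D := by
    rw [abs_mul]
    exact mul_le_mul hd hs (abs_nonneg _) (by norm_num)
  rw [abs_le] at h₂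
  have h₃ : (t : ℝ) - 4 * k < 1 := by
    by_contra hlt
    have := mul_le_mul_of_nonneg_left (not_lt.1 hlt) (show 0 ≤ G by linarith)
    linarith
  have h₄ : (-1 : ℝ) < t - 4 * k := by
    by_contra hlt
    have := mul_le_mul_of_nonneg_left (not_lt.1 hlt) (show 0 ≤ G by linarith)
    linarith
  have h₅ : t - 4 * k < 1 := by exact_mod_cast h₃
  have h₆ : -1 < t - 4 * k := by exact_mod_cast h₄
  omega

namespace RectilinearRep

variable {V C : ℕ} {Φ : Monotone3CNF V C} (R : RectilinearRep Φ)

set_option maxHeartbeats 400000 in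
/-- A segment between lattice points in different rows that avoids the happy edges passes the
wall `w` between them in an open column, and it is vertical. -/
theorem exists_open_column {a b yA yB v v' w : ℤ} (hv : -(R.maxRow : ℤ) < v)
    (hv' : v' < R.maxRow) (ha : -3 ≤ a ∧ a ≤ 4 * R.width - 3) (hb : -3 ≤ b ∧ b ≤ 4 * R.width - 3)
    (hyA : R.rowDist * v - 1 ≤ yA ∧ yA ≤ R.rowDist * v + 1)
    (hyB : R.rowDist * v' - 1 ≤ yB ∧ yB ≤ R.rowDist * v' + 1)
    (havoid : ∀ e ∈ R.happy, ∀ z ∈ edgeSegment s(pt (R.unit * a) yA, pt (R.unit * b) yB),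
      z ∉ edgeSegment e) (hw : v ≤ w) (hw' : w < v') :
    ∃ k : ℤ, 0 ≤ k ∧ k < R.width ∧ a = 4 * k ∧ b = 4 * k ∧ R.ColumnOpen w k := by
  have hS := R.rowDist_eq
  have hS0 : (0 : ℤ) ≤ R.rowDist := by omega
  have hG := R.unit_ge
  have hGeq := R.unit_eq
  have e₁ := mul_le_mul_of_nonneg_left hw hS0
  have e₂ := mul_add_le_mul hS0 hw'
  have e₃ := mul_add_le_mul hS0 hv
  have e₄ := mul_add_le_mul hS0 hv'
  -- The space left on both sides of the layers makes the segment rise by at least `2 * width + 6`,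
  -- as needed in `eq_of_gaps`.
  have hlow : yA + R.width + 2 ≤ R.wallBase w := by rw [wallBase]; omega
  have hhigh : R.wallBase w + 2 + R.width + 2 ≤ yB := by rw [wallBase]; omega
  -- The reason for the choice of `unit`: it exceeds twice the height of the whole drawing, as
  -- needed in `eq_of_near`.
  have hheight' : 2 * (yB - yA) + 1 < R.unit := by
    have : (R.unit : ℤ) = 4 * (R.rowDist * R.maxRow) + 4 * R.rowDist := by rw [hGeq]; ring
    rw [mul_neg] at e₃
    omega
  have hdiff : yA + 2 * R.width + 6 ≤ yB := by omega
  have hGr : (32 : ℝ) ≤ (R.unit : ℝ) := by exact_mod_cast hG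
  have hlowr : (yA : ℝ) + R.width + 2 ≤ R.wallBase w := by exact_mod_cast hlow
  have hhighr : (R.wallBase w : ℝ) + 2 + R.width + 2 ≤ yB := by exact_mod_cast hhigh
  have hheightr : 2 * ((yB : ℝ) - yA) + 1 < R.unit := by exact_mod_cast hheight'
  have hdiffr : (yA : ℝ) + 2 * R.width + 6 ≤ yB := by exact_mod_cast hdiff
  have hn : (0 : ℝ) ≤ R.width := by positivity
  have ha₁ : (-3 : ℝ) ≤ a := by exact_mod_cast ha.1
  have ha₂ : (a : ℝ) ≤ 4 * R.width - 3 := by exact_mod_cast ha.2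
  have hb₁ : (-3 : ℝ) ≤ b := by exact_mod_cast hb.1
  have hb₂ : (b : ℝ) ≤ 4 * R.width - 3 := by exact_mod_cast hb.2
  set A : Plane := pt (R.unit * a) yA with hA
  set B : Plane := pt (R.unit * b) yB with hB
  have A1 : A.1 = R.unit * a := by simp [hA, pt]
  have A2 : A.2 = yA := by simp [hA, pt]
  have B1 : B.1 = R.unit * b := by simp [hB, pt]
  have B2 : B.2 = yB := by simp [hB, pt]
  have hAB : A.2 < B.2 := by rw [A2, B2]; linarith
  set d : ℝ := (B.1 - A.1) / (B.2 - A.2) with hd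
  have hdmul : d * (yB - yA) = R.unit * b - R.unit * a := by
    rw [hd, A1, A2, B1, B2]
    have : (yB : ℝ) - yA ≠ 0 := by linarith
    field_simp
  set X : ℝ → ℝ := fun i => A.1 + d * (R.wallBase w + i - A.2) with hX
  have hmem : ∀ i : ℝ, 0 ≤ i → i ≤ 2 → (X i, R.wallBase w + i) ∈ edgeSegment s(A, B) := by
    intro i h₁ h₂
    exact mem_segment_at_height hAB (by rw [A2]; linarith) (by rw [B2]; linarith)
  have hgap : ∀ i : ℕ, i < 2 → ∃ k : ℤ, 0 ≤ k ∧ k < R.width ∧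
      |X i - 4 * R.unit * k| < 1 := by
    intro i hi
    have hi' : (i : ℝ) ≤ 2 := by exact_mod_cast hi.le
    have hz := hmem i (by positivity) hi'
    have hbox := inBox_of_mem (x₁ := -3 * R.unit) (x₂ := R.unit * (4 * R.width - 3))
      (y₁ := yA) (y₂ := yB) hz (by nlinarith) (by nlinarith) (by nlinarith) (by nlinarith)
      le_rfl (by omega) (by omega) le_rfl
    obtain ⟨h₁, h₂, -⟩ := hbox
    push_cast at h₁ h₂
    refine exists_gap hGr h₁ h₂ fun k hk₁ hk₂ hk => ?_
    refine havoid (R.wallPiece w i k) (R.mem_happy.2 (Or.inr (Or.inl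
      ⟨w, i, k, ⟨by omega, by omega⟩, hi, ⟨hk₁, hk₂⟩, rfl⟩))) _ hz ?_
    exact mem_edgeSegment_horizontal (by push_cast; exact hk.1) (by push_cast; exact hk.2)
      (by push_cast; rfl)
  -- Passing the layers `0` and `1` puts the segment into gaps, and it is too steep for these to be
  -- different ones.
  obtain ⟨k, hk₀, hk₁, hk⟩ := hgap 0 (by norm_num)
  obtain ⟨k', -, -, hk'⟩ := hgap 1 (by norm_num)
  have hX1 : X (1 : ℕ) = X (0 : ℕ) + d := by simp only [hX]; push_cast; ring
  have hX2 : X 2 = X (0 : ℕ) + 2 * d := by simp only [hX]; push_cast; ring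
  rw [hX1] at hk'
  have hkk : k' = k := by
    refine eq_of_gaps hGr hn (show 2 * R.width + 6 ≤ (yB : ℝ) - yA by linarith) ?_ hk hk'
    rw [hdmul, abs_le]
    constructor <;> nlinarith
  subst hkk
  have near : ∀ (t : ℤ) (s : ℝ), (R.unit * t : ℝ) = X (0 : ℕ) + d * s → |s| ≤ yB - yA →
      t = 4 * k' := fun t s hts hs => eq_of_near hGr hheightr hk hk' hts hs
  rw [abs_lt] at hk hk'
  refine ⟨k', hk₀, hk₁, ?_, ?_, ?_⟩
  · refine near a (yA - R.wallBase w) ?_ ?_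
    · simp only [hX, A1, A2]; push_cast; ring
    · rw [abs_le]; constructor <;> linarith
  · refine near b (yB - R.wallBase w) ?_ ?_
    · simp only [hX, A1, A2]; push_cast; linarith
    · rw [abs_le]; constructor <;> linarith
  -- Being within 1 of the column in layers `0` and `1`, the segment is within 3 of it in layer `2`,
  -- where the plug has half-width 3.
  · by_contra hclosed
    refine havoid (R.plug w k') (R.mem_happy.2 (Or.inr (Or.inr
      ⟨w, k', ⟨by omega, by omega⟩, ⟨hk₀, hk₁⟩, hclosed, rfl⟩))) _
      (hmem 2 (by norm_num) le_rfl) ?_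
    refine mem_edgeSegment_horizontal ?_ ?_ (by push_cast; rfl)
    · push_cast; rw [hX2]; linarith
    · push_cast; rw [hX2]; linarith

/-! ### Entering a clause gadget -/

theorem vertex_coords (g : R.Gadget) {j : ℕ} (hj : j < 2 * R.len g) :
    ∃ t y : ℤ, R.vertex g j = pt (R.unit * (4 * R.left g - 1 + t)) y ∧ 0 ≤ t ∧ t < R.len g ∧
      (y = R.rowDist * R.row g + 1 ∧ t = j ∨
        y = R.rowDist * R.row g - 1 ∧ t = 2 * R.len g - 1 - j) := by
  rcases lt_or_ge j (R.len g) with h | h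
  · exact ⟨j, _, R.vertex_upper g h, by omega, by omega, Or.inl ⟨rfl, rfl⟩⟩
  · exact ⟨2 * R.len g - 1 - j, _, R.vertex_lower g h, by omega, by omega, Or.inr ⟨rfl, rfl⟩⟩

/-- A column that is open next to the row of a clause, on the side of the variables, and that
belongs to the bar of the clause contains a leg of this clause. -/
theorem exists_leg_of_open {e : Fin C} {w k : ℤ}
    (hw : 0 < R.clauseRow e ∧ w = R.clauseRow e - 1 ∨ R.clauseRow e < 0 ∧ w = R.clauseRow e)
    (hopen : R.ColumnOpen w k) (h₁ : (R.clauseLeft e : ℤ) ≤ k) (h₂ : k ≤ R.clauseRight e) :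
    ∃ y ∈ Φ.vars e, (R.leg e y : ℤ) = k := by
  obtain ⟨d, y, hy, hk, hrow⟩ := hopen
  have : d = e := R.eq_of_leg_mem hy (by omega) (by omega) (by omega)
  subst this
  exact ⟨y, hy, hk⟩

/-- Used to show that a clause gadget cannot be entered from the far side of a variable gadget, or
from `start`. -/
theorem vertical_meets_bar {x : Fin V} {k y₁ y₂ : ℤ} (h₁ : y₁ ≤ 0) (h₂ : 0 ≤ y₂) (hlt : y₁ < y₂)
    (hk₁ : (R.varLeft x : ℤ) ≤ k) (hk₂ : k ≤ R.varRight x) :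
    ∃ z ∈ edgeSegment s(pt (R.unit * (4 * k)) y₁, pt (R.unit * (4 * k)) y₂),
      z ∈ edgeSegment (R.bar (Sum.inl x)) := by
  have hG := R.unit_ge
  have hmem := mem_segment_at_height (A := pt (R.unit * (4 * k)) y₁)
    (B := pt (R.unit * (4 * k)) y₂) (y := 0) (by simpa [pt] using hlt) (by simpa [pt] using h₁)
    (by simpa [pt] using h₂)
  refine ⟨_, hmem, ?_⟩
  have e₁ := mul_add_le_mul (by omega : (0 : ℤ) ≤ R.unit)
    (show (4 * R.varLeft x - 1 : ℤ) < 4 * k by omega)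
  have e₂ := mul_add_le_mul (by omega : (0 : ℤ) ≤ R.unit)
    (show (4 * k : ℤ) < 4 * R.varRight x + 1 by omega)
  have e₃ : R.unit * (4 * R.varLeft x - 1 : ℤ) + 1 ≤ R.unit * (4 * k) := by omega
  have e₄ : R.unit * (4 * k) ≤ R.unit * (4 * R.varRight x + 1 : ℤ) - 1 := by omega
  rify at e₃ e₄
  refine mem_edgeSegment_horizontal ?_ ?_ ?_
  · simpa [pt, left] using e₃
  · simpa [pt, right] using e₄
  · simp [row]

/-- The only entries to a clause gadget are its legs, from the side of the clause. -/
theorem entry_of_clause {c : Fin C} {j : ℕ} (hj : j < 2 * R.len (Sum.inr c)) {u : Plane}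
    (hu : u = R.start ∨ ∃ h : R.Gadget, h ≠ Sum.inr c ∧ ∃ i < 2 * R.len h, u = R.vertex h i)
    (havoid : ∀ e ∈ R.happy, ∀ z ∈ edgeSegment s(u, R.vertex (Sum.inr c) j),
      z ∉ edgeSegment e) :
    ∃ x ∈ Φ.vars c, ∃ i < 2 * R.len (Sum.inl x), u = R.vertex (Sum.inl x) i ∧
      i % 2 = if Φ.positive c then 1 else 0 := by
  have hS := R.rowDist_ge
  have hm : 0 < R.maxRow := by
    have : 0 < C := c.pos
    simp only [maxRow]
    positivity
  have hbc := (R.row_bounds (Sum.inr c)).2.2 hm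
  obtain ⟨t, y, hc, ht₀, ht₁, hty⟩ := R.vertex_coords (Sum.inr c) hj
  have hlenc := R.len_eq (Sum.inr c)
  have hwc := R.right_lt_width (Sum.inr c)
  change _ ∧ R.clauseRow c < _ at hbc
  change -(R.maxRow : ℤ) < R.clauseRow c ∧ _ at hbc
  simp only [left, right, row, Sum.elim_inr] at hc hlenc hty hwc
  rw [hc] at havoid
  have hrow0 := R.clauseRow_ne_zero c
  -- the coordinates of `u`
  obtain ⟨v, a, yu, rfl, hv₀, hv₁, ha₀, ha₁, hy₀, hy₁, hvc, hu'⟩ : ∃ v a yu : ℤ,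
      u = pt (R.unit * a) yu ∧ -(R.maxRow : ℤ) < v ∧ v < R.maxRow ∧ -3 ≤ a ∧
      a ≤ 4 * R.width - 3 ∧ R.rowDist * v - 1 ≤ yu ∧ yu ≤ R.rowDist * v + 1 ∧
      v ≠ R.clauseRow c ∧ (v = 0 ∧ a = -3 ∨ ∃ h : R.Gadget, h ≠ Sum.inr c ∧ v = R.row h ∧
        ∃ i < 2 * R.len h, pt (R.unit * a) yu = R.vertex h i ∧ ∃ s : ℤ,
        a = 4 * R.left h - 1 + s ∧ 0 ≤ s ∧ s < R.len h ∧
        (yu = R.rowDist * v + 1 ∧ s = i ∨ yu = R.rowDist * v - 1 ∧ s = 2 * R.len h - 1 - i)) := by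
    rcases hu with rfl | ⟨h, hne, i, hi, rfl⟩
    · refine ⟨0, -3, 0, ?_, by omega, by omega, le_rfl, by omega, by omega, by omega,
        hrow0.symm, Or.inl ⟨rfl, rfl⟩⟩
      rw [start, mul_comm]
    · obtain ⟨s, yu, heq, hs₀, hs₁, hsy⟩ := R.vertex_coords h hi
      have hb := (R.row_bounds h).2.2 hm
      have hlen := R.len_eq h
      have hw := R.right_lt_width h
      refine ⟨R.row h, _, yu, heq, hb.1, hb.2, by omega, by omega, by omega, by omega, ?_,
        Or.inr ⟨h, hne, rfl, i, hi, heq.symm, s, rfl, hs₀, hs₁, hsy⟩⟩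
      rcases h with x | d
      · exact hrow0.symm
      · exact fun h => hne (by rw [R.clauseRow_inj h])
  -- Every wall between the two ends forces both of them into one column, and this column is open in
  -- the wall.
  have column : ∀ w, v ≤ w ∧ w < R.clauseRow c ∨ R.clauseRow c ≤ w ∧ w < v →
      ∃ k : ℤ, a = 4 * k ∧ 4 * R.clauseLeft c - 1 + t = 4 * k ∧ R.ColumnOpen w k := by
    intro w hw
    rcases hw with ⟨h₁, h₂⟩ | ⟨h₁, h₂⟩
    · obtain ⟨k, -, -, h⟩ := R.exists_open_column (v := v) (v' := R.clauseRow c) hv₀ hbc.2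
        ⟨ha₀, ha₁⟩ ⟨by omega, by omega⟩ ⟨hy₀, hy₁⟩ ⟨by omega, by omega⟩ havoid h₁ h₂
      exact ⟨k, h⟩
    · obtain ⟨k, -, -, h₃, h₄, h₅⟩ := R.exists_open_column (v := R.clauseRow c) (v' := v)
        (a := 4 * R.clauseLeft c - 1 + t) (yA := y) hbc.1 hv₁ ⟨by omega, by omega⟩ ⟨ha₀, ha₁⟩
        ⟨by omega, by omega⟩ ⟨hy₀, hy₁⟩ (by rwa [Sym2.eq_swap]) h₁ h₂
      exact ⟨k, h₄, h₃, h₅⟩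
  have hS0 : (0 : ℤ) ≤ R.rowDist := by omega
  -- `u` is not behind the clause
  have hfront : 0 < R.clauseRow c ∧ v < R.clauseRow c ∨ R.clauseRow c < 0 ∧ R.clauseRow c < v := by
    by_contra hnot
    have hcase : 0 < R.clauseRow c ∧ R.clauseRow c < v ∨ R.clauseRow c < 0 ∧ v < R.clauseRow c := by
      clear hu'; omega
    -- This is the wall next to row `v` on the side of the variables. Behind `c`, the point `u` can
    -- only belong to a clause gadget `e`; a column of `e` open in this wall contains a leg of `e`,
    -- which would run through the bar of `c`.
    obtain ⟨k, hk₁, hk₂, hopen⟩ := column (if 0 < v then v - 1 else v) (by split_ifs <;> omega)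
    rcases hu' with ⟨-, h⟩ | ⟨h, hne, hvr, i, hi, -, s, hs, hs₀, hs₁, -⟩
    · omega
    · have hlen := R.len_eq h
      rcases h with x | e
      · simp only [row, Sum.elim_inl] at hvr
        omega
      · simp only [row, left, right, Sum.elim_inr] at hvr hs hlen
        obtain ⟨y, hy, hleg⟩ := R.exists_leg_of_open (e := e)
          (by split_ifs <;> omega) hopen (by omega) (by omega)
        exact hne (by rw [R.eq_of_leg_mem hy (d := c) (by omega) (by omega) (by omega)])
  -- Within the range of `c`, the wall directly in front of `c` is open only in the columns of legs
  -- of `c`.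
  obtain ⟨k, hk₁, hk₂, hopen⟩ :=
    column (if 0 < R.clauseRow c then R.clauseRow c - 1 else R.clauseRow c)
      (by split_ifs <;> omega)
  obtain ⟨x, hx, hleg⟩ := R.exists_leg_of_open (e := c) (by split_ifs <;> omega) hopen
    (by omega) (by omega)
  have hlx := R.leg_var c x hx
  -- Otherwise the segment would cross level `0` in a column of `x` and meet the bar of `x`.
  have hside : 0 < R.clauseRow c ∧ 0 < yu ∨ R.clauseRow c < 0 ∧ yu < 0 := by
    by_contra hnot
    clear hu'
    rw [hk₂, hk₁] at havoid
    rcases hfront with ⟨h₁, h₂⟩ | ⟨h₁, h₂⟩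
    · have := mul_add_le_mul hS0 h₁
      obtain ⟨z, hz, hz'⟩ := R.vertical_meets_bar (x := x) (k := k) (y₁ := yu) (y₂ := y)
        (by omega) (by omega) (by omega) (by omega) (by omega)
      exact havoid _ (R.mem_happy.2 (Or.inl ⟨_, rfl⟩)) z hz hz'
    · have := mul_add_le_mul hS0 h₁
      obtain ⟨z, hz, hz'⟩ := R.vertical_meets_bar (x := x) (k := k) (y₁ := y) (y₂ := yu)
        (by omega) (by omega) (by omega) (by omega) (by omega)
      exact havoid _ (R.mem_happy.2 (Or.inl ⟨_, rfl⟩)) z (by rwa [Sym2.eq_swap]) hz'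
  rcases hu' with ⟨-, h⟩ | ⟨h, hne, hvr, i, hi, hui, s, hs, hs₀, hs₁, hsy⟩
  · omega
  have hlen := R.len_eq h
  rcases h with x' | e
  · simp only [row, left, right, Sum.elim_inl] at hvr hs hlen
    obtain rfl : x' = x := R.eq_of_mem_columns (k := k) (by omega) (by omega) (by omega) (by omega)
    refine ⟨x', hx, i, hi, hui, ?_⟩
    subst hvr
    -- In a column of the representation, the position on either side is congruent to 1 modulo 4.
    -- Vertices there have odd index on the upper side and even index on the lower side.
    cases hp : Φ.positive c
    · have := (R.clauseRow_neg_iff c).2 hp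
      simp only [Bool.false_eq_true, if_false]
      omega
    · have := (R.clauseRow_pos_iff c).2 hp
      simp only [if_true]
      omega
  -- A clause gadget in front of `c` would have its bar in the way of the leg of `c` in this column.
  · exfalso
    simp only [row, left, right, Sum.elim_inr] at hvr hs hlen
    have he := R.clauseRow_ne_zero e
    have hsign : 0 < R.clauseRow c ∧ 0 ≤ v ∨ R.clauseRow c < 0 ∧ v ≤ 0 := by
      by_contra hnot
      rcases lt_or_gt_of_ne (show v ≠ 0 by omega) with h | h <;>
        have := mul_add_le_mul hS0 h <;> omega
    exact hne (by rw [R.eq_of_leg_mem hx (d := e) (by omega) (by omega) (by omega)])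

end RectilinearRep

/-! ### Short flip sequences give satisfying assignments -/

/-- A flip moves the isolated point `u` to `b`, replacing an edge `ab` by `ua`. -/
theorem Flip.exists_move {P : Finset Plane} {M N : Finset (Sym2 Plane)} (h : Flip P M N) :
    ∃ u a b, IsIsolated P M u ∧ s(u, a) ∉ M ∧ s(a, b) ∈ M ∧
      N = insert s(u, a) (M.erase s(a, b)) ∧ IsIsolated P N b := by
  obtain ⟨hM, hN, e, he, f, hf, ⟨u, hu, hiso⟩, rfl⟩ := h
  obtain ⟨a, rfl⟩ := hu
  have hfN : s(u, a) ∈ insert s(u, a) (M.erase e) := Finset.mem_insert_self _ _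
  have haP := hN.edge_mem _ hfN a (Sym2.mem_mk_right _ _)
  have hua : a ≠ u := fun h => hN.edge_not_diag _ hfN (by simp [h])
  -- Otherwise `a` would be isolated in `M` as well, or be matched by two edges of the new matching.
  have hae : a ∈ e := by
    by_contra hae
    obtain ⟨u', hu', huniq⟩ := hM.isolated
    obtain rfl := huniq u hiso
    refine hua (huniq a ⟨haP, fun e' he' hae' => ?_⟩)
    have hne : e' ≠ e := fun h => hae (h ▸ hae')
    have := hN.matching _ hfN e' (Finset.mem_insert_of_mem (Finset.mem_erase.2 ⟨hne, he'⟩)) a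
      (Sym2.mem_mk_right _ _) hae'
    exact hf (this ▸ he')
  obtain ⟨b, rfl⟩ := hae
  refine ⟨u, a, b, hiso, hf, he, rfl, hM.edge_mem _ he b (Sym2.mem_mk_right _ _), ?_⟩
  intro e' he' hb
  rcases Finset.mem_insert.1 he' with rfl | he'
  · rcases Sym2.mem_iff.1 hb with rfl | rfl
    · exact hiso.2 _ he (Sym2.mem_mk_right _ _)
    · exact hM.edge_not_diag _ he (by simp)
  · rw [Finset.mem_erase] at he'
    exact he'.1 (hM.matching _ he'.2 _ he b hb (Sym2.mem_mk_right _ _))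

namespace RectilinearRep

variable {V C : ℕ} {Φ : Monotone3CNF V C} (R : RectilinearRep Φ)

/-! ### Endpoints of the coloured edges -/

theorem cycleEdge_ends {g : R.Gadget} {n : ℕ} (hn : n < 2 * R.len g) {p q : Plane}
    (h : s(p, q) = R.cycleEdge g n) : ∃ i < 2 * R.len g, ∃ j < 2 * R.len g,
      p = R.vertex g i ∧ q = R.vertex g j ∧ i % 2 ≠ j % 2 := by
  have hl := Nat.mod_lt (n + 1) (show 2 * R.len g > 0 by omega)
  have hpar : n % 2 ≠ (n + 1) % (2 * R.len g) % 2 := by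
    rw [succ_mod hn]; split_ifs <;> omega
  rcases Sym2.eq_iff.1 h with ⟨h₁, h₂⟩ | ⟨h₁, h₂⟩
  · exact ⟨_, hn, _, hl, h₁, h₂, hpar⟩
  · exact ⟨_, hl, _, hn, h₁, h₂, hpar.symm⟩

theorem blue_ends {g : R.Gadget} {p q : Plane} (h : s(p, q) ∈ R.blue g) :
    ∃ i < 2 * R.len g, ∃ j < 2 * R.len g,
      p = R.vertex g i ∧ q = R.vertex g j ∧ i % 2 ≠ j % 2 := by
  obtain ⟨j, hj, h⟩ := R.mem_blue.1 h
  exact R.cycleEdge_ends (by omega) h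

theorem red_ends {g : R.Gadget} {p q : Plane} (h : s(p, q) ∈ R.red g) :
    ∃ i < 2 * R.len g, ∃ j < 2 * R.len g,
      p = R.vertex g i ∧ q = R.vertex g j ∧ i % 2 ≠ j % 2 := by
  obtain ⟨j, hj, h⟩ := R.mem_red.1 h
  exact R.cycleEdge_ends (by omega) h

theorem vertex_not_mem_happy {g : R.Gadget} {j : ℕ} (hj : j < 2 * R.len g) {e : Sym2 Plane}
    (he : e ∈ R.happy) : R.vertex g j ∉ e := fun h =>
  R.happy_cycleEdge_disjoint he hj (mem_edgeSegment_of_mem h)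
    (mem_edgeSegment_of_mem (R.mem_cycleEdge.2 (Or.inl rfl)))

theorem blue_subset_initialMatching (g : R.Gadget) : R.blue g ⊆ R.initialMatching :=
  fun _ he => Finset.mem_union_right _ (Finset.mem_biUnion.2 ⟨g, Finset.mem_univ _, he⟩)

theorem red_subset_targetMatching (g : R.Gadget) : R.red g ⊆ R.targetMatching :=
  fun _ he => Finset.mem_union_right _ (Finset.mem_biUnion.2 ⟨g, Finset.mem_univ _, he⟩)

theorem blue_not_mem_targetMatching {g : R.Gadget} {e : Sym2 Plane} (he : e ∈ R.blue g) :
    e ∉ R.targetMatching := by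
  intro h
  rcases Finset.mem_union.1 h with h | h
  · exact Finset.disjoint_left.1 (R.blue_happy_disjoint g) he h
  · obtain ⟨g', -, h⟩ := Finset.mem_biUnion.1 h
    exact Finset.disjoint_left.1 (R.blue_red_disjoint g g') he h

theorem red_not_mem_initialMatching {g : R.Gadget} {e : Sym2 Plane} (he : e ∈ R.red g) :
    e ∉ R.initialMatching := by
  intro h
  rcases Finset.mem_union.1 h with h | h
  · exact Finset.disjoint_left.1 (R.red_happy_disjoint g) he h
  · obtain ⟨g', -, h⟩ := Finset.mem_biUnion.1 h
    exact Finset.disjoint_left.1 (R.blue_red_disjoint g' g) h he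

theorem exists_blue_of_vertex {g : R.Gadget} {j : ℕ} (hj : j < 2 * R.len g) :
    ∃ e ∈ R.blue g, R.vertex g j ∈ e := by
  obtain ⟨i, hi, h⟩ := R.exists_cycleEdge_of_vertex g (ε := 0) (by norm_num) hj
  exact ⟨_, R.mem_blue.2 ⟨i, hi, rfl⟩, h⟩

/-- A flip sequence, with the moves of the isolated point: flip `i` replaces the edge
`a i, b i` by the edge `u i, a i`. -/
structure Moves (k : ℕ) (seq : ℕ → Finset (Sym2 Plane)) (u a b : ℕ → Plane) : Prop where
  zero : seq 0 = R.initialMatching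
  last : seq k = R.targetMatching
  odd : ∀ i ≤ k, IsOddMatching R.points (seq i)
  isolated : ∀ i < k, IsIsolated R.points (seq i) (u i)
  mem : ∀ i < k, s(a i, b i) ∈ seq i
  succ : ∀ i < k, seq (i + 1) = insert s(u i, a i) ((seq i).erase s(a i, b i))
  next : ∀ i, i + 1 < k → u (i + 1) = b i

theorem exists_moves {k : ℕ}
    (h : HasFlipSequence R.points R.initialMatching R.targetMatching k) :
    ∃ seq u a b, R.Moves k seq u a b := by
  obtain ⟨seq, h₀, hk, hstep⟩ := h
  have hmove : ∀ i, ∃ u a b, i < k → IsIsolated R.points (seq i) u ∧ s(u, a) ∉ seq i ∧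
      s(a, b) ∈ seq i ∧ seq (i + 1) = insert s(u, a) ((seq i).erase s(a, b)) ∧
      IsIsolated R.points (seq (i + 1)) b := by
    intro i
    by_cases hi : i < k
    · obtain ⟨u, a, b, h⟩ := (hstep i hi).exists_move
      exact ⟨u, a, b, fun _ => h⟩
    -- Filler values after the end of the sequence.
    · exact ⟨0, 0, 0, fun h => absurd h hi⟩
  choose u a b hm using hmove
  have hodd : ∀ i ≤ k, IsOddMatching R.points (seq i) := by
    intro i hi
    rcases hi.eq_or_lt with rfl | hi
    · rw [hk]; exact R.targetMatching_isOddMatching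
    · exact (hstep i hi).1
  refine ⟨seq, u, a, b, h₀, hk, hodd, fun i hi => (hm i hi).1, fun i hi => (hm i hi).2.2.1,
    fun i hi => (hm i hi).2.2.2.1, fun i hi => ?_⟩
  exact (hodd (i + 1) hi.le).isolated.unique (hm (i + 1) hi).1 (hm i (by omega)).2.2.2.2

/-! ### Analysis of a shortest flip sequence -/

namespace Moves

variable {R} {k : ℕ} {seq : ℕ → Finset (Sym2 Plane)} {u a b : ℕ → Plane}

theorem exists_insert (m : R.Moves k seq u a b) {e : Sym2 Plane} {i j : ℕ} (hij : i ≤ j)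
    (hj : j ≤ k) (hi : e ∉ seq i) (he : e ∈ seq j) :
    ∃ t, i ≤ t ∧ t < j ∧ e = s(u t, a t) := by
  induction j, hij using Nat.le_induction with
  | base => exact absurd he hi
  | succ j hij ih =>
    by_cases h : e ∈ seq j
    · obtain ⟨t, h₁, h₂, h₃⟩ := ih (by omega) h
      exact ⟨t, h₁, by omega, h₃⟩
    · rw [m.succ j (by omega), Finset.mem_insert, Finset.mem_erase] at he
      exact ⟨j, hij, by omega, he.resolve_right fun hmem => h hmem.2⟩

/-- Each gadget `g` is entered at some time: until then it is blue, and then the first blue edge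
is removed. -/
theorem exists_entry (m : R.Moves k seq u a b) (g : R.Gadget) :
    ∃ t < k, (∀ i ≤ t, R.blue g ⊆ seq i) ∧ s(a t, b t) ∈ R.blue g := by
  classical
  have hex : ∃ i, ¬ R.blue g ⊆ seq (i + 1) ∧ i < k := by
    have hmem : R.cycleEdge g (2 * 0 + 0) ∈ R.blue g :=
      R.mem_blue.2 ⟨0, by have := R.three_le_len g; omega, rfl⟩
    have hk : k ≠ 0 := by
      rintro rfl
      refine R.blue_not_mem_targetMatching hmem ?_
      rw [← m.last, m.zero]
      exact R.blue_subset_initialMatching g hmem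
    refine ⟨k - 1, fun h => R.blue_not_mem_targetMatching hmem ?_, by omega⟩
    rw [← m.last]
    rw [Nat.sub_add_cancel (by omega)] at h
    exact h hmem
  -- The first flip after which a blue edge of `g` is missing. It exists, as the target matching
  -- contains no blue edge.
  obtain ⟨hnot, hlt⟩ := Nat.find_spec hex
  have hmin := fun i => Nat.find_min hex (m := i)
  generalize Nat.find hex = t at *
  have hall : ∀ i ≤ t, R.blue g ⊆ seq i := by
    rintro (_ | i) hi
    · rw [m.zero]; exact R.blue_subset_initialMatching g
    · by_contra h
      exact hmin i (by omega) ⟨h, by omega⟩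
  refine ⟨t, hlt, hall, ?_⟩
  obtain ⟨e, he, he'⟩ := Finset.not_subset.1 hnot
  rw [m.succ t hlt, Finset.mem_insert, Finset.mem_erase] at he'
  by_contra hne
  exact he' (Or.inr ⟨fun h => hne (h ▸ he), hall t le_rfl he⟩)

/-- The blue edges of a gadget cover all its vertices. -/
theorem isolated_ne_vertex (m : R.Moves k seq u a b) {g : R.Gadget} {i : ℕ} (hi : i < k)
    (hg : R.blue g ⊆ seq i) {j : ℕ} (hj : j < 2 * R.len g) : u i ≠ R.vertex g j := by
  intro h
  obtain ⟨e, he, hv⟩ := R.exists_blue_of_vertex hj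
  exact (m.isolated i hi).2 e (hg he) (h ▸ hv)

/-- In a shortest sequence, every flip inserts a red edge or enters a gadget. -/
theorem red_or_entry (m : R.Moves k seq u a b) (hk : k = ∑ g, R.len g + (V + C))
    {τ : R.Gadget → ℕ} (hτ : ∀ g, τ g < k ∧ (∀ i ≤ τ g, R.blue g ⊆ seq i) ∧
      s(a (τ g), b (τ g)) ∈ R.blue g) {i : ℕ} (hi : i < k) :
    (∃ g, s(u i, a i) ∈ R.red g) ∨ ∃ g, i = τ g := by
  classical
  set reds := Finset.univ.biUnion R.red with hreds
  set T₁ := (Finset.range k).filter fun i => s(u i, a i) ∈ reds with hT₁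
  set T₂ := Finset.univ.image τ with hT₂
  -- Every red edge is missing at the beginning and has to be inserted at some time.
  have hcard₁ : ∑ g, R.len g ≤ T₁.card := by
    calc ∑ g, R.len g = reds.card := by
          rw [hreds, Finset.card_biUnion fun g _ h _ hne => R.red_disjoint hne]
          simp only [card_red]
      _ ≤ (T₁.image fun i => s(u i, a i)).card := by
          refine Finset.card_le_card fun e he => ?_
          obtain ⟨g, -, hg⟩ := Finset.mem_biUnion.1 he
          obtain ⟨t, -, ht, rfl⟩ := m.exists_insert (Nat.zero_le k) le_rfl
            (by rw [m.zero]; exact R.red_not_mem_initialMatching hg)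
            (by rw [m.last]; exact R.red_subset_targetMatching g hg)
          exact Finset.mem_image.2 ⟨t, Finset.mem_filter.2 ⟨Finset.mem_range.2 ht, he⟩, rfl⟩
      _ ≤ T₁.card := Finset.card_image_le
  -- Entries into different gadgets happen at different times, since a flip removes only one edge.
  have hcard₂ : T₂.card = V + C := by
    rw [hT₂, Finset.card_image_of_injective, Finset.card_univ, Fintype.card_sum,
      Fintype.card_fin, Fintype.card_fin]
    intro g h hgh
    by_contra hne
    have h₁ := (hτ g).2.2
    rw [show τ g = τ h from hgh] at h₁
    exact Finset.disjoint_left.1 (R.blue_disjoint hne) h₁ (hτ h).2.2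
  -- The edge inserted at an entry joins a vertex of the gadget to a point outside of it, whereas
  -- both ends of a red edge belong to one gadget.
  have hdisj : Disjoint T₁ T₂ := by
    rw [Finset.disjoint_left]
    rintro i h₁ h₂
    obtain ⟨g, -, rfl⟩ := Finset.mem_image.1 h₂
    obtain ⟨h, -, hred⟩ := Finset.mem_biUnion.1 (Finset.mem_filter.1 h₁).2
    obtain ⟨hlt, hall, hblue⟩ := hτ g
    obtain ⟨i₁, hi₁, j₁, hj₁, ha₁, -, -⟩ := R.blue_ends hblue
    obtain ⟨i₂, hi₂, j₂, hj₂, hu₂, ha₂, -⟩ := R.red_ends hred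
    obtain ⟨rfl, -⟩ := R.vertex_inj hi₁ hj₂ (ha₁.symm.trans ha₂)
    exact m.isolated_ne_vertex hlt (hall _ le_rfl) hi₂ hu₂
  have hsub : T₁ ∪ T₂ ⊆ Finset.range k := by
    refine Finset.union_subset (Finset.filter_subset _ _) fun i hi => ?_
    obtain ⟨g, -, rfl⟩ := Finset.mem_image.1 hi
    exact Finset.mem_range.2 (hτ g).1
  -- The two disjoint sets have together at least `k` elements and so exhaust the `k` flips.
  have heq := Finset.eq_of_subset_of_card_le hsub (by
    rw [Finset.card_range, Finset.card_union_of_disjoint hdisj]; omega)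
  have hmem : i ∈ T₁ ∪ T₂ := by rw [heq]; exact Finset.mem_range.2 hi
  rcases Finset.mem_union.1 hmem with h | h
  · obtain ⟨g, -, hg⟩ := Finset.mem_biUnion.1 (Finset.mem_filter.1 h).2
    exact Or.inl ⟨g, hg⟩
  · obtain ⟨g, -, hg⟩ := Finset.mem_image.1 h
    exact Or.inr ⟨g, hg.symm⟩

/-- A missing happy edge would have to be inserted again later. But every inserted edge is red or
has an endpoint `a` on a gadget, and no happy edge has such an endpoint. -/
theorem happy_subset (m : R.Moves k seq u a b)
    {τ : R.Gadget → ℕ} (hτ : ∀ g, τ g < k ∧ (∀ i ≤ τ g, R.blue g ⊆ seq i) ∧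
      s(a (τ g), b (τ g)) ∈ R.blue g)
    (hdich : ∀ i < k, (∃ g, s(u i, a i) ∈ R.red g) ∨ ∃ g, i = τ g) {i : ℕ} (hi : i ≤ k) :
    R.happy ⊆ seq i := by
  intro e he
  by_contra hnot
  obtain ⟨t, -, ht, rfl⟩ := m.exists_insert hi le_rfl hnot
    (by rw [m.last]; exact Finset.mem_union_left _ he)
  rcases hdich t ht with ⟨g, hg⟩ | ⟨g, rfl⟩
  · exact Finset.disjoint_left.1 (R.red_happy_disjoint g) hg he
  · obtain ⟨i₁, hi₁, -, -, ha, -⟩ := R.blue_ends (hτ g).2.2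
    exact R.vertex_not_mem_happy hi₁ he (ha ▸ Sym2.mem_mk_right _ _)

/-- All isolated vertices of a gadget that occur in the sequence have the same parity. -/
theorem parity (m : R.Moves k seq u a b)
    {τ : R.Gadget → ℕ} (hτ : ∀ g, τ g < k ∧ (∀ i ≤ τ g, R.blue g ⊆ seq i) ∧
      s(a (τ g), b (τ g)) ∈ R.blue g)
    (hdich : ∀ i < k, (∃ g, s(u i, a i) ∈ R.red g) ∨ ∃ g, i = τ g) {i : ℕ} (hi : i < k) :
    (∀ g, ∀ j₁ < 2 * R.len g, ∀ j₂ < 2 * R.len g, ∀ i₁ ≤ i, ∀ i₂ ≤ i,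
      u i₁ = R.vertex g j₁ → u i₂ = R.vertex g j₂ → j₁ % 2 = j₂ % 2) ∧
    ∀ e ∈ seq i, e ∈ R.happy ∨ (∃ g, e ∈ R.blue g) ∨ (∃ g, e ∈ R.red g) ∨
      ∃ g, ∃ j < 2 * R.len g, ∃ v, e = s(v, R.vertex g j) ∧ (∃ i' ≤ i, u i' = v) ∧
        ∃ i' ≤ i, ∃ j' < 2 * R.len g, u i' = R.vertex g j' ∧ j' % 2 ≠ j % 2 := by
  -- The second assertion keeps track of the entry edges. Removing one of them can make its outer
  -- end `v` isolated; `v` has been isolated before, so no new parity arises.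
  induction i with
  | zero =>
    constructor
    · intro g j₁ hj₁ j₂ hj₂ i₁ hi₁ i₂ hi₂ h₁ h₂
      obtain rfl : i₁ = 0 := by omega
      obtain rfl : i₂ = 0 := by omega
      rw [(R.vertex_inj hj₁ hj₂ (h₁.symm.trans h₂)).2]
    · intro e he
      rw [m.zero] at he
      rcases Finset.mem_union.1 he with h | h
      · exact Or.inl h
      · obtain ⟨g, -, h⟩ := Finset.mem_biUnion.1 h
        exact Or.inr (Or.inl ⟨g, h⟩)
  | succ i ih =>
    have hik : i < k := by omega
    obtain ⟨ihA, ihB⟩ := ih hik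
    have hnext := m.next i hi
    -- it suffices to classify the new isolated point and the new edge
    suffices hnew : (∀ g, ∀ j₁ < 2 * R.len g, ∀ j₂ < 2 * R.len g, ∀ i₁ ≤ i,
        u i₁ = R.vertex g j₁ → b i = R.vertex g j₂ → j₁ % 2 = j₂ % 2) ∧
        ((∃ g, s(u i, a i) ∈ R.red g) ∨ ∃ g, ∃ j < 2 * R.len g, a i = R.vertex g j ∧
          ∃ j' < 2 * R.len g, b i = R.vertex g j' ∧ j' % 2 ≠ j % 2) by
      constructor
      · intro g j₁ hj₁ j₂ hj₂ i₁ hi₁ i₂ hi₂ h₁ h₂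
        rcases Nat.le_succ_iff.1 hi₁ with hi₁ | rfl <;> rcases Nat.le_succ_iff.1 hi₂ with hi₂ | rfl
        · exact ihA g j₁ hj₁ j₂ hj₂ i₁ hi₁ i₂ hi₂ h₁ h₂
        · exact hnew.1 g j₁ hj₁ j₂ hj₂ i₁ hi₁ h₁ (hnext ▸ h₂)
        · exact (hnew.1 g j₂ hj₂ j₁ hj₁ i₂ hi₂ h₂ (hnext ▸ h₁)).symm
        · rw [(R.vertex_inj hj₁ hj₂ (h₁.symm.trans h₂)).2]
      · intro e he
        rw [m.succ i hik, Finset.mem_insert, Finset.mem_erase] at he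
        rcases he with rfl | ⟨-, he⟩
        · rcases hnew.2 with h | ⟨g, j, hj, haj, j', hj', hbj, hpar⟩
          · exact Or.inr (Or.inr (Or.inl h))
          · exact Or.inr (Or.inr (Or.inr ⟨g, j, hj, u i, by rw [haj], ⟨i, by omega, rfl⟩,
              i + 1, le_rfl, j', hj', hnext.trans hbj, hpar⟩))
        · rcases ihB e he with h | h | h | ⟨g, j, hj, v, rfl, ⟨i₁, hi₁, h₁⟩, i₂, hi₂, h₂⟩
          · exact Or.inl h
          · exact Or.inr (Or.inl h)
          · exact Or.inr (Or.inr (Or.inl h))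
          · exact Or.inr (Or.inr (Or.inr ⟨g, j, hj, v, rfl, ⟨i₁, by omega, h₁⟩, i₂, by omega, h₂⟩))
    rcases hdich i hik with ⟨h, hred⟩ | ⟨g, rfl⟩
    · refine ⟨?_, Or.inl ⟨h, hred⟩⟩
      obtain ⟨ju, hju, ja, hja, hu, ha, hpar⟩ := R.red_ends hred
      rcases ihB _ (m.mem i hik) with hrem | ⟨g, hrem⟩ | ⟨g, hrem⟩ |
        ⟨g, j, hj, v, heq, ⟨i₁, hi₁, hv⟩, -⟩
      · exact absurd (ha ▸ Sym2.mem_mk_left _ _) (R.vertex_not_mem_happy hja hrem)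
      -- A red edge followed by a blue one moves the isolated point by two steps on the cycle.
      · obtain ⟨ja', hja', jb, hjb, ha', hb, hpar'⟩ := R.blue_ends hrem
        obtain ⟨rfl, rfl⟩ := R.vertex_inj hja hja' (ha.symm.trans ha')
        intro g j₁ hj₁ j₂ hj₂ i₁ hi₁ h₁ h₂
        obtain ⟨rfl, rfl⟩ := R.vertex_inj hjb hj₂ (hb.symm.trans h₂)
        have := ihA h j₁ hj₁ ju hju i₁ hi₁ i le_rfl h₁ hu
        omega
      -- The target has only one red edge at `a i`, so the removed edge would be the inserted one
      -- and would already cover `u i`.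
      · exfalso
        have := R.targetMatching_isOddMatching.matching _ (R.red_subset_targetMatching h hred) _
          (R.red_subset_targetMatching g hrem) (a i) (Sym2.mem_mk_right _ _) (Sym2.mem_mk_left _ _)
        exact (m.isolated i hik).2 _ (m.mem i hik) (this ▸ Sym2.mem_mk_left _ _)
      -- If `a i` were the outer end `v`, both ends of a red edge would have been isolated, against
      -- the parity so far. Otherwise `b i = v`.
      · rcases Sym2.eq_iff.1 heq with ⟨h₁, -⟩ | ⟨-, h₂⟩
        · exfalso
          exact hpar (ihA h ju hju ja hja i le_rfl i₁ hi₁ hu (hv.trans (h₁.symm.trans ha)))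
        · intro g' j₁ hj₁ j₂ hj₂ i₂ hi₂ h₃ h₄
          exact ihA g' j₁ hj₁ j₂ hj₂ i₂ hi₂ i₁ hi₁ h₃ (hv.trans (h₂.symm.trans h₄))
    · obtain ⟨-, hall, hblue⟩ := hτ g
      obtain ⟨ja, hja, jb, hjb, ha, hb, hpar⟩ := R.blue_ends hblue
      refine ⟨?_, Or.inr ⟨g, ja, hja, ha, jb, hjb, hb, hpar.symm⟩⟩
      intro g' j₁ hj₁ j₂ hj₂ i₁ hi₁ h₁ h₂
      obtain ⟨rfl, -⟩ := R.vertex_inj hjb hj₂ (hb.symm.trans h₂)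
      -- Before its entry, no vertex of the gadget has been isolated, so there is nothing to compare
      -- with.
      exact absurd h₁ (m.isolated_ne_vertex (by omega) (hall i₁ hi₁) hj₁)

/-- A variable is true if some odd vertex of its gadget is isolated before some flip. A clause
gadget is entered from a variable vertex on its own side, whose parity agrees with the sign of the
clause; for negative clauses, `parity` excludes odd vertices at any other time. -/
theorem satisfiable (m : R.Moves k seq u a b) (hk : k = ∑ g, R.len g + (V + C)) :
    Φ.Satisfiable := by
  classical
  choose τ hτ using m.exists_entry
  have hdich : ∀ i < k, (∃ g, s(u i, a i) ∈ R.red g) ∨ ∃ g, i = τ g :=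
    fun i hi => m.red_or_entry hk hτ hi
  refine ⟨fun x => decide (∃ i < k, ∃ j < 2 * R.len (Sum.inl x), j % 2 = 1 ∧
    u i = R.vertex (Sum.inl x) j), fun c => ?_⟩
  obtain ⟨hlt, hall, hblue⟩ := hτ (Sum.inr c)
  set i := τ (Sum.inr c) with hi
  obtain ⟨ja, hja, -, -, ha, -⟩ := R.blue_ends hblue
  have hu : u i = R.start ∨ ∃ h : R.Gadget, h ≠ Sum.inr c ∧
      ∃ j < 2 * R.len h, u i = R.vertex h j := by
    rcases R.mem_points_cases (m.isolated i hlt).1 with h | ⟨h, j, hj, hv⟩ | ⟨e, he, hue⟩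
    · exact Or.inl h
    · refine Or.inr ⟨h, ?_, j, hj, hv⟩
      rintro rfl
      exact m.isolated_ne_vertex hlt (hall i le_rfl) hj hv
    · exact absurd hue ((m.isolated i hlt).2 e (m.happy_subset hτ hdich hlt.le he))
  have havoid : ∀ e ∈ R.happy, ∀ z ∈ edgeSegment s(u i, R.vertex (Sum.inr c) ja),
      z ∉ edgeSegment e := by
    intro e he z hz hz'
    rw [← ha] at hz
    have hmem : s(u i, a i) ∈ seq (i + 1) := by
      rw [m.succ i hlt]; exact Finset.mem_insert_self _ _
    have hae : a i ∉ e := ha ▸ R.vertex_not_mem_happy hja he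
    refine (m.odd (i + 1) hlt).plane _ hmem e (m.happy_subset hτ hdich hlt he)
      ⟨fun h => hae (h ▸ Sym2.mem_mk_right _ _), z, ⟨hz, hz'⟩, fun ⟨h₁, h₂⟩ => ?_⟩
    rcases Sym2.mem_iff.1 h₁ with rfl | rfl
    · exact (m.isolated i hlt).2 e (m.happy_subset hτ hdich hlt.le he) h₂
    · exact hae h₂
  obtain ⟨x, hx, j, hj, huj, hpar⟩ := R.entry_of_clause hja hu havoid
  refine ⟨x, hx, ?_⟩
  cases hp : Φ.positive c
  · simp only [hp, Bool.false_eq_true, if_false] at hpar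
    rw [decide_eq_false_iff_not]
    rintro ⟨i', hi', j', hj', hpar', huj'⟩
    have h₁ := (m.parity hτ hdich (i := max i i') (by omega)).1 (Sum.inl x) j hj j' hj' i
      (le_max_left _ _) i' (le_max_right _ _) huj huj'
    omega
  · simp only [hp, if_true] at hpar
    rw [decide_eq_true_iff]
    exact ⟨i, hlt, j, hj, hpar, huj⟩

end Moves

end RectilinearRep

/-! ### Flip sequences inside a plane graph -/

theorem HasFlipSequence.refl (P : Finset Plane) (M : Finset (Sym2 Plane)) :
    HasFlipSequence P M M 0 :=
  ⟨fun _ => M, rfl, rfl, fun i hi => absurd hi (Nat.not_lt_zero i)⟩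

theorem HasFlipSequence.snoc {P : Finset Plane} {M N K : Finset (Sym2 Plane)} {k : ℕ}
    (h : HasFlipSequence P M N k) (h' : Flip P N K) : HasFlipSequence P M K (k + 1) := by
  obtain ⟨seq, h₀, hk, hs⟩ := h
  refine ⟨fun i => if i ≤ k then seq i else K, by simpa using h₀, by simp, fun i hi => ?_⟩
  rcases Nat.lt_succ_iff_lt_or_eq.1 hi with hlt | rfl
  · simpa [hlt.le, Nat.succ_le_of_lt hlt] using hs i hlt
  · simpa [hk] using h'

theorem HasFlipSequence.trans {P : Finset Plane} {M N K : Finset (Sym2 Plane)} {k l : ℕ}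
    (h : HasFlipSequence P M N k) (h' : HasFlipSequence P N K l) :
    HasFlipSequence P M K (k + l) := by
  induction l generalizing K with
  | zero =>
    obtain ⟨seq, h₀, hl, -⟩ := h'
    rw [h₀] at hl
    exact hl ▸ h
  | succ l ih =>
    obtain ⟨seq, h₀, hl, hs⟩ := h'
    have := ih ⟨seq, h₀, rfl, fun i hi => hs i (by omega)⟩
    exact this.snoc (hl ▸ hs l (by omega))

/-- `M` is an odd matching in the graph `E`, with isolated point `u`. -/
structure IsState (P : Finset Plane) (E : Set (Sym2 Plane)) (M : Finset (Sym2 Plane))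
    (u : Plane) : Prop where
  odd : IsOddMatching P M
  sub : ∀ e ∈ M, e ∈ E
  isolated : IsIsolated P M u

/-- Inside a plane graph no crossing can arise, so only the matching conditions have to be
maintained when `u` moves to `b`. -/
theorem IsState.flip {P : Finset Plane} {E : Set (Sym2 Plane)} {M : Finset (Sym2 Plane)}
    {u a b : Plane} (hE : ∀ e ∈ E, ∀ f ∈ E, ¬ Cross e f) (h : IsState P E M u)
    (hab : s(a, b) ∈ M) (hua : s(u, a) ∈ E) :
    Flip P M (insert s(u, a) (M.erase s(a, b))) ∧
      IsState P E (insert s(u, a) (M.erase s(a, b))) b := by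
  obtain ⟨odd, sub, hu⟩ := h
  have hne : a ≠ u := fun h => hu.2 _ hab (h ▸ Sym2.mem_mk_left _ _)
  have haP := odd.edge_mem _ hab a (Sym2.mem_mk_left _ _)
  have hbP := odd.edge_mem _ hab b (Sym2.mem_mk_right _ _)
  have hba : b ≠ a := fun h => odd.edge_not_diag _ hab (by simp [h])
  have hbu : b ≠ u := fun h => hu.2 _ hab (h ▸ Sym2.mem_mk_right _ _)
  have hmem : ∀ e ∈ insert s(u, a) (M.erase s(a, b)),
      e = s(u, a) ∨ e ∈ M ∧ a ∉ e ∧ b ∉ e ∧ u ∉ e := by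
    intro e he
    rw [Finset.mem_insert, Finset.mem_erase] at he
    refine he.imp_right fun ⟨h₁, h₂⟩ => ⟨h₂, fun h => h₁ ?_, fun h => h₁ ?_, hu.2 e h₂⟩
    · exact odd.matching _ h₂ _ hab a h (Sym2.mem_mk_left _ _)
    · exact odd.matching _ h₂ _ hab b h (Sym2.mem_mk_right _ _)
  have hsub : ∀ e ∈ insert s(u, a) (M.erase s(a, b)), e ∈ E := by
    intro e he
    rcases hmem e he with rfl | h
    · exact hua
    · exact sub e h.1
  have hiso : IsIsolated P (insert s(u, a) (M.erase s(a, b))) b := by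
    refine ⟨hbP, fun e he => ?_⟩
    rcases hmem e he with rfl | h
    · rw [Sym2.mem_iff]; tauto
    · exact h.2.2.1
  have hodd : IsOddMatching P (insert s(u, a) (M.erase s(a, b))) := by
    refine ⟨?_, ?_, ?_, fun e he f hf => hE e (hsub e he) f (hsub f hf), b, hiso, ?_⟩
    · intro e he
      rcases hmem e he with rfl | h
      · simpa using hne.symm
      · exact odd.edge_not_diag e h.1
    · intro e he p hp
      rcases hmem e he with rfl | h
      · rcases Sym2.mem_iff.1 hp with rfl | rfl
        · exact hu.1
        · exact haP
      · exact odd.edge_mem e h.1 p hp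
    · intro e he f hf p hpe hpf
      rcases hmem e he with rfl | h <;> rcases hmem f hf with rfl | h'
      · rfl
      · rcases Sym2.mem_iff.1 hpe with rfl | rfl
        · exact absurd hpf h'.2.2.2
        · exact absurd hpf h'.2.1
      · rcases Sym2.mem_iff.1 hpf with rfl | rfl
        · exact absurd hpe h.2.2.2
        · exact absurd hpe h.2.1
      · exact odd.matching e h.1 f h'.1 p hpe hpf
    · rintro p ⟨hp, hp'⟩
      have hpu : p ≠ u := fun h =>
        hp' _ (Finset.mem_insert_self _ _) (h ▸ Sym2.mem_mk_left _ _)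
      have hpa : p ≠ a := fun h =>
        hp' _ (Finset.mem_insert_self _ _) (h ▸ Sym2.mem_mk_right _ _)
      have : ∃ e ∈ M, p ∈ e := by
        by_contra hnot
        push Not at hnot
        exact hpu (odd.isolated.unique ⟨hp, hnot⟩ hu)
      obtain ⟨e, he, hpe⟩ := this
      by_cases heq : e = s(a, b)
      · subst heq
        exact (Sym2.mem_iff.1 hpe).resolve_left hpa
      · exact absurd hpe (hp' e (Finset.mem_insert_of_mem (Finset.mem_erase.2 ⟨heq, he⟩)))
  exact ⟨⟨odd, hodd, s(a, b), hab, s(u, a), fun h => hu.2 _ h (Sym2.mem_mk_left _ _),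
    ⟨u, Sym2.mem_mk_left _ _, hu⟩, rfl⟩, hodd, hsub, hiso⟩

/-! ### Bookkeeping of exchanged edges on a round -/

section FinsetAlgebra

variable {α : Type*} [DecidableEq α]

theorem insert_erase_first (M : Finset α) (ent β : α) :
    insert ent (M.erase β) = (M \ ({β} ∪ ∅)) ∪ insert ent (∅ ∪ ∅) := by
  ext e
  simp only [Finset.mem_insert, Finset.mem_erase, Finset.mem_union, Finset.mem_sdiff,
    Finset.mem_singleton, Finset.notMem_empty]
  tauto

/-- One step of a round. Here `F` and `F'` stand for the blue and the red edges involved, `X` and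
`Y` for the edges of the round removed and inserted so far, `B'` and `A'` for the edges exchanged in
earlier side tours, `B` and `A` for those of the current one. As `ent` and the red edges avoid `F`,
later removals do not affect earlier insertions. -/
theorem insert_erase_middle {M X Y B B' A A' F F' : Finset α} {ent β ρ : α}
    (hF : ∀ e, e ∈ F → e ∈ F' → False) (hβ : β ∈ F) (hB : B ⊆ F) (hY : Y ⊆ F') (hA' : A' ⊆ F')
    (hA : A ⊆ F') (hent : ent ∉ F) :
    insert ρ ((((M \ (X ∪ B')) ∪ insert ent (Y ∪ A')) \ B ∪ A).erase β) =
      (M \ (insert β X ∪ (B' ∪ B))) ∪ insert ent (insert ρ Y ∪ (A' ∪ A)) := by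
  ext e
  have f₁ := hF e
  have f₂ : e = β → e ∈ F := fun h => h ▸ hβ
  have f₃ := @hB e
  have f₄ := @hY e
  have f₅ := @hA' e
  have f₆ := @hA e
  have f₇ : e = ent → e ∉ F := fun h => h ▸ hent
  simp only [Finset.mem_insert, Finset.mem_erase, Finset.mem_union, Finset.mem_sdiff]
  clear * - f₁ f₂ f₃ f₄ f₅ f₆ f₇
  grind

theorem insert_erase_final {M X Y B B' A A' : Finset α} {ent ρ : α}
    (hF : ∀ e, e ∈ X ∪ (B' ∪ B) → e ∈ insert ρ Y ∪ (A' ∪ A) → False) (hM : ent ∉ M)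
    (hent : ent ∉ insert ρ Y ∪ (A' ∪ A)) :
    insert ρ ((((M \ (X ∪ B')) ∪ insert ent (Y ∪ A')) \ B ∪ A).erase ent) =
      (M \ (X ∪ (B' ∪ B))) ∪ (insert ρ Y ∪ (A' ∪ A)) := by
  ext e
  have f₁ := hF e
  have f₂ : e = ent → e ∉ M := fun h => h ▸ hM
  have f₃ : e = ent → e ∉ insert ρ Y ∪ (A' ∪ A) := fun h => h ▸ hent
  simp only [Finset.mem_insert, Finset.mem_erase, Finset.mem_union, Finset.mem_sdiff] at *
  clear * - f₁ f₂ f₃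
  grind

end FinsetAlgebra

/-! ### Tours that recolour a set of gadgets -/

namespace RectilinearRep

variable {V C : ℕ} {Φ : Monotone3CNF V C} (R : RectilinearRep Φ)

/-- Recolour the gadgets in `D`. -/
noncomputable def recolor (D : Finset R.Gadget) (M : Finset (Sym2 Plane)) : Finset (Sym2 Plane) :=
  (M \ D.biUnion R.blue) ∪ D.biUnion R.red

/-- Starting and ending with the isolated point `u`, the gadgets in `D` can be recoloured, with one
flip per red edge and one additional flip for each gadget. -/
def Tour (E : Set (Sym2 Plane)) (u : Plane) (D : Finset R.Gadget) : Prop :=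
  ∀ M, IsState R.points E M u → D.biUnion R.blue ⊆ M →
    HasFlipSequence R.points M (R.recolor D M) (∑ g ∈ D, (R.len g + 1)) ∧
      IsState R.points E (R.recolor D M) u

theorem tour_empty (E : Set (Sym2 Plane)) (u : Plane) : R.Tour E u ∅ := by
  intro M hM _
  have : R.recolor ∅ M = M := by simp [recolor]
  rw [this]
  exact ⟨HasFlipSequence.refl _ _, hM⟩

theorem biUnion_blue_red_disjoint (D D' : Finset R.Gadget) :
    Disjoint (D.biUnion R.blue) (D'.biUnion R.red) := by
  simp only [Finset.disjoint_biUnion_left, Finset.disjoint_biUnion_right]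
  exact fun g _ h _ => R.blue_red_disjoint _ _

theorem biUnion_blue_disjoint {D D' : Finset R.Gadget} (h : Disjoint D D') :
    Disjoint (D.biUnion R.blue) (D'.biUnion R.blue) := by
  simp only [Finset.disjoint_biUnion_left, Finset.disjoint_biUnion_right]
  exact fun g hg h' hh' => R.blue_disjoint fun heq => Finset.disjoint_left.1 h hh' (heq ▸ hg)

variable {R}

/-- A tour returns to its starting point and touches no blue edges of other gadgets, so tours from
the same point can be concatenated. -/
theorem Tour.union {E : Set (Sym2 Plane)} {u : Plane} {D D' : Finset R.Gadget}
    (h : R.Tour E u D) (h' : R.Tour E u D') (hdisj : Disjoint D D') : R.Tour E u (D ∪ D') := by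
  intro M hM hsub
  rw [Finset.union_biUnion] at hsub
  obtain ⟨s₁, t₁⟩ := h M hM (Finset.union_subset_left hsub)
  have hb := R.biUnion_blue_disjoint hdisj
  have hbr := R.biUnion_blue_red_disjoint D' D
  obtain ⟨s₂, t₂⟩ := h' _ t₁ (by
    refine fun e he => Finset.mem_union_left _ (Finset.mem_sdiff.2 ⟨?_, ?_⟩)
    · exact Finset.union_subset_right hsub he
    · exact Finset.disjoint_right.1 hb he)
  have heq : R.recolor D' (R.recolor D M) = R.recolor (D ∪ D') M := by
    simp only [recolor, Finset.union_biUnion]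
    ext e
    have : e ∈ D'.biUnion R.blue → e ∉ D.biUnion R.red := fun h => Finset.disjoint_left.1 hbr h
    simp only [Finset.mem_union, Finset.mem_sdiff]
    tauto
  rw [heq] at s₂ t₂
  rw [Finset.sum_union hdisj]
  exact ⟨s₁.trans s₂, t₂⟩

/-- A cyclic enumeration of the vertices of the gadget `g`, starting with a blue edge. -/
structure IsRound (R : RectilinearRep Φ) (g : R.Gadget) (q : ℕ → Plane) : Prop where
  blue : R.blue g = (Finset.range (R.len g)).image fun j => s(q (2 * j), q (2 * j + 1))
  red : R.red g = (Finset.range (R.len g)).image fun j => s(q (2 * j + 1), q (2 * j + 2))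
  last : q (2 * R.len g) = q 0

theorem IsRound.blue_inj {g : R.Gadget} {q : ℕ → Plane} (h : IsRound R g q) {i j : ℕ}
    (hi : i < R.len g) (hj : j < R.len g)
    (heq : s(q (2 * i), q (2 * i + 1)) = s(q (2 * j), q (2 * j + 1))) : i = j := by
  have hcard : ((Finset.range (R.len g)).image fun j => s(q (2 * j), q (2 * j + 1))).card =
      (Finset.range (R.len g)).card := by
    rw [← h.blue, R.card_blue, Finset.card_range]
  exact Finset.card_image_iff.1 hcard (by simpa using hi) (by simpa using hj) heq

/-- Enter a gadget, go round it, and make tours from its vertices on the way. -/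
theorem Tour.enter {E : Set (Sym2 Plane)} (hE : ∀ e ∈ E, ∀ f ∈ E, ¬ Cross e f)
    (hred : ∀ g, ∀ e ∈ R.red g, e ∈ E) {u : Plane} {g : R.Gadget} {q : ℕ → Plane}
    (hq : IsRound R g q) (hu : s(u, q 0) ∈ E) (D : ℕ → Finset R.Gadget)
    (hD : ∀ j < R.len g, R.Tour E (q (2 * j + 1)) (D j)) (hg : ∀ j < R.len g, g ∉ D j)
    (hdisj : ∀ i < R.len g, ∀ j < R.len g, i ≠ j → Disjoint (D i) (D j)) :
    R.Tour E u (insert g ((Finset.range (R.len g)).biUnion D)) := by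
  classical
  intro M hM hsub
  set L := R.len g with hL
  have hLpos : 0 < L := by have := R.three_le_len g; omega
  set β : ℕ → Sym2 Plane := fun j => s(q (2 * j), q (2 * j + 1)) with hβ
  set ρ : ℕ → Sym2 Plane := fun j => s(q (2 * j + 1), q (2 * j + 2)) with hρ
  set ent : Sym2 Plane := s(u, q 0) with hent
  set DD : ℕ → Finset R.Gadget := fun j => (Finset.range j).biUnion D with hDD
  set B : Finset R.Gadget → Finset (Sym2 Plane) := fun D => D.biUnion R.blue with hB
  set Rd : Finset R.Gadget → Finset (Sym2 Plane) := fun D => D.biUnion R.red with hRd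
  set full := insert g (DD L) with hfull
  have hDDsub : ∀ j ≤ L, DD j ⊆ DD L := fun j hj =>
    Finset.biUnion_subset_biUnion_of_subset_left _ (Finset.range_subset_range.2 hj)
  have hDsub : ∀ j < L, D j ⊆ DD L := fun j hj =>
    Finset.subset_biUnion_of_mem D (Finset.mem_range.2 hj)
  have hgDD : g ∉ DD L := by
    simp only [hDD, Finset.mem_biUnion, Finset.mem_range, not_exists, not_and]
    exact fun j hj => hg j hj
  have hDDsucc : ∀ j, DD (j + 1) = DD j ∪ D j := by
    intro j; simp only [hDD, Finset.range_add_one, Finset.biUnion_insert, Finset.union_comm]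
  have hDDdisj : ∀ j < L, Disjoint (DD j) (D j) := by
    intro j hj
    simp only [hDD, Finset.disjoint_biUnion_left, Finset.mem_range]
    exact fun i hi => hdisj i (by omega) j hj (by omega)
  -- blue edges of the gadgets concerned, and their relation to the other edges
  have hβblue : ∀ j < L, β j ∈ R.blue g := by
    intro j hj; rw [hq.blue]; exact Finset.mem_image_of_mem _ (Finset.mem_range.2 hj)
  have hρred : ∀ j < L, ρ j ∈ R.red g := by
    intro j hj; rw [hq.red]; exact Finset.mem_image_of_mem _ (Finset.mem_range.2 hj)
  have hgM : R.blue g ⊆ M :=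
    (Finset.subset_biUnion_of_mem R.blue (Finset.mem_insert_self _ _)).trans hsub
  have hDM : B (DD L) ⊆ M :=
    (Finset.biUnion_subset_biUnion_of_subset_left _ (Finset.subset_insert _ _)).trans hsub
  -- While a gadget is blue, the isolated point is none of its vertices. Hence the entry edge is not
  -- red in any gadget concerned.
  have huvert : ∀ h : R.Gadget, R.blue h ⊆ M → ∀ j < 2 * R.len h, u ≠ R.vertex h j := by
    intro h hh j hj heq
    obtain ⟨e, he, hv⟩ := R.exists_blue_of_vertex hj
    exact hM.isolated.2 e (hh he) (heq ▸ hv)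
  have hfullM : ∀ h ∈ full, R.blue h ⊆ M := fun h hh =>
    (Finset.subset_biUnion_of_mem R.blue hh).trans hsub
  have hentred : ∀ h ∈ full, ent ∉ R.red h := by
    intro h hh he
    obtain ⟨i, hi, -, -, hui, -⟩ := R.red_ends he
    exact huvert h (hfullM h hh) i hi hui
  have hentM : ent ∉ M := fun h => hM.isolated.2 _ h (Sym2.mem_mk_left _ _)
  have hBM : ∀ e ∈ B full, e ∈ M := fun e he => hsub he
  have hBR : ∀ e, e ∈ B full → e ∈ Rd full → False := fun e h₁ h₂ =>
    Finset.disjoint_left.1 (R.biUnion_blue_red_disjoint full full) h₁ h₂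
  have hentR : ent ∉ Rd full := by
    intro h
    obtain ⟨h, hh, he⟩ := Finset.mem_biUnion.1 h
    exact hentred h hh he
  have Bmono : ∀ {X Y : Finset R.Gadget}, X ⊆ Y → B X ⊆ B Y := fun h =>
    Finset.biUnion_subset_biUnion_of_subset_left _ h
  have Rmono : ∀ {X Y : Finset R.Gadget}, X ⊆ Y → Rd X ⊆ Rd Y := fun h =>
    Finset.biUnion_subset_biUnion_of_subset_left _ h
  have subfull : ∀ {X : Finset R.Gadget}, X ⊆ DD L → X ⊆ full := fun h =>
    h.trans (Finset.subset_insert _ _)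
  have gfull : g ∈ full := Finset.mem_insert_self _ _
  have hβfull : ∀ j < L, β j ∈ B full := fun j hj =>
    Finset.mem_biUnion.2 ⟨g, gfull, hβblue j hj⟩
  have hρfull : ∀ j < L, ρ j ∈ Rd full := fun j hj =>
    Finset.mem_biUnion.2 ⟨g, gfull, hρred j hj⟩
  have hβD : ∀ j < L, β j ∉ B (DD L) := by
    intro j hj h
    obtain ⟨h, hh, he⟩ := Finset.mem_biUnion.1 h
    have hne : g ≠ h := fun heq => hgDD (heq ▸ hh)
    exact Finset.disjoint_left.1 (R.blue_disjoint hne) (hβblue j hj) he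
  -- the matching after `j` red edges
  set N : ℕ → Finset (Sym2 Plane) := fun j =>
    (M \ ((Finset.range (j + 1)).image β ∪ B (DD j))) ∪
      insert ent ((Finset.range j).image ρ ∪ Rd (DD j)) with hN
  -- a tour from the current vertex
  have htour : ∀ j < L, IsState R.points E (N j) (q (2 * j + 1)) →
      HasFlipSequence R.points (N j) (R.recolor (D j) (N j)) (∑ h ∈ D j, (R.len h + 1)) ∧
      IsState R.points E (R.recolor (D j) (N j)) (q (2 * j + 1)) := by
    intro j hj hst
    refine hD j hj (N j) hst fun e he => ?_
    have he' : e ∈ B (DD L) := Bmono (hDsub j hj) he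
    refine Finset.mem_union_left _ (Finset.mem_sdiff.2 ⟨hDM he', fun h => ?_⟩)
    rcases Finset.mem_union.1 h with h | h
    · obtain ⟨i, hi, rfl⟩ := Finset.mem_image.1 h
      exact hβD i (by have := Finset.mem_range.1 hi; omega) he'
    · exact Finset.disjoint_left.1 (R.biUnion_blue_disjoint (hDDdisj j hj)) h he
  -- The count is one entry, `j` red edges and the side tours completed so far; the side tour at `q
  -- (2 * j + 1)` is still to come.
  have hmain : ∀ j < L, HasFlipSequence R.points M (N j)
      (1 + j + ∑ h ∈ DD j, (R.len h + 1)) ∧ IsState R.points E (N j) (q (2 * j + 1)) := by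
    intro j
    induction j with
    | zero =>
      intro _
      obtain ⟨hf, hs⟩ := hM.flip hE (hgM (hβblue 0 hLpos)) hu
      have heq : insert s(u, q (2 * 0)) (M.erase s(q (2 * 0), q (2 * 0 + 1))) = N 0 := by
        have e₁ : DD 0 = ∅ := rfl
        have e₂ : B ∅ = ∅ := rfl
        have e₃ : Rd ∅ = ∅ := rfl
        simp only [hN]
        rw [e₁, e₂, e₃]
        exact insert_erase_first M ent (β 0)
      rw [heq] at hf hs
      exact ⟨by simpa [hDD] using (HasFlipSequence.refl _ _).snoc hf, hs⟩
    | succ j ih =>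
      intro hj
      have hj' : j < L := by omega
      obtain ⟨s₁, t₁⟩ := ih hj'
      obtain ⟨s₂, t₂⟩ := htour j hj' t₁
      have hsubj : DD j ⊆ full := subfull (hDDsub j hj'.le)
      have hsubD : D j ⊆ full := subfull (hDsub j hj')
      have hmem : β (j + 1) ∈ R.recolor (D j) (N j) := by
        refine Finset.mem_union_left _ (Finset.mem_sdiff.2 ⟨?_, fun h =>
          hβD (j + 1) hj (Bmono (hDsub j hj') h)⟩)
        refine Finset.mem_union_left _ (Finset.mem_sdiff.2 ⟨hgM (hβblue _ hj), fun h => ?_⟩)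
        rcases Finset.mem_union.1 h with h | h
        · obtain ⟨i, hi, heq⟩ := Finset.mem_image.1 h
          have hi' := Finset.mem_range.1 hi
          have := hq.blue_inj (by omega) hj heq
          omega
        · exact hβD (j + 1) hj (Bmono (hDDsub j hj'.le) h)
      obtain ⟨hf, hs⟩ := t₂.flip hE hmem (hred g _ (hρred j hj'))
      have heq : insert (ρ j) ((R.recolor (D j) (N j)).erase (β (j + 1))) = N (j + 1) := by
        have b₁ : B (DD j ∪ D j) = B (DD j) ∪ B (D j) := Finset.union_biUnion
        have b₂ : Rd (DD j ∪ D j) = Rd (DD j) ∪ Rd (D j) := Finset.union_biUnion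
        have b₃ : (Finset.range (j + 1 + 1)).image β =
            insert (β (j + 1)) ((Finset.range (j + 1)).image β) := by
          rw [Finset.range_add_one, Finset.image_insert]
        have b₄ : (Finset.range (j + 1)).image ρ = insert (ρ j) ((Finset.range j).image ρ) := by
          rw [Finset.range_add_one, Finset.image_insert]
        change insert (ρ j) (((N j \ B (D j)) ∪ Rd (D j)).erase (β (j + 1))) = _
        simp only [hN]
        rw [hDDsucc, b₁, b₂, b₃, b₄]
        refine insert_erase_middle hBR (hβfull _ hj) (Bmono hsubD) (fun e h => ?_) (Rmono hsubj)
          (Rmono hsubD) (fun h => hentM (hBM _ h))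
        obtain ⟨i, hi, rfl⟩ := Finset.mem_image.1 h
        exact hρfull i (by have := Finset.mem_range.1 hi; omega)
      have hf' : Flip R.points (R.recolor (D j) (N j)) (N (j + 1)) := heq ▸ hf
      refine ⟨?_, heq ▸ hs⟩
      have := (s₁.trans s₂).snoc hf'
      rw [hDDsucc, Finset.sum_union (hDDdisj j hj')]
      convert this using 1
      omega
  -- The last red edge is special: it ends in `q 0`, so the entry edge is the one removed, and `u`
  -- is isolated again.
  obtain ⟨l, hl⟩ : ∃ l, L = l + 1 := ⟨L - 1, by omega⟩
  have hlL : l < L := by omega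
  obtain ⟨s₁, t₁⟩ := hmain l hlL
  obtain ⟨s₂, t₂⟩ := htour l hlL t₁
  have hsubj : DD l ⊆ full := subfull (hDDsub l hlL.le)
  have hsubD : D l ⊆ full := subfull (hDsub l hlL)
  have hlast : q (2 * l + 2) = q 0 := by
    rw [← hq.last, ← hL, hl]; rfl
  have hρl : ρ l = s(q (2 * l + 1), q 0) := by simp only [hρ]; rw [hlast]
  have hmem : s(q 0, u) ∈ R.recolor (D l) (N l) := by
    rw [Sym2.eq_swap]
    refine Finset.mem_union_left _ (Finset.mem_sdiff.2 ⟨?_, fun h =>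
      hentM (hBM _ (Bmono hsubD h))⟩)
    exact Finset.mem_union_right _ (Finset.mem_insert_self _ _)
  obtain ⟨hf, hs⟩ := t₂.flip hE hmem (hρl ▸ hred g _ (hρred l hlL))
  rw [← hρl, Sym2.eq_swap (a := q 0)] at hf hs
  have heq : insert (ρ l) ((R.recolor (D l) (N l)).erase ent) = R.recolor full M := by
    have b₀ : DD L = DD l ∪ D l := by rw [hl, hDDsucc]
    have b₁ : B full = R.blue g ∪ (B (DD l) ∪ B (D l)) := by
      rw [hfull, b₀]; simp only [hB, Finset.biUnion_insert, Finset.union_biUnion]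
    have b₂ : Rd full = R.red g ∪ (Rd (DD l) ∪ Rd (D l)) := by
      rw [hfull, b₀]; simp only [hRd, Finset.biUnion_insert, Finset.union_biUnion]
    have b₃ : (Finset.range (l + 1)).image β = R.blue g := by rw [hq.blue, ← hL, hl]
    have b₄ : R.red g = insert (ρ l) ((Finset.range l).image ρ) := by
      rw [hq.red, ← hL, hl, Finset.range_add_one, Finset.image_insert]
    change insert (ρ l) (((N l \ B (D l)) ∪ Rd (D l)).erase ent) = (M \ B full) ∪ Rd full
    simp only [hN]
    rw [b₃]
    rw [b₂, b₄] at hBR hentR ⊢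
    rw [b₁] at hBR ⊢
    exact insert_erase_final hBR hentM hentR
  have hf' : Flip R.points (R.recolor (D l) (N l)) (R.recolor full M) := heq ▸ hf
  refine ⟨?_, heq ▸ hs⟩
  have := (s₁.trans s₂).snoc hf'
  have b₀ : DD L = DD l ∪ D l := by rw [hl, hDDsucc]
  rw [Finset.sum_insert hgDD, b₀, Finset.sum_union (hDDdisj l hlL)]
  convert this using 1
  omega

end RectilinearRep

/-! ### Rounds of gadgets -/

theorem Cross.symm {e f : Sym2 Plane} (h : Cross e f) : Cross f e := by
  obtain ⟨hne, z, ⟨h₁, h₂⟩, hz⟩ := h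
  exact ⟨hne.symm, z, ⟨h₂, h₁⟩, fun ⟨a, b⟩ => hz ⟨b, a⟩⟩

namespace RectilinearRep

variable {V C : ℕ} {Φ : Monotone3CNF V C} (R : RectilinearRep Φ)

/-- The parity of `f` gives the inclusion in the right colour class, and injectivity gives equality
by counting. -/
theorem isRound_of_index {g : R.Gadget} {q : ℕ → Plane} (f : ℕ → ℕ)
    (hf : ∀ n < 2 * R.len g, f n < 2 * R.len g ∧ f n % 2 = n % 2 ∧
      s(q n, q (n + 1)) = R.cycleEdge g (f n))
    (hinj : ∀ m < 2 * R.len g, ∀ n < 2 * R.len g, f m = f n → m = n)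
    (hlast : q (2 * R.len g) = q 0) : IsRound R g q := by
  refine ⟨(Finset.eq_of_subset_of_card_le ?_ ?_).symm,
    (Finset.eq_of_subset_of_card_le ?_ ?_).symm, hlast⟩
  · intro e he
    obtain ⟨j, hj, rfl⟩ := Finset.mem_image.1 he
    have hj' := Finset.mem_range.1 hj
    obtain ⟨h₁, h₂, h₃⟩ := hf (2 * j) (by omega)
    exact R.mem_blue.2 ⟨f (2 * j) / 2, by omega, h₃.trans (by congr 1; omega)⟩
  · rw [R.card_blue, Finset.card_image_of_injOn, Finset.card_range]
    intro i hi j hj hij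
    simp only [Finset.coe_range, Set.mem_Iio] at hi hj
    obtain ⟨h₁, -, h₂⟩ := hf (2 * i) (by omega)
    obtain ⟨h₃, -, h₄⟩ := hf (2 * j) (by omega)
    have := hinj _ (by omega) _ (by omega)
      (R.cycleEdge_inj h₁ h₃ (h₂.symm.trans (Eq.trans hij h₄))).2
    omega
  · intro e he
    obtain ⟨j, hj, rfl⟩ := Finset.mem_image.1 he
    have hj' := Finset.mem_range.1 hj
    obtain ⟨h₁, h₂, h₃⟩ := hf (2 * j + 1) (by omega)
    exact R.mem_red.2 ⟨f (2 * j + 1) / 2, by omega, h₃.trans (by congr 1; omega)⟩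
  · rw [R.card_red, Finset.card_image_of_injOn, Finset.card_range]
    intro i hi j hj hij
    simp only [Finset.coe_range, Set.mem_Iio] at hi hj
    obtain ⟨h₁, -, h₂⟩ := hf (2 * i + 1) (by omega)
    obtain ⟨h₃, -, h₄⟩ := hf (2 * j + 1) (by omega)
    have := hinj _ (by omega) _ (by omega)
      (R.cycleEdge_inj h₁ h₃ (h₂.symm.trans (Eq.trans hij h₄))).2
    omega

/-- From each vertex there is a round; the isolated points on it are the vertices of the other
parity. -/
theorem exists_round (g : R.Gadget) {i₀ : ℕ} (hi₀ : i₀ < 2 * R.len g) :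
    ∃ q, IsRound R g q ∧ q 0 = R.vertex g i₀ ∧
      ∀ v < 2 * R.len g, v % 2 ≠ i₀ % 2 → ∃ j < R.len g, q (2 * j + 1) = R.vertex g v := by
  have hlen := R.three_le_len g
  suffices h : ∃ idx : ℕ → ℕ, IsRound R g (fun n => R.vertex g (idx n)) ∧ idx 0 = i₀ ∧
      ∀ n < 2 * R.len g, idx n < 2 * R.len g ∧ idx n % 2 = (i₀ + n) % 2 by
    obtain ⟨idx, hr, h₀, hpar⟩ := h
    refine ⟨_, hr, by rw [h₀], fun v hv hne => ?_⟩
    -- By parity, `v` is the second end of its blue edge on the round.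
    obtain ⟨e, he, hve⟩ := R.exists_blue_of_vertex hv
    rw [hr.blue] at he
    obtain ⟨j, hj, rfl⟩ := Finset.mem_image.1 he
    have hj' := Finset.mem_range.1 hj
    rcases Sym2.mem_iff.1 hve with h | h
    · have h₁ := (R.vertex_inj hv (hpar (2 * j) (by omega)).1 h).2
      have h₂ := (hpar (2 * j) (by omega)).2
      omega
    · exact ⟨j, hj', h.symm⟩
  -- The first edge must be blue: the round is clockwise from an even vertex and counterclockwise
  -- from an odd one.
  rcases Nat.mod_two_eq_zero_or_one i₀ with hpar | hpar
  · refine ⟨fun n => if i₀ + n < 2 * R.len g then i₀ + n else i₀ + n - 2 * R.len g,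
      R.isRound_of_index
        (fun n => if i₀ + n < 2 * R.len g then i₀ + n else i₀ + n - 2 * R.len g) ?_ ?_ ?_, ?_, ?_⟩
    · intro n hn
      refine ⟨by split_ifs <;> omega, by split_ifs <;> omega, ?_⟩
      have h : (if i₀ + (n + 1) < 2 * R.len g then i₀ + (n + 1)
          else i₀ + (n + 1) - 2 * R.len g) = if (if i₀ + n < 2 * R.len g then i₀ + n else i₀ + n - 2 * R.len g) + 1 = 2 * R.len g then 0
          else (if i₀ + n < 2 * R.len g then i₀ + n else i₀ + n - 2 * R.len g) + 1 := by split_ifs <;> omega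
      rw [cycleEdge, succ_mod (by split_ifs <;> omega), ← h]
    · intro m hm n hn h
      split_ifs at h <;> omega
    · refine congrArg (R.vertex g) ?_
      beta_reduce
      split_ifs <;> omega
    · simp [hi₀]
    · intro n hn
      dsimp only
      split_ifs <;> omega
  · refine ⟨fun n => if n ≤ i₀ then i₀ - n else i₀ + 2 * R.len g - n,
      R.isRound_of_index
        -- Counterclockwise, an edge carries the index of the vertex reached later, hence the shift
        -- by one.
        (fun n => if n + 1 ≤ i₀ then i₀ - (n + 1) else i₀ + 2 * R.len g - (n + 1)) ?_ ?_ ?_, ?_, ?_⟩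
    · intro n hn
      refine ⟨by split_ifs <;> omega, by split_ifs <;> omega, ?_⟩
      have h : (if n ≤ i₀ then i₀ - n else i₀ + 2 * R.len g - n) = if (if n + 1 ≤ i₀ then i₀ - (n + 1) else i₀ + 2 * R.len g - (n + 1)) + 1 = 2 * R.len g then 0
          else (if n + 1 ≤ i₀ then i₀ - (n + 1) else i₀ + 2 * R.len g - (n + 1)) + 1 := by split_ifs <;> omega
      rw [Sym2.eq_swap, cycleEdge, succ_mod (by split_ifs <;> omega), ← h]
    · intro m hm n hn h
      split_ifs at h <;> omega
    · refine congrArg (R.vertex g) ?_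
      beta_reduce
      split_ifs <;> omega
    · simp
    · intro n hn
      dsimp only
      split_ifs <;> omega

variable {R} in
theorem IsRound.odd_inj {g : R.Gadget} {q : ℕ → Plane} (h : IsRound R g q) {i j : ℕ}
    (hi : i < R.len g) (hj : j < R.len g) (heq : q (2 * i + 1) = q (2 * j + 1)) : i = j := by
  have hmem : ∀ i < R.len g, s(q (2 * i), q (2 * i + 1)) ∈ R.initialMatching := by
    intro i hi
    refine R.blue_subset_initialMatching g ?_
    rw [h.blue]
    exact Finset.mem_image.2 ⟨i, Finset.mem_range.2 hi, rfl⟩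
  exact h.blue_inj hi hj (R.initialMatching_isOddMatching.matching _ (hmem i hi) _ (hmem j hj)
    (q (2 * i + 1)) (Sym2.mem_mk_right _ _) (heq ▸ Sym2.mem_mk_right _ _))

/-! ### Legs and chain edges -/

/-- Index of the vertex of a gadget in column `k`, on the upper or lower side. -/
def columnIndex (g : R.Gadget) (k : ℕ) (upper : Bool) : ℕ :=
  if upper then 4 * (k - R.left g) + 1 else 2 * R.len g - 1 - (4 * (k - R.left g) + 1)

theorem columnIndex_spec (g : R.Gadget) {k : ℕ} (h₁ : R.left g ≤ k) (h₂ : k ≤ R.right g)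
    (upper : Bool) : R.columnIndex g k upper < 2 * R.len g ∧
      R.columnIndex g k upper % 2 = (if upper then 1 else 0) ∧
      R.vertex g (R.columnIndex g k upper) =
        pt (R.unit * (4 * k)) (R.rowDist * R.row g + if upper then 1 else -1) := by
  have hlen := R.len_eq g
  cases upper
  · simp only [columnIndex, Bool.false_eq_true, if_false]
    refine ⟨by omega, by omega, ?_⟩
    rw [R.vertex_lower g (by omega), pt_eq_iff, abscissa]
    refine ⟨?_, by ring⟩
    congr 1
    omega
  · simp only [columnIndex, if_true]
    refine ⟨by omega, by omega, ?_⟩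
    rw [R.vertex_upper g (by omega), pt_eq_iff, abscissa]
    refine ⟨?_, rfl⟩
    congr 1
    omega

/-- The vertex of the gadget of `x` from which the gadget of `c` is entered. -/
def foot (c : Fin C) (x : Fin V) : Plane :=
  R.vertex (Sum.inl x) (R.columnIndex (Sum.inl x) (R.leg c x) (Φ.positive c))

/-- The edge by which the gadget of `c` is entered from the gadget of `x`. -/
def legEdge (c : Fin C) (x : Fin V) : Sym2 Plane :=
  s(R.foot c x,
    R.vertex (Sum.inr c) (R.columnIndex (Sum.inr c) (R.leg c x) (!Φ.positive c)))

/-- Index of the vertex where the gadget of a variable with the given truth value is entered. -/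
def entryIndex (x : Fin V) (value : Bool) : ℕ :=
  if value then 0 else 2 * R.len (Sum.inl x) - 1

/-- Index of the vertex from where the gadget of the next variable is entered. -/
def exitIndex (x : Fin V) (value : Bool) : ℕ :=
  if value then R.len (Sum.inl x) else R.len (Sum.inl x) - 1

/-- The point from where the gadget of the `i`-th variable is entered. -/
def gate (α : Fin V → Bool) : ℕ → Plane
  | 0 => R.start
  -- The final `R.start` is only a filler for `i ≥ V`.
  | i + 1 => if h : i < V then R.vertex (Sum.inl ⟨i, h⟩) (R.exitIndex ⟨i, h⟩ (α ⟨i, h⟩)) else R.start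

/-- The edge by which the gadget of the variable `x` is entered. -/
def chainEdge (α : Fin V → Bool) (x : Fin V) : Sym2 Plane :=
  s(R.gate α x, R.vertex (Sum.inl x) (R.entryIndex x (α x)))

theorem legEdge_cases {c : Fin C} {x : Fin V} (hx : x ∈ Φ.vars c) :
    (0 < R.clauseRow c ∧ R.legEdge c x = s(pt (R.unit * (4 * R.leg c x)) 1,
      pt (R.unit * (4 * R.leg c x)) (R.rowDist * R.clauseRow c - 1))) ∨
    (R.clauseRow c < 0 ∧ R.legEdge c x = s(pt (R.unit * (4 * R.leg c x)) (-1),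
      pt (R.unit * (4 * R.leg c x)) (R.rowDist * R.clauseRow c + 1))) := by
  have hv := R.leg_var c x hx
  have hc := R.leg_clause c x hx
  have h₁ := fun b => (R.columnIndex_spec (Sum.inl x) (k := R.leg c x) hv.1 hv.2 b).2.2
  have h₂ := fun b => (R.columnIndex_spec (Sum.inr c) (k := R.leg c x) hc.1 hc.2 b).2.2
  rw [legEdge, foot, h₁, h₂]
  cases hp : Φ.positive c
  · exact Or.inr ⟨(R.clauseRow_neg_iff c).2 hp, by simp [row]⟩
  · exact Or.inl ⟨(R.clauseRow_pos_iff c).2 hp, by simp [row, sub_eq_add_neg]⟩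

theorem legEdge_inBox {c : Fin C} {x : Fin V} (hx : x ∈ Φ.vars c) {z : Plane}
    (hz : z ∈ edgeSegment (R.legEdge c x)) :
    ∃ y₁ y₂ : ℤ, InBox (R.unit * (4 * R.leg c x)) (R.unit * (4 * R.leg c x)) y₁ y₂ z ∧
      (0 < R.clauseRow c ∧ y₁ = 1 ∧ y₂ = R.rowDist * R.clauseRow c - 1 ∨
       R.clauseRow c < 0 ∧ y₁ = R.rowDist * R.clauseRow c + 1 ∧ y₂ = -1) := by
  have hS := R.rowDist_ge
  have hS0 : (0 : ℤ) ≤ R.rowDist := by omega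
  rcases R.legEdge_cases hx with ⟨h, heq⟩ | ⟨h, heq⟩
  · rw [heq] at hz
    have := mul_add_le_mul hS0 h
    exact ⟨1, _, inBox_of_mem hz le_rfl le_rfl le_rfl le_rfl le_rfl (by omega) (by omega) le_rfl,
      Or.inl ⟨h, rfl, rfl⟩⟩
  · rw [heq] at hz
    have := mul_add_le_mul hS0 h
    exact ⟨_, -1, inBox_of_mem hz le_rfl le_rfl le_rfl le_rfl (by omega) le_rfl le_rfl (by omega),
      Or.inr ⟨h, rfl, rfl⟩⟩

/-- A leg stays strictly between row `0` and the row of its clause. It meets no bar there by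
`eq_of_leg_mem`, passes the pieces through their gaps, and makes its own column open in all the
walls it traverses. -/
theorem legEdge_happy_disjoint {c : Fin C} {x : Fin V} (hx : x ∈ Φ.vars c) {e : Sym2 Plane}
    (he : e ∈ R.happy) {z : Plane} (hz : z ∈ edgeSegment (R.legEdge c x))
    (hze : z ∈ edgeSegment e) : False := by
  have hG := R.unit_ge
  have hS := R.rowDist_eq
  have hS0 : (0 : ℤ) ≤ R.rowDist := by omega
  obtain ⟨y₁, y₂, hbox, hy⟩ := R.legEdge_inBox hx hz
  rcases R.mem_happy.1 he with ⟨g, rfl⟩ | ⟨w, i, k, -, hi, -, rfl⟩ | ⟨w, k, -, -, hclosed, rfl⟩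
  · obtain ⟨h₁, h₂, h₃, h₄⟩ := hbox.overlap (R.bar_inBox g hze)
    have h₅ : (4 * R.leg c x : ℤ) < 4 * R.right g + 1 :=
      lt_of_mul_lt_mul_left (by omega : R.unit * (4 * R.leg c x : ℤ) < R.unit * _) (by omega)
    have h₆ : (4 * R.left g - 1 : ℤ) < 4 * R.leg c x :=
      lt_of_mul_lt_mul_left (by omega : R.unit * (4 * R.left g - 1 : ℤ) < R.unit * _) (by omega)
    have hrow : 0 < R.row g ∧ R.row g < R.clauseRow c ∨
        R.clauseRow c < R.row g ∧ R.row g < 0 := by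
      rcases hy with ⟨hc, rfl, rfl⟩ | ⟨hc, rfl, rfl⟩
      · exact Or.inl ⟨lt_of_mul_lt_mul_left (by omega : R.rowDist * 0 < R.rowDist * R.row g) hS0,
          lt_of_mul_lt_mul_left (by omega : R.rowDist * R.row g < R.rowDist * _) hS0⟩
      · refine Or.inr
          ⟨lt_of_mul_lt_mul_left (by omega : R.rowDist * R.clauseRow c < R.rowDist * _) hS0, ?_⟩
        exact lt_of_mul_lt_mul_left (by omega : R.rowDist * R.row g < R.rowDist * 0) hS0
    rcases g with y | d
    · simp only [row, Sum.elim_inl] at hrow; omega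
    · simp only [row, left, right, Sum.elim_inr] at hrow h₅ h₆
      have := R.eq_of_leg_mem hx (d := d) (by omega) (by omega) (by omega)
      subst this
      omega
  · obtain ⟨h₁, h₂, -, -⟩ := hbox.overlap (R.wallPiece_inBox w i k hze)
    have h₅ : (R.leg c x : ℤ) < k + 1 :=
      lt_of_mul_lt_mul_left (by linarith : 4 * R.unit * (R.leg c x : ℤ) < 4 * R.unit * (k + 1))
        (by omega)
    have h₆ : k < (R.leg c x : ℤ) :=
      lt_of_mul_lt_mul_left (by linarith : 4 * R.unit * k < 4 * R.unit * (R.leg c x : ℤ))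
        (by omega)
    omega
  · obtain ⟨h₁, h₂, h₃, h₄⟩ := hbox.overlap (R.plug_inBox w k hze)
    have h₅ : (R.leg c x : ℤ) < k + 1 :=
      lt_of_mul_lt_mul_left (by linarith : 4 * R.unit * (R.leg c x : ℤ) < 4 * R.unit * (k + 1))
        (by omega)
    have h₆ : k < (R.leg c x : ℤ) + 1 :=
      lt_of_mul_lt_mul_left (by linarith : 4 * R.unit * k < 4 * R.unit * ((R.leg c x : ℤ) + 1))
        (by omega)
    refine hclosed ⟨c, x, hx, by omega, ?_⟩
    rcases hy with ⟨hc, rfl, rfl⟩ | ⟨hc, rfl, rfl⟩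
    · left
      constructor
      · by_contra hlt
        have := mul_add_le_mul hS0 (not_le.1 hlt)
        omega
      · exact lt_of_mul_lt_mul_left (by omega : R.rowDist * w < R.rowDist * _) hS0
    · right
      constructor
      · by_contra hlt
        have := mul_add_le_mul hS0 (not_le.1 hlt)
        omega
      · exact lt_of_mul_lt_mul_left (by omega : R.rowDist * w < R.rowDist * 0) hS0

/-- A leg can meet cycles only in row `0` and in the row of `c`, at one of its own endpoints. This
is a lattice point and hence a vertex of the cycle edge too. -/
theorem legEdge_not_cross_cycleEdge {c : Fin C} {x : Fin V} (hx : x ∈ Φ.vars c) {g : R.Gadget}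
    {j : ℕ} (hj : j < 2 * R.len g) : ¬ Cross (R.legEdge c x) (R.cycleEdge g j) := by
  rintro ⟨-, z, ⟨hz, hz'⟩, hnot⟩
  have hG := R.unit_ge
  have hS := R.rowDist_ge
  have hS0 : (0 : ℤ) ≤ R.rowDist := by omega
  obtain ⟨y₁, y₂, hbox, hy⟩ := R.legEdge_inBox hx hz
  have hgbox := R.cycleEdge_inGadgetBox g hj hz'
  obtain ⟨h₁, h₂, h₃, h₄⟩ := hbox.overlap hgbox
  have h₅ := le_of_mul_le_mul_left h₁ (by omega)
  have h₆ := le_of_mul_le_mul_left h₂ (by omega)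
  suffices hpt : ∃ y : ℤ, z = pt (R.unit * (4 * R.leg c x)) y ∧ y ≠ R.rowDist * R.row g ∧
      pt (R.unit * (4 * R.leg c x)) y ∈ R.legEdge c x by
    obtain ⟨y, rfl, hyne, hmem⟩ := hpt
    exact hnot ⟨hmem, R.mem_cycleEdge_of_lattice g hj hz' hyne⟩
  have hbetween : ¬ (0 < R.row g ∧ R.row g < R.clauseRow c ∨
      R.clauseRow c < R.row g ∧ R.row g < 0) := by
    intro hrow
    rcases g with y | d
    · simp only [row, Sum.elim_inl] at hrow; omega
    · simp only [row, left, right, Sum.elim_inr] at hrow h₅ h₆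
      have := R.eq_of_leg_mem hx (d := d) (by omega) (by omega) (by omega)
      subst this
      omega
  rcases R.legEdge_cases hx with ⟨hc, heq⟩ | ⟨hc, heq⟩
  · obtain ⟨-, rfl, rfl⟩ := hy.resolve_right (by omega)
    have hr₁ : 0 ≤ R.row g := by
      by_contra hlt
      have := mul_add_le_mul hS0 (not_le.1 hlt)
      omega
    have hr₂ : R.row g ≤ R.clauseRow c := by
      by_contra hlt
      have := mul_add_le_mul hS0 (not_le.1 hlt)
      omega
    rcases hr₁.eq_or_lt with h | h
    · refine ⟨1, InBox.eq_pt ⟨hbox.1, hbox.2.1, hbox.2.2.1, ?_⟩, by rw [← h]; omega, ?_⟩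
      · have := hgbox.2.2.2
        rw [← h] at this
        simpa using this
      · rw [heq]; exact Sym2.mem_mk_left _ _
    · have h' : R.row g = R.clauseRow c := by omega
      refine ⟨R.rowDist * R.clauseRow c - 1,
        InBox.eq_pt ⟨hbox.1, hbox.2.1, ?_, hbox.2.2.2⟩, by rw [h']; omega, ?_⟩
      · rw [← h']; exact hgbox.2.2.1
      · rw [heq]; exact Sym2.mem_mk_right _ _
  · obtain ⟨-, rfl, rfl⟩ := hy.resolve_left (by omega)
    have hr₁ : R.row g ≤ 0 := by
      by_contra hlt
      have := mul_add_le_mul hS0 (not_le.1 hlt)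
      omega
    have hr₂ : R.clauseRow c ≤ R.row g := by
      by_contra hlt
      have := mul_add_le_mul hS0 (not_le.1 hlt)
      omega
    rcases hr₁.eq_or_lt with h | h
    · refine ⟨-1, InBox.eq_pt ⟨hbox.1, hbox.2.1, ?_, hbox.2.2.2⟩, by rw [h]; omega, ?_⟩
      · have := hgbox.2.2.1
        rw [h] at this
        simpa using this
      · rw [heq]; exact Sym2.mem_mk_left _ _
    · have h' : R.row g = R.clauseRow c := by omega
      refine ⟨R.rowDist * R.clauseRow c + 1,
        InBox.eq_pt ⟨hbox.1, hbox.2.1, hbox.2.2.1, ?_⟩, by rw [h']; omega, ?_⟩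
      · rw [← h']; exact hgbox.2.2.2
      · rw [heq]; exact Sym2.mem_mk_right _ _

/-- Legs with a common point share column and side, so the one reaching farther would run through
the bar of the nearer clause. The conclusion `c = d` suffices, since only one leg of each clause is
used. -/
theorem legEdge_disjoint {c d : Fin C} {x y : Fin V} (hx : x ∈ Φ.vars c) (hy : y ∈ Φ.vars d)
    {z : Plane} (hz : z ∈ edgeSegment (R.legEdge c x)) (hz' : z ∈ edgeSegment (R.legEdge d y)) :
    c = d := by
  have hG := R.unit_ge
  obtain ⟨_, _, hb, hs⟩ := R.legEdge_inBox hx hz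
  obtain ⟨_, _, hb', hs'⟩ := R.legEdge_inBox hy hz'
  obtain ⟨h₁, h₂, h₃, h₄⟩ := hb.overlap hb'
  have h₅ := le_of_mul_le_mul_left h₁ (by omega)
  have h₆ := le_of_mul_le_mul_left h₂ (by omega)
  have hc := R.leg_clause c x hx
  have hd := R.leg_clause d y hy
  rcases hs with ⟨hs, rfl, rfl⟩ | ⟨hs, rfl, rfl⟩ <;> rcases hs' with ⟨hs', rfl, rfl⟩ | ⟨hs', rfl, rfl⟩
  · rcases le_total (R.clauseRow c) (R.clauseRow d) with h | h
    · exact (R.eq_of_leg_mem hy (d := c) (by omega) (by omega) (by omega)).symm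
    · exact R.eq_of_leg_mem hx (d := d) (by omega) (by omega) (by omega)
  · omega
  · omega
  · rcases le_total (R.clauseRow c) (R.clauseRow d) with h | h
    · exact R.eq_of_leg_mem hx (d := d) (by omega) (by omega) (by omega)
    · exact (R.eq_of_leg_mem hy (d := c) (by omega) (by omega) (by omega)).symm

end RectilinearRep

/-! ### Chain edges between consecutive variables -/

theorem eq_left_of_fst_le {A B z : Plane} (hz : z ∈ edgeSegment s(A, B)) (hAB : A.1 < B.1)
    (h : z.1 ≤ A.1) : z = A := by
  rw [mem_edgeSegment, segment_eq_image'] at hz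
  obtain ⟨t, ht, rfl⟩ := hz
  simp only [Prod.fst_add, Prod.smul_fst, Prod.fst_sub, smul_eq_mul] at h
  have h₁ : t * (B.1 - A.1) ≤ 0 := by linarith
  have h₂ : 0 < B.1 - A.1 := by linarith
  have h₃ : t = 0 := le_antisymm (by nlinarith) ht.1
  simp [h₃]

theorem eq_right_of_le_fst {A B z : Plane} (hz : z ∈ edgeSegment s(A, B)) (hAB : A.1 < B.1)
    (h : B.1 ≤ z.1) : z = B := by
  rw [mem_edgeSegment, segment_eq_image'] at hz
  obtain ⟨t, ht, rfl⟩ := hz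
  simp only [Prod.fst_add, Prod.smul_fst, Prod.fst_sub, smul_eq_mul] at h
  have h₁ : 0 ≤ (t - 1) * (B.1 - A.1) := by linarith
  have h₂ : 0 < B.1 - A.1 := by linarith
  have h₃ : t = 1 := le_antisymm ht.2 (by nlinarith)
  simp [h₃]

namespace RectilinearRep

variable {V C : ℕ} {Φ : Monotone3CNF V C} (R : RectilinearRep Φ)

theorem entryIndex_lt (x : Fin V) (v : Bool) : R.entryIndex x v < 2 * R.len (Sum.inl x) := by
  have := R.three_le_len (Sum.inl x)
  cases v <;> simp only [entryIndex, Bool.false_eq_true, if_false, if_true] <;> omega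

theorem exitIndex_lt (x : Fin V) (v : Bool) : R.exitIndex x v < 2 * R.len (Sum.inl x) := by
  have := R.three_le_len (Sum.inl x)
  cases v <;> simp only [exitIndex, Bool.false_eq_true, if_false, if_true] <;> omega

theorem vertex_entryIndex (x : Fin V) (v : Bool) :
    R.vertex (Sum.inl x) (R.entryIndex x v) =
      pt (R.unit * (4 * R.varLeft x - 1)) (if v then 1 else -1) := by
  have := R.three_le_len (Sum.inl x)
  cases v
  · simp only [entryIndex, Bool.false_eq_true, if_false]
    rw [R.vertex_lower _ (by omega), pt_eq_iff, abscissa]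
    refine ⟨?_, by simp [row]⟩
    change (R.unit : ℤ) * (4 * R.varLeft x - 1 + _) = _
    congr 1
    omega
  · simp only [entryIndex, if_true]
    rw [R.vertex_upper _ (by omega), pt_eq_iff, abscissa]
    exact ⟨by simp [left], by simp [row]⟩

theorem vertex_exitIndex (x : Fin V) (v : Bool) :
    R.vertex (Sum.inl x) (R.exitIndex x v) =
      pt (R.unit * (4 * R.varRight x + 1)) (if v then -1 else 1) := by
  have := R.three_le_len (Sum.inl x)
  have hlen := R.len_eq (Sum.inl x)
  simp only [left, right, Sum.elim_inl] at hlen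
  cases v
  · simp only [exitIndex, Bool.false_eq_true, if_false]
    rw [R.vertex_upper _ (by omega), pt_eq_iff, abscissa]
    refine ⟨?_, by simp [row]⟩
    change (R.unit : ℤ) * (4 * R.varLeft x - 1 + _) = _
    congr 1
    omega
  · simp only [exitIndex, if_true]
    rw [R.vertex_lower _ le_rfl, pt_eq_iff, abscissa]
    refine ⟨?_, by simp [row]⟩
    change (R.unit : ℤ) * (4 * R.varLeft x - 1 + _) = _
    congr 1
    omega

/-- A common description of the edge from `start` and of the edges between gadgets: all of them lie
in the strip of row `0`, to the right of the preceding gadgets and to the left of the gadget of `x`.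
-/
theorem chainEdge_coords (α : Fin V → Bool) (x : Fin V) : ∃ a y₀ y₁ : ℤ,
    R.chainEdge α x = s(pt (R.unit * a) y₀, pt (R.unit * (4 * R.varLeft x - 1)) y₁) ∧
    a < 4 * R.varLeft x - 1 ∧ (-1 ≤ y₀ ∧ y₀ ≤ 1) ∧ (y₁ = 1 ∨ y₁ = -1) ∧
    (∀ y, y < x → 4 * (R.varRight y : ℤ) + 1 ≤ a) ∧ (a = -3 ∨ y₀ = 1 ∨ y₀ = -1) := by
  rw [chainEdge, R.vertex_entryIndex]
  have h₁ : (if α x then (1 : ℤ) else -1) = 1 ∨ (if α x then (1 : ℤ) else -1) = -1 := by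
    split_ifs <;> simp
  obtain ⟨n, hn⟩ := x
  rcases n with _ | i
  · refine ⟨-3, 0, _, ?_, by omega, by omega, h₁, fun y hy => ?_, Or.inl rfl⟩
    · simp only [gate, start]
      rw [mul_comm]
    · exact absurd hy (Nat.not_lt_zero _)
  · have hi : i < V := by omega
    have h₂ : (if α ⟨i, hi⟩ then (-1 : ℤ) else 1) = 1 ∨
      (if α ⟨i, hi⟩ then (-1 : ℤ) else 1) = -1 := by split_ifs <;> simp
    have hd := R.var_disjoint ⟨i, hi⟩ ⟨i + 1, hn⟩ (Fin.mk_lt_mk.2 (by omega))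
    refine ⟨4 * R.varRight ⟨i, hi⟩ + 1, _, _, ?_, by omega, ?_, h₁, fun y hy => ?_, Or.inr h₂⟩
    · simp only [gate, hi, dif_pos]
      rw [R.vertex_exitIndex]
    · split_ifs <;> omega
    · have hy' : y.val ≤ i := Nat.lt_succ_iff.1 hy
      rcases hy'.eq_or_lt with h | h
      · have : y = ⟨i, hi⟩ := Fin.ext h
        rw [this]
      · have h₃ := R.var_disjoint y ⟨i, hi⟩ h
        have h₄ := R.var_le ⟨i, hi⟩
        omega

theorem lt_of_varLeft_lt {x y : Fin V} (h : R.varLeft y < R.varLeft x) : y < x := by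
  by_contra hlt
  rcases (not_lt.1 hlt).eq_or_lt with rfl | h'
  · omega
  · have := R.var_disjoint x y h'
    have := R.var_le x
    omega

theorem chainEdge_happy_disjoint (α : Fin V → Bool) (x : Fin V) {e : Sym2 Plane}
    (he : e ∈ R.happy) {z : Plane} (hz : z ∈ edgeSegment (R.chainEdge α x))
    (hze : z ∈ edgeSegment e) : False := by
  have hG := R.unit_ge
  have hG0 : (0 : ℤ) ≤ R.unit := by omega
  obtain ⟨a, y₀, y₁, heq, ha, hy₀, hy₁, hprev, -⟩ := R.chainEdge_coords α x
  rw [heq] at hz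
  have hm := mul_le_mul_of_nonneg_left ha.le hG0
  have hbox : InBox (R.unit * a) (R.unit * (4 * R.varLeft x - 1)) (R.rowDist * 0 - 1)
      (R.rowDist * 0 + 1) z :=
    inBox_of_mem hz le_rfl hm hm le_rfl (by omega) (by omega) (by omega) (by omega)
  rcases R.happy_bar_or_wall he with ⟨g, rfl⟩ | hw
  · obtain ⟨h₁, h₂, h₃, h₄⟩ := hbox.overlap (R.bar_inBox g hze)
    have hrow : (0 : ℤ) = R.row g :=
      R.row_eq_of_overlap (a := 0) (b := 0) (by omega) (by omega) (by omega) (by omega)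
    rcases g with y | d
    · simp only [left, right, Sum.elim_inl] at h₁ h₂
      have h₅ : a < 4 * R.varRight y + 1 :=
        lt_of_mul_lt_mul_left (by omega : R.unit * a < R.unit * _) hG0
      have h₆ : (4 * R.varLeft y - 1 : ℤ) < 4 * R.varLeft x - 1 :=
        lt_of_mul_lt_mul_left (by omega : R.unit * (4 * R.varLeft y - 1 : ℤ) < R.unit * _) hG0
      have := hprev y (R.lt_of_varLeft_lt (by omega))
      omega
    · exact R.clauseRow_ne_zero d hrow.symm
  · exact IsWallEdge.not_inBox R hw hze hbox

theorem chainEdge_not_cross_cycleEdge (α : Fin V → Bool) (x : Fin V) {g : R.Gadget} {j : ℕ}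
    (hj : j < 2 * R.len g) : ¬ Cross (R.chainEdge α x) (R.cycleEdge g j) := by
  rintro ⟨-, z, ⟨hz, hz'⟩, hnot⟩
  have hG := R.unit_ge
  have hG0 : (0 : ℤ) ≤ R.unit := by omega
  obtain ⟨a, y₀, y₁, heq, ha, hy₀, hy₁, hprev, hy₀'⟩ := R.chainEdge_coords α x
  rw [heq] at hz hnot
  have hm := mul_add_le_mul hG0 ha
  have hlt : (pt (R.unit * a) y₀).1 < (pt (R.unit * (4 * R.varLeft x - 1)) y₁).1 := by
    simp only [pt]
    exact_mod_cast (by omega : (R.unit : ℤ) * a < R.unit * (4 * R.varLeft x - 1))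
  have hbox : InBox (R.unit * a) (R.unit * (4 * R.varLeft x - 1)) (R.rowDist * 0 - 1)
      (R.rowDist * 0 + 1) z :=
    inBox_of_mem hz le_rfl (by omega) (by omega) le_rfl (by omega) (by omega) (by omega) (by omega)
  have hgbox := R.cycleEdge_inGadgetBox g hj hz'
  obtain ⟨h₁, h₂, h₃, h₄⟩ := hbox.overlap hgbox
  have hrow : (0 : ℤ) = R.row g :=
    R.row_eq_of_overlap (a := 1) (b := 1) (by omega) (by omega) (by omega) (by omega)
  have h₅ := le_of_mul_le_mul_left h₁ (by omega)
  have h₆ := le_of_mul_le_mul_left h₂ (by omega)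
  rcases g with y | d
  · simp only [left, right, Sum.elim_inl] at h₅ h₆
    -- The gadget of `x` is touched only at the right end of the chain edge, and a preceding gadget
    -- only at its left end.
    rcases eq_or_ne y x with rfl | hne
    · obtain rfl := eq_right_of_le_fst hz hlt (by simpa [pt, left] using hgbox.1)
      exact hnot ⟨Sym2.mem_mk_right _ _,
        R.mem_cycleEdge_of_lattice _ hj hz' (by rw [← hrow]; omega)⟩
    · have hyx : y < x := by
        by_contra hge
        have := R.var_disjoint x y (lt_of_le_of_ne (not_lt.1 hge) hne.symm)
        have := R.var_le x
        omega
      have hprev' := hprev y hyx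
      have haeq : a = 4 * R.varRight y + 1 := by omega
      obtain rfl := eq_left_of_fst_le hz hlt (by
        have := hgbox.2.1
        rw [haeq]
        simpa [pt, right] using this)
      exact hnot ⟨Sym2.mem_mk_left _ _,
        R.mem_cycleEdge_of_lattice _ hj hz' (by rw [← hrow]; omega)⟩
  · exact R.clauseRow_ne_zero d hrow.symm

theorem chainEdge_disjoint (α : Fin V → Bool) {x y : Fin V} (hxy : x < y) {z : Plane}
    (hz : z ∈ edgeSegment (R.chainEdge α x)) (hz' : z ∈ edgeSegment (R.chainEdge α y)) :
    False := by
  have hG := R.unit_ge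
  have hG0 : (0 : ℤ) ≤ R.unit := by omega
  obtain ⟨a, y₀, y₁, heq, ha, hy₀, hy₁, -, -⟩ := R.chainEdge_coords α x
  obtain ⟨b, u₀, u₁, heq', hb, hu₀, hu₁, hprev, -⟩ := R.chainEdge_coords α y
  rw [heq] at hz
  rw [heq'] at hz'
  have hm := mul_le_mul_of_nonneg_left ha.le hG0
  have hm' := mul_le_mul_of_nonneg_left hb.le hG0
  have h₁ := (inBox_of_mem (y₁ := -1) (y₂ := 1) hz le_rfl hm hm le_rfl (by omega) (by omega)
    (by omega) (by omega)).overlap (inBox_of_mem (y₁ := -1) (y₂ := 1) hz' le_rfl hm' hm' le_rfl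
    (by omega) (by omega) (by omega) (by omega))
  have h₂ := le_of_mul_le_mul_left h₁.2.1 (by omega)
  have := hprev x hxy
  have := R.var_le x
  omega

/-- Columns of legs lie inside the ranges of their variables, which chain edges avoid. -/
theorem chainEdge_legEdge_disjoint (α : Fin V → Bool) (x : Fin V) {c : Fin C} {y : Fin V}
    (hy : y ∈ Φ.vars c) {z : Plane} (hz : z ∈ edgeSegment (R.chainEdge α x))
    (hz' : z ∈ edgeSegment (R.legEdge c y)) : False := by
  have hG := R.unit_ge
  have hG0 : (0 : ℤ) ≤ R.unit := by omega
  obtain ⟨a, y₀, y₁, heq, ha, hy₀, hy₁, hprev, -⟩ := R.chainEdge_coords α x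
  obtain ⟨_, _, hb, -⟩ := R.legEdge_inBox hy hz'
  rw [heq] at hz
  have hm := mul_le_mul_of_nonneg_left ha.le hG0
  have h₁ := (inBox_of_mem (y₁ := -1) (y₂ := 1) hz le_rfl hm hm le_rfl (by omega) (by omega)
    (by omega) (by omega)).overlap hb
  have h₂ := le_of_mul_le_mul_left h₁.1 (by omega)
  have h₃ := le_of_mul_le_mul_left h₁.2.1 (by omega)
  have hv := R.leg_var c y hy
  have := hprev y (R.lt_of_varLeft_lt (by omega))
  omega

/-! ### Satisfying assignments give short flip sequences -/

/-- The edges used by the flip sequence of a truth assignment `α`, where each clause `c` is entered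
from the variable `X c`. -/
def usedEdges (α : Fin V → Bool) (X : Fin C → Fin V) : Set (Sym2 Plane) :=
  {e | e ∈ R.happy ∨ (∃ g, ∃ j < 2 * R.len g, e = R.cycleEdge g j) ∨
    (∃ c, e = R.legEdge c (X c)) ∨ ∃ x, e = R.chainEdge α x}

theorem usedEdges_not_cross (α : Fin V → Bool) {X : Fin C → Fin V}
    (hX : ∀ c, X c ∈ Φ.vars c) {e f : Sym2 Plane} (he : e ∈ R.usedEdges α X)
    (hf : f ∈ R.usedEdges α X) : ¬ Cross e f := by
  intro hcross
  have disj : (∀ z, z ∈ edgeSegment e → z ∈ edgeSegment f → e ≠ f → False) → False := by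
    intro h
    obtain ⟨hne, z, hz, -⟩ := hcross
    exact h z hz.1 hz.2 hne
  rcases he with he | ⟨g, i, hi, rfl⟩ | ⟨c, rfl⟩ | ⟨x, rfl⟩ <;>
    rcases hf with hf | ⟨h, j, hj, rfl⟩ | ⟨d, rfl⟩ | ⟨y, rfl⟩
  · exact R.not_cross_happy he hf hcross
  · exact disj fun z h₁ h₂ _ => R.happy_cycleEdge_disjoint he hj h₁ h₂
  · exact disj fun z h₁ h₂ _ => R.legEdge_happy_disjoint (hX d) he h₂ h₁
  · exact disj fun z h₁ h₂ _ => R.chainEdge_happy_disjoint α y he h₂ h₁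
  · exact disj fun z h₁ h₂ _ => R.happy_cycleEdge_disjoint hf hi h₂ h₁
  · exact R.not_cross_cycleEdge hi hj hcross
  · exact R.legEdge_not_cross_cycleEdge (hX d) hi hcross.symm
  · exact R.chainEdge_not_cross_cycleEdge α y hi hcross.symm
  · exact disj fun z h₁ h₂ _ => R.legEdge_happy_disjoint (hX c) hf h₁ h₂
  · exact R.legEdge_not_cross_cycleEdge (hX c) hj hcross
  · refine disj fun z h₁ h₂ hne => hne ?_
    rw [R.legEdge_disjoint (hX c) (hX d) h₁ h₂]
  · exact disj fun z h₁ h₂ _ => R.chainEdge_legEdge_disjoint α y (hX c) h₂ h₁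
  · exact disj fun z h₁ h₂ _ => R.chainEdge_happy_disjoint α x hf h₁ h₂
  · exact R.chainEdge_not_cross_cycleEdge α x hj hcross
  · exact disj fun z h₁ h₂ _ => R.chainEdge_legEdge_disjoint α x (hX d) h₁ h₂
  · refine disj fun z h₁ h₂ hne => ?_
    rcases lt_trichotomy x y with h | rfl | h
    · exact R.chainEdge_disjoint α h h₁ h₂
    · exact hne rfl
    · exact R.chainEdge_disjoint α h h₂ h₁

theorem red_mem_usedEdges (α : Fin V → Bool) (X : Fin C → Fin V) (g : R.Gadget)
    {e : Sym2 Plane} (he : e ∈ R.red g) : e ∈ R.usedEdges α X := by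
  obtain ⟨j, hj, rfl⟩ := R.mem_red.1 he
  exact Or.inr (Or.inl ⟨g, _, by omega, rfl⟩)

theorem tour_clause (α : Fin V → Bool) {X : Fin C → Fin V} (hX : ∀ c, X c ∈ Φ.vars c)
    (c : Fin C) : R.Tour (R.usedEdges α X) (R.foot c (X c)) {Sum.inr c} := by
  have hc := R.leg_clause c (X c) (hX c)
  obtain ⟨q, hq, hq₀, -⟩ := R.exists_round (Sum.inr c)
    (R.columnIndex_spec (Sum.inr c) (k := R.leg c (X c)) hc.1 hc.2 (!Φ.positive c)).1
  have := Tour.enter (fun e he f hf => R.usedEdges_not_cross α hX he hf)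
    (fun g e he => R.red_mem_usedEdges α X g he) hq (u := R.foot c (X c))
    (by rw [hq₀]; exact Or.inr (Or.inr (Or.inl ⟨c, rfl⟩))) (fun _ => ∅)
    (fun _ _ => R.tour_empty _ _) (fun _ _ => Finset.notMem_empty _)
    (fun _ _ _ _ _ => Finset.disjoint_empty_left _)
  convert this using 1
  ext g
  simp

/-- Treating all clauses with the same foot together makes it unnecessary to show that feet are
distinct. -/
theorem tour_clauses (α : Fin V → Bool) {X : Fin C → Fin V} (hX : ∀ c, X c ∈ Φ.vars c)
    (p : Plane) (A : Finset (Fin C)) (hA : ∀ c ∈ A, R.foot c (X c) = p) :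
    R.Tour (R.usedEdges α X) p (A.image Sum.inr) := by
  induction A using Finset.induction_on with
  | empty => exact R.tour_empty _ _
  | insert c A hc ih =>
    rw [Finset.image_insert, Finset.insert_eq]
    refine Tour.union ?_ (ih fun d hd => hA d (Finset.mem_insert_of_mem hd)) ?_
    · rw [← hA c (Finset.mem_insert_self _ _)]
      exact R.tour_clause α hX c
    · simpa using hc

/-- The gadgets of the variables from the `i`-th one on, and of the clauses entered from them. -/
def gadgetsFrom (X : Fin C → Fin V) (i : ℕ) : Finset R.Gadget :=
  Finset.univ.filter fun g => i ≤ Sum.elim Fin.val (fun c => (X c).val) g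

/-- The depth-first recursion, by descending `i`: the tour of all later variables is a side tour of
the round of variable `i`, made at its exit corner, and the clauses assigned to this variable are
side tours made at their feet. -/
theorem tour_gadgetsFrom {α : Fin V → Bool} {X : Fin C → Fin V} (hX : ∀ c, X c ∈ Φ.vars c)
    (hα : ∀ c, α (X c) = Φ.positive c) {i : ℕ} (hi : i ≤ V) :
    R.Tour (R.usedEdges α X) (R.gate α i) (R.gadgetsFrom X i) := by
  classical
  induction hi using Nat.decreasingInduction with
  | self =>
    have : R.gadgetsFrom X V = ∅ := by
      rw [gadgetsFrom, Finset.filter_eq_empty_iff]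
      rintro (x | c) -
      · have := x.isLt
        simp only [Sum.elim_inl]
        omega
      · have := (X c).isLt
        simp only [Sum.elim_inr]
        omega
    rw [this]
    exact R.tour_empty _ _
  | of_succ i hi ih =>
    set x : Fin V := ⟨i, hi⟩ with hx
    obtain ⟨q, hq, hq₀, hvisit⟩ := R.exists_round (Sum.inl x) (R.entryIndex_lt x (α x))
    have hlen := R.three_le_len (Sum.inl x)
    have hlen' := R.len_eq (Sum.inl x)
    have hent : s(R.gate α i, q 0) ∈ R.usedEdges α X := by
      rw [hq₀]; exact Or.inr (Or.inr (Or.inr ⟨x, rfl⟩))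
    have hgate : R.gate α (i + 1) = R.vertex (Sum.inl x) (R.exitIndex x (α x)) := by
      simp [gate, hi, hx]
    -- Entry and exit are diagonally opposite corners. Since `len` is odd, they have different
    -- parity, so the exit is among the vertices that become isolated.
    obtain ⟨j₀, hj₀, hexit⟩ := hvisit (R.exitIndex x (α x)) (R.exitIndex_lt x (α x)) (by
      cases α x <;> simp only [exitIndex, entryIndex, Bool.false_eq_true, if_false, if_true] <;>
        omega)
    rw [← hgate] at hexit
    have hfoot : ∀ c, X c = x → ∃ j < R.len (Sum.inl x), R.foot c (X c) = q (2 * j + 1) := by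
      intro c hc
      have hv := R.leg_var c (X c) (hX c)
      have hspec := R.columnIndex_spec (Sum.inl (X c)) (k := R.leg c (X c)) hv.1 hv.2
        (Φ.positive c)
      rw [hc] at hspec
      -- A true variable is entered at the even vertex `0`, so its odd vertices become isolated,
      -- which include the feet of positive clauses; a false one is entered at an odd vertex.
      obtain ⟨j, hj, h⟩ := hvisit _ hspec.1 (by
        rw [hspec.2.1, ← hα c, hc]
        cases α x <;> simp only [entryIndex, Bool.false_eq_true, if_false, if_true] <;> omega)
      exact ⟨j, hj, by rw [h, hc]; rfl⟩
    -- The side tours at `q (2 * j + 1)`: `K j` consists of the clauses with this foot, and `T j` of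
    -- all later gadgets if this is the exit.
    set K : ℕ → Finset R.Gadget := fun j =>
      (Finset.univ.filter fun c => X c = x ∧ R.foot c (X c) = q (2 * j + 1)).image Sum.inr with hK
    set T : ℕ → Finset R.Gadget := fun j =>
      if q (2 * j + 1) = R.gate α (i + 1) then R.gadgetsFrom X (i + 1) else ∅ with hT
    have memK_inl : ∀ j y, Sum.inl y ∉ K j := by intro j y; simp [hK]
    have memK_inr : ∀ j c, Sum.inr c ∈ K j ↔ X c = x ∧ R.foot c (X c) = q (2 * j + 1) := by
      intro j c; simp [hK]
    have memT : ∀ j g, g ∈ T j ↔ q (2 * j + 1) = R.gate α (i + 1) ∧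
        i + 1 ≤ Sum.elim Fin.val (fun c => (X c).val) g := by
      intro j g
      simp only [hT]
      split_ifs with h
      · simp [h, gadgetsFrom]
      · simp [h]
    have hKT : ∀ j j', Disjoint (K j) (T j') := by
      intro j j'
      rw [Finset.disjoint_left]
      rintro (y | c) h₁ h₂
      · exact memK_inl j y h₁
      · have h₃ := ((memK_inr j c).1 h₁).1
        have h₄ := ((memT j' _).1 h₂).2
        simp only [Sum.elim_inr, h₃, hx] at h₄
        omega
    have htour := Tour.enter (fun e he f hf => R.usedEdges_not_cross α hX he hf)
      (fun g e he => R.red_mem_usedEdges α X g he) hq hent (fun j => K j ∪ T j)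
      (fun j _ => by
        refine Tour.union (R.tour_clauses α hX _ _ fun c hc => ?_) ?_ (hKT j j)
        · exact (Finset.mem_filter.1 hc).2.2
        · simp only [hT]
          split_ifs with h
          · rw [h]; exact ih
          · exact R.tour_empty _ _)
      (fun j _ h => by
        rcases Finset.mem_union.1 h with h | h
        · exact memK_inl j x h
        · have := ((memT j _).1 h).2
          simp only [Sum.elim_inl, hx] at this
          omega)
      (fun j hj j' hj' hne => by
        rw [Finset.disjoint_left]
        intro g h₁ h₂
        rcases Finset.mem_union.1 h₁ with h₁ | h₁ <;> rcases Finset.mem_union.1 h₂ with h₂ | h₂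
        · rcases g with y | c
          · exact memK_inl j y h₁
          · exact hne (hq.odd_inj hj hj'
              (((memK_inr j c).1 h₁).2.symm.trans ((memK_inr j' c).1 h₂).2))
        · exact Finset.disjoint_left.1 (hKT j j') h₁ h₂
        · exact Finset.disjoint_left.1 (hKT j' j) h₂ h₁
        · exact hne (hq.odd_inj hj hj' (((memT j g).1 h₁).1.trans ((memT j' g).1 h₂).1.symm)))
    convert htour using 1
    ext g
    simp only [gadgetsFrom, Finset.mem_filter, Finset.mem_univ, true_and, Finset.mem_insert,
      Finset.mem_biUnion, Finset.mem_range, Finset.mem_union]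
    constructor
    · intro hg
      rcases hg.eq_or_lt with heq | hlt
      · rcases g with y | c
        · exact Or.inl (by rw [hx]; exact congrArg Sum.inl (Fin.ext heq.symm))
        · have hc : X c = x := Fin.ext heq.symm
          obtain ⟨j, hj, h⟩ := hfoot c hc
          exact Or.inr ⟨j, hj, Or.inl ((memK_inr j c).2 ⟨hc, h⟩)⟩
      · exact Or.inr ⟨j₀, hj₀, Or.inr ((memT j₀ g).2 ⟨hexit, hlt⟩)⟩
    · rintro (rfl | ⟨j, hj, h | h⟩)
      · exact le_rfl
      · rcases g with y | c
        · exact absurd h (memK_inl j y)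
        · have := ((memK_inr j c).1 h).1
          simp [this, hx]
      · have := ((memT j g).1 h).2
        omega

theorem recolor_univ : R.recolor Finset.univ R.initialMatching = R.targetMatching := by
  have h : Disjoint R.happy (Finset.univ.biUnion R.blue) := by
    rw [disjoint_comm]
    simp only [Finset.disjoint_biUnion_left]
    exact fun g _ => R.blue_happy_disjoint g
  rw [recolor, initialMatching, targetMatching, Finset.union_sdiff_right,
    Finset.sdiff_eq_self_of_disjoint h]

theorem hasFlipSequence_of_satisfiable (h : Φ.Satisfiable) :
    HasFlipSequence R.points R.initialMatching R.targetMatching (∑ g, R.len g + (V + C)) := by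
  obtain ⟨α, hα⟩ := h
  choose X hX hXα using hα
  have htour := R.tour_gadgetsFrom hX hXα (Nat.zero_le V)
  have huniv : R.gadgetsFrom X 0 = Finset.univ := by simp [gadgetsFrom]
  rw [huniv] at htour
  have hstate : IsState R.points (R.usedEdges α X) R.initialMatching (R.gate α 0) := by
    refine ⟨R.initialMatching_isOddMatching, fun e he => ?_, R.initialMatching_isIsolated⟩
    rcases R.mem_initialMatching.1 he with h | ⟨g, j, hj, rfl⟩
    · exact Or.inl h
    · exact Or.inr (Or.inl ⟨g, _, by omega, rfl⟩)
  have := (htour _ hstate Finset.subset_union_right).1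
  rw [R.recolor_univ, Finset.sum_add_distrib] at this
  simpa using this

end RectilinearRep

end OddFlip

theorem mainTheorem10 {V C : ℕ} (Φ : OddFlip.Monotone3CNF V C) (R : OddFlip.RectilinearRep Φ) :
    OddFlip.IsOddMatching R.points R.initialMatching ∧
    OddFlip.IsOddMatching R.points R.targetMatching ∧
    ((∃ k : ℕ,
        (k : ℚ) = ((symmDiff R.initialMatching R.targetMatching).card : ℚ) / 2 + V + C ∧
        OddFlip.HasFlipSequence R.points R.initialMatching R.targetMatching k) ↔
      Φ.Satisfiable) := by
  refine ⟨R.initialMatching_isOddMatching, R.targetMatching_isOddMatching, ?_, fun h => ?_⟩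
  · rintro ⟨k, hk, hseq⟩
    obtain ⟨seq, u, a, b, m⟩ := R.exists_moves hseq
    refine m.satisfiable ?_
    rw [R.card_symmDiff] at hk
    push_cast at hk
    have : (k : ℚ) = ((∑ g, R.len g + (V + C) : ℕ) : ℚ) := by
      push_cast
      linarith
    exact_mod_cast this
  · refine ⟨_, ?_, R.hasFlipSequence_of_satisfiable h⟩
    rw [R.card_symmDiff]
    push_cast
    ring
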